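/- Let $C$ be a smooth complex projective curve with distinct points $p_1,\dots,p_n$, let $D=p_1+\cdots+p_n$, and let $K$ be the canonical bundle. A quasi-parabolic Higgs bundle of rank $r$ is a vector bundle $E$ of rank $r$ on $C$ with full flags $0=E_{i,0}\subset\cdots\subset E_{i,r}=E_{p_i}$ and a Higgs field $\phi\in H^0(\operatorname{End}E\otimes K(D))$ with $\phi(E_{i,j})\subset E_{i,j-1}\otimes K(D)$; it becomes a parabolic Higgs bundle (PHB) $\boldsymbol E$ on choosing weights $\alpha=(\alpha_{i,j})$ in the space $\mathcal S$ of all $\alpha$ with $1>\alpha_{i,1}>\cdots>\alpha_{i,r}\ge 0$. Its parabolic degree is $\operatorname{pdeg}\boldsymbol E=\deg E+\sum_{i,j}\alpha_{i,j}$. A sub-PHB is a $\phi$-invariant subbundle $F$ with the induced flags and weights; its discrete data are its rank, its degree and the numbers $n_{i,j}=\dim (E_{i,j}\cap F_{p_i})/(E_{i,j-1}\cap F_{p_i})\in\{0,1\}$. Stability (semistability) with respect to $\alpha$ means $\operatorname{pdeg}\boldsymbol F/\operatorname{rk}F<\operatorname{pdeg}\boldsymbol E/r$ (resp. $\le$)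 for all sub-PHBs $\boldsymbol F$ with $0<\operatorname{rk}F<r$. Fix the rank $r$ and the degree $d$. For integers $r^+,d^+,n^+_{i,j}$ with $0<r^+<r$, $n^+_{i,j}\in\{0,1\}$ and $\sum_j n^+_{i,j}=r^+$ for every $i$, the wall of $\boldsymbol d^+=(r^+,d^+,n^+_{i,j})$ is the set of $\alpha\in\mathcal S$ with $$r^+\Bigl(d+\sum_{i,j}\alpha_{i,j}\Bigr)=r\Bigl(d^++\sum_{i,j}n^+_{i,j}\alpha_{i,j}\Bigr),\qquad(*)$$ and the chambers are the connected components of the complement of all walls in $\mathcal S$. Let $\alpha^0\in\mathcal S$ lie on exactly one wall, that of $\boldsymbol d^+$; put $\boldsymbol d^-=(r-r^+,\,d-d^+,\,1-n^+_{i,j})$. Let $\Delta^+\ne\Delta^-$ be the two chambers having $\alpha^0$ in their closure, named so that $\le$ holds in $(*)$ for $\alpha\in\Delta^+$. "$\Delta^\pm$-stable" means stable for weights in $\Delta^\pm$. An extension $0\to\boldsymbol E^+\to\boldsymbol E\to\boldsymbol E^-\to0$ of PHBs is a short exact sequence of bundles in which $\boldsymbol E^+$ is a sub-PHB of $\boldsymbol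 E$ and $\boldsymbol E^-$ is the quotient, both with the induced flags, weights and Higgs fields; it splits if $\boldsymbol E\to\boldsymbol E^-$ has a right inverse that is a homomorphism of bundles which is parabolic and commutes with the Higgs fields. Then there is a neighbourhood $U$ of $\alpha^0$ in $\mathcal S$ such that the following hold. (1) Let $\boldsymbol E$ be a quasi-parabolic Higgs bundle of rank $r$ and degree $d$ which is stable with respect to some weights in $\Delta^-$ and not stable with respect to some weights in $\Delta^+$. Then $\boldsymbol E$ can be expressed as a nonsplit extension $0\to\boldsymbol E^+\to\boldsymbol E\to\boldsymbol E^-\to0$ in which $\boldsymbol E^\pm$ have discrete data $\boldsymbol d^\pm$ and are stable with respect to (the weights inherited from) all weights in $\Delta^+\cup U$. This expression is unique: any nonsplit extension expressing $\boldsymbol E$, with terms that have discrete data $\boldsymbol d^\pm$ and are stable with respect to some weights in $U$, is isomorphic to it by an isomorphism of short exact sequences which is the identity on $\boldsymbol E$. (2) Conversely, if $0\to\boldsymbol E^+\to\boldsymbol E\to\boldsymbol E^-\to0$ is a nonsplit extension with terms $\boldsymbol E^\pm$ that have discrete data $\boldsymbol d^\pm$ and are stable with respect to some weights in $U$, then $\boldsymbol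 E$ is stable with respect to all weights in $\Delta^-$, and is not even semistable with respect to any weights in $\Delta^+$. -/

import Mathlib

open AlgebraicGeometry CategoryTheory
open scoped TensorProduct KaehlerDifferential Topology

noncomputable section

namespace ParHiggs

/-! ### Curves -/

/-- A smooth complex projective curve: an integral scheme, proper over `Spec ℂ`, whose local rings
at closed points are regular of dimension one, i.e. discrete valuation rings.  (A proper curve is
projective, and over `ℂ` regular is the same as smooth.) -/
structure Curve where
  /-- the underlying scheme -/
  X : Scheme.{0}
  /-- the structure morphism -/
  str : X ⟶ Spec (CommRingCat.of ℂ)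
  [integral : IsIntegral X]
  [proper : IsProper str]
  dvr : ∀ x : X, IsClosed ({x} : Set X) → IsDiscreteValuationRing (X.presheaf.stalk x)

namespace Curve

instance (C : Curve) : IsIntegral C.X := C.integral

instance (C : Curve) : IsProper C.str := C.proper

instance (C : Curve) : IsLocallyNoetherian C.X := LocallyOfFiniteType.isLocallyNoetherian C.str

/-- The function field of the curve. -/
abbrev K (C : Curve) : Type := C.X.functionField

/-- The function field is an algebra over `ℂ` through the structure morphism. -/
instance (C : Curve) : Algebra ℂ C.K :=
  ((Scheme.ΓSpecIso (CommRingCat.of ℂ)).inv ≫ C.str.appTop ≫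
    C.X.presheaf.germ ⊤ (genericPoint C.X) trivial).hom.toAlgebra

/-- The local ring `𝒪_x` of the curve at `x`, as a subring of the function field. -/
def O (C : Curve) (x : C.X) : Subring C.K :=
  (algebraMap (C.X.presheaf.stalk x) C.X.functionField).range

/-- The maximal ideal of `𝒪_x`. -/
def m (C : Curve) (x : C.X) : Ideal (C.O x) :=
  (IsLocalRing.maximalIdeal (C.X.presheaf.stalk x)).map
    (algebraMap (C.X.presheaf.stalk x) C.X.functionField).rangeRestrict

/-- Rational differentials, i.e. the generic stalk of the canonical bundle. -/
abbrev Om (C : Curve) : Type := Ω[C.K⁄ℂ]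

/-- The stalk at `x` of the canonical bundle: the differentials generated over `𝒪_x` by the `da`
with `a ∈ 𝒪_x`. -/
def canonical (C : Curve) (x : C.X) : Submodule (C.O x) C.Om :=
  Submodule.span (C.O x) ((KaehlerDifferential.D ℂ C.K) '' (C.O x : Set C.K))

open Classical in
/-- The stalk at `x` of `K(D)`, `D` being the sum of the distinct points `p i`: differentials which
are regular at `x` if `x` is not one of the `p i`, and which become regular on multiplication by any
element of the maximal ideal (at most a simple pole) if it is. -/
def logCanonical (C : Curve) {n : ℕ} (p : Fin n → C.X) (x : C.X) : Submodule (C.O x) C.Om where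
  carrier := {w | if x ∈ Set.range p then ∀ a ∈ C.m x, a • w ∈ C.canonical x
    else w ∈ C.canonical x}
  add_mem' := by
    intro v w hv hw
    simp only [Set.mem_ofPred_eq] at *
    split_ifs at * with h
    · intro a ha
      rw [smul_add]
      exact add_mem (hv a ha) (hw a ha)
    · exact add_mem hv hw
  zero_mem' := by
    simp
  smul_mem' := by
    intro c w hw
    simp only [Set.mem_ofPred_eq] at *
    split_ifs at * with h
    · intro a ha
      rw [smul_comm]
      exact Submodule.smul_mem _ c (hw a ha)
    · exact Submodule.smul_mem _ c hw

end Curve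

/-! ### Vector bundles -/

/-- An algebraic vector bundle on `C`, that is, a locally free sheaf of `𝒪_C`-modules of finite
rank.  As `C` is integral, such a sheaf is a subsheaf of the constant sheaf on its generic stalk
`V`, and is given by its stalks `E_x ⊆ V`: the sections over a nonempty open `U` are the `v ∈ V`
which lie in `E_x` for all `x ∈ U`.  Local freeness says that every point has a neighbourhood `U`
on which the sheaf is the free `𝒪_U`-module on some basis of `V`. -/
structure VectorBundle (C : Curve) where
  /-- the generic stalk -/
  V : Type
  [grp : AddCommGroup V]
  [mod : Module C.K V]
  /-- the rank -/
  rank : ℕ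
  /-- the stalks -/
  stalk : ∀ x : C.X, Submodule (C.O x) V
  locallyFree : ∀ x : C.X, ∃ U : C.X.Opens, x ∈ U ∧ ∃ b : Module.Basis (Fin rank) C.K V,
    ∀ y ∈ U, stalk y = Submodule.span (C.O y) (Set.range b)

attribute [instance] VectorBundle.grp VectorBundle.mod

namespace VectorBundle

variable {C : Curve}

/-- A local frame of the bundle near `x`. -/
def frame (E : VectorBundle C) (x : C.X) : Module.Basis (Fin E.rank) C.K E.V :=
  (E.locallyFree x).choose_spec.2.choose

/-- A rational frame of the bundle. -/
def rationalFrame (E : VectorBundle C) : Module.Basis (Fin E.rank) C.K E.V :=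
  E.frame (genericPoint C.X)

/-- The degree: the degree of the divisor of the rational section `b₁ ∧ ⋯ ∧ b_r` of `det E`, where
`b` is a rational frame.  Its order at `x` is that of the determinant of `b` with respect to a frame
of `E` near `x`. -/
def degree (E : VectorBundle C) : ℤ :=
  ∑ᶠ x : C.X, Scheme.ord (((E.frame x).toMatrix E.rationalFrame).det : C.K) x

end VectorBundle

/-- Restriction of scalars of a linear map of generic stalks to the local ring at `x`. -/
abbrev atPt {C : Curve} {V W : Type} [AddCommGroup V] [Module C.K V] [AddCommGroup W]
    [Module C.K W] (f : V →ₗ[C.K] W) (x : C.X) : V →ₗ[C.O x] W :=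
  f.restrictScalars (C.O x)

/-- For a submodule `L` of the generic stalk of a bundle, the submodule `K(D)_x ⊗ L` of the generic
stalk of `K(D) ⊗ E`. -/
def twist {C : Curve} {n : ℕ} (p : Fin n → C.X) {V : Type} [AddCommGroup V] [Module C.K V]
    (x : C.X) (L : Submodule (C.O x) V) : Submodule (C.O x) (C.Om ⊗[C.K] V) :=
  Submodule.span (C.O x) {t | ∃ w ∈ C.logCanonical p x, ∃ v ∈ L, t = w ⊗ₜ[C.K] v}

/-! ### Parabolic Higgs bundles -/

/-- A quasi-parabolic Higgs bundle of rank `r` on `C` with distinguished points `p i`.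

The flag `0 = E_{i,0} ⊂ ⋯ ⊂ E_{i,r} = E_{p_i}` in the fibre `E_{p_i}`, which is the stalk at `p i`
modulo the maximal ideal, is recorded by the inverse images `flag i j` of the `E_{i,j}` in the
stalk (for `j > r`, `flag i j` is the whole stalk).  The Higgs field is a global section of
`End E ⊗ K(D)`: a rational section which is regular at every point. -/
structure QPHB (C : Curve) {n : ℕ} (p : Fin n → C.X) (r : ℕ) extends VectorBundle C where
  rank_eq : rank = r
  /-- the flags -/
  flag : (i : Fin n) → ℕ → Submodule (C.O (p i)) V
  flag_zero : ∀ i, flag i 0 = C.m (p i) • stalk (p i)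
  flag_lt : ∀ i j, j < r → flag i j < flag i (j + 1)
  flag_top : ∀ i j, r ≤ j → flag i j = stalk (p i)
  /-- the Higgs field -/
  higgs : V →ₗ[C.K] C.Om ⊗[C.K] V
  higgs_regular : ∀ x : C.X, ∀ v ∈ stalk x, higgs v ∈ twist p x (stalk x)
  higgs_flag : ∀ i j, j < r → ∀ v ∈ flag i (j + 1), higgs v ∈ twist p (p i) (flag i j)

/-- Systems of parabolic weights: `w i j` (for `j = 0, …, r - 1`) is the weight `α_{i,j+1}`, which
belongs to `E_{i,j+1}`. -/
abbrev Weights (n r : ℕ) : Type := Fin n → Fin r → ℝ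

/-- The space of all possible values of the weights, `1 > α_{i,1} > ⋯ > α_{i,r} ≥ 0`. -/
def weightSpace (n r : ℕ) : Set (Weights n r) :=
  {w | ∀ i, (∀ j, w i j < 1) ∧ (∀ j k, j < k → w i k < w i j) ∧ ∀ j, 0 ≤ w i j}

namespace QPHB

variable {C : Curve} {n : ℕ} {p : Fin n → C.X} {r : ℕ}

/-- The parabolic degree with respect to the weights `w`. -/
def pdeg (E : QPHB C p r) (w : Weights n r) : ℝ :=
  (E.degree : ℝ) + ∑ i, ∑ j, w i j

/-- A sub-PHB: a subbundle `F` (the stalks of `F` are those of `E` intersected with the generic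
stalk of `F`) which is invariant under the Higgs field.  It carries the induced flags. -/
structure Sub (E : QPHB C p r) extends VectorBundle C where
  /-- the inclusion -/
  incl : V →ₗ[C.K] E.V
  incl_injective : Function.Injective incl
  stalk_eq : ∀ x, (E.stalk x).comap (atPt incl x) = stalk x
  invariant : ∀ v, E.higgs (incl v) ∈ LinearMap.range (incl.lTensor C.Om)

open Classical in
/-- The number `n_{i,j+1} = dim (E_{i,j+1} ∩ F) / (E_{i,j} ∩ F) ∈ {0, 1}`. -/
def Sub.mult {E : QPHB C p r} (F : E.Sub) (i : Fin n) (j : Fin r) : ℕ :=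
  if (E.flag i j).comap (atPt F.incl (p i)) = (E.flag i (j + 1)).comap (atPt F.incl (p i))
  then 0 else 1

/-- The parabolic degree of a sub-PHB, with respect to the weights it inherits. -/
def Sub.pdeg {E : QPHB C p r} (F : E.Sub) (w : Weights n r) : ℝ :=
  (F.degree : ℝ) + ∑ i, ∑ j, (F.mult i j : ℝ) * w i j

/-- Semistability with respect to the weights `w`. -/
def IsSemistable (E : QPHB C p r) (w : Weights n r) : Prop :=
  ∀ F : E.Sub, 0 < F.rank → F.rank < r → F.pdeg w / F.rank ≤ E.pdeg w / r

/-- Stability with respect to the weights `w`. -/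
def IsStable (E : QPHB C p r) (w : Weights n r) : Prop :=
  ∀ F : E.Sub, 0 < F.rank → F.rank < r → F.pdeg w / F.rank < E.pdeg w / r

variable {s : ℕ}

/-- `f` is a homomorphism of PHBs from `E` with weights `a` to `F` with weights `b`: a homomorphism
of bundles which is parabolic (`f (E_{i,j}) ⊆ F_{i,k-1}` whenever `α_{i,j} > β_{i,k}`) and commutes
with the Higgs fields. -/
structure IsHom (E : QPHB C p r) (a : Weights n r) (F : QPHB C p s) (b : Weights n s)
    (f : E.V →ₗ[C.K] F.V) : Prop where
  stalk : ∀ x, (E.stalk x).map (atPt f x) ≤ F.stalk x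
  parabolic : ∀ i (j : Fin r) (k : Fin s), b i k < a i j →
    (E.flag i (j + 1)).map (atPt f (p i)) ≤ F.flag i k
  higgs : ∀ v, F.higgs (f v) = f.lTensor C.Om (E.higgs v)

/-- `f` is an isomorphism of quasi-parabolic Higgs bundles of the same rank. -/
structure IsIsom (E F : QPHB C p r) (f : E.V ≃ₗ[C.K] F.V) : Prop where
  stalk : ∀ x, (E.stalk x).map (atPt f.toLinearMap x) = F.stalk x
  flag : ∀ i j, (E.flag i j).map (atPt f.toLinearMap (p i)) = F.flag i j
  higgs : ∀ v, F.higgs (f v) = f.toLinearMap.lTensor C.Om (E.higgs v)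

end QPHB

/-! ### Discrete data, walls and chambers -/

/-- Discrete data `(r⁺, d⁺, n⁺_{i,j})` of a proper subbundle of a PHB of rank `r`; the numbers
`n⁺_{i,j} ∈ {0, 1}` are recorded by the sets `{j | n⁺_{i,j} = 1}`, which have `r⁺` elements. -/
structure DiscreteData (n r : ℕ) where
  /-- the rank -/
  rk : ℕ
  /-- the degree -/
  deg : ℤ
  /-- the indices of the steps of the flag at `p i` where the dimension jumps -/
  N : Fin n → Finset (Fin r)
  rk_pos : 0 < rk
  rk_lt : rk < r
  card_N : ∀ i, (N i).card = rk

namespace DiscreteData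

variable {n r : ℕ}

/-- The complementary data `(r - r⁺, d - d⁺, 1 - n⁺_{i,j})`. -/
def compl (δ : DiscreteData n r) (d : ℤ) : DiscreteData n r where
  rk := r - δ.rk
  deg := d - δ.deg
  N := fun i => (δ.N i)ᶜ
  rk_pos := Nat.sub_pos_of_lt δ.rk_lt
  rk_lt := Nat.sub_lt (lt_trans δ.rk_pos δ.rk_lt) δ.rk_pos
  card_N := fun i => by rw [Finset.card_compl, δ.card_N, Fintype.card_fin]

/-- The weights that a subbundle with discrete data `δ` inherits, in decreasing order. -/
def restrict (δ : DiscreteData n r) (w : Weights n r) : Weights n δ.rk :=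
  fun i k => w i ((δ.N i).orderEmbOfFin (δ.card_N i) k)

/-- `n_{i,1} + ⋯ + n_{i,j}`, the dimension of the intersection of `E_{i,j}` with a subbundle whose
discrete data are `δ`. -/
def count (δ : DiscreteData n r) (i : Fin n) (j : ℕ) : ℕ :=
  ((δ.N i).filter fun k : Fin r => k.val < j).card

/-- `r⁺ (d + ∑ α_{i,j})` -/
def lhs (δ : DiscreteData n r) (d : ℤ) (w : Weights n r) : ℝ :=
  δ.rk * (d + ∑ i, ∑ j, w i j)

/-- `r (d⁺ + ∑ n⁺_{i,j} α_{i,j})` -/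
def rhs (δ : DiscreteData n r) (w : Weights n r) : ℝ :=
  r * (δ.deg + ∑ i, ∑ j ∈ δ.N i, w i j)

/-- The wall determined by the discrete data `δ` (for PHBs of rank `r` and degree `d`). -/
def wall (δ : DiscreteData n r) (d : ℤ) : Set (Weights n r) :=
  {w ∈ weightSpace n r | δ.lhs d w = δ.rhs w}

end DiscreteData

/-- A chamber: a connected component of the complement of the walls in the weight space. -/
def IsChamber {n r : ℕ} (d : ℤ) (Δ : Set (Weights n r)) : Prop :=
  ∃ w ∈ weightSpace n r \ ⋃ δ : DiscreteData n r, δ.wall d,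
    Δ = connectedComponentIn (weightSpace n r \ ⋃ δ : DiscreteData n r, δ.wall d) w

/-- `w₀` is a point of the weight space lying on only one wall, namely that of `δ`; `Δp` and `Δm`
are the two chambers which every neighbourhood of `w₀` meets, named so that
`r⁺ (d + ∑ α_{i,j}) ≤ r (d⁺ + ∑ n⁺_{i,j} α_{i,j})` on `Δp`. -/
structure IsWallCrossing {n r : ℕ} (d : ℤ) (δ : DiscreteData n r) (w₀ : Weights n r)
    (Δp Δm : Set (Weights n r)) : Prop where
  mem : w₀ ∈ δ.wall d
  only : ∀ δ' : DiscreteData n r, w₀ ∈ δ'.wall d → δ'.wall d = δ.wall d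
  chamber_p : IsChamber d Δp
  chamber_m : IsChamber d Δm
  adj_p : w₀ ∈ closure Δp
  adj_m : w₀ ∈ closure Δm
  ne : Δp ≠ Δm
  sign : ∀ w ∈ Δp, δ.lhs d w ≤ δ.rhs w

/-! ### Extensions -/

variable {C : Curve} {n : ℕ} {p : Fin n → C.X} {r : ℕ}

/-- An expression of `E` as an extension `0 → E⁺ → E → E⁻ → 0` of PHBs, where the steps of the
flags of `E` (hence its weights) are distributed over `E⁺` and `E⁻` as prescribed by `δ` and its
complement.  All of `0 → E⁺_x → E_x → E⁻_x → 0` and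
`0 → E⁺_{i,a} → E_{i,j} → E⁻_{i,j-a} → 0` are exact, i.e. `E⁺` is a sub-PHB of `E` and `E⁻` is
the quotient, both with the induced flags and Higgs fields. -/
structure Extension (d : ℤ) (δ : DiscreteData n r) (E : QPHB C p r)
    (Ep : QPHB C p δ.rk) (Em : QPHB C p (δ.compl d).rk) where
  /-- the inclusion of `E⁺` -/
  inc : Ep.V →ₗ[C.K] E.V
  /-- the projection to `E⁻` -/
  proj : E.V →ₗ[C.K] Em.V
  inc_injective : Function.Injective inc
  proj_surjective : Function.Surjective proj
  exact : Function.Exact inc proj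
  stalk_inc : ∀ x, (E.stalk x).comap (atPt inc x) = Ep.stalk x
  stalk_proj : ∀ x, (E.stalk x).map (atPt proj x) = Em.stalk x
  flag_inc : ∀ i j, (E.flag i j).comap (atPt inc (p i)) = Ep.flag i (δ.count i j)
  flag_proj : ∀ i j, (E.flag i j).map (atPt proj (p i)) = Em.flag i ((δ.compl d).count i j)
  higgs_inc : ∀ v, E.higgs (inc v) = inc.lTensor C.Om (Ep.higgs v)
  higgs_proj : ∀ v, Em.higgs (proj v) = proj.lTensor C.Om (E.higgs v)

namespace Extension

variable {d : ℤ} {δ : DiscreteData n r} {E : QPHB C p r}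
  {Ep Ep' : QPHB C p δ.rk} {Em Em' : QPHB C p (δ.compl d).rk}

/-- The extension splits: the projection has a section which is a homomorphism of PHBs (for the
weights `w` on `E` and the weights inherited from them on `E⁻`). -/
def IsSplit (X : Extension d δ E Ep Em) (w : Weights n r) : Prop :=
  ∃ s : Em.V →ₗ[C.K] E.V, Em.IsHom ((δ.compl d).restrict w) E w s ∧ ∀ v, X.proj (s v) = v

/-- `E⁺` and `E⁻` have degrees `d⁺` and `d⁻ = d - d⁺` (so, with the conditions on ranks and flags
above, discrete data `δ` and its complement), and the extension does not split. -/
def IsNonsplitOfType (X : Extension d δ E Ep Em) (w : Weights n r) : Prop :=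
  Ep.degree = δ.deg ∧ Em.degree = (δ.compl d).deg ∧ ¬ X.IsSplit w

/-- Both `E⁺` and `E⁻` are stable with respect to the weights inherited from `w`. -/
def TermsStable (_X : Extension d δ E Ep Em) (w : Weights n r) : Prop :=
  Ep.IsStable (δ.restrict w) ∧ Em.IsStable ((δ.compl d).restrict w)

/-- Two expressions of `E` as an extension are the same, i.e. isomorphic by an isomorphism which is
the identity on `E`. -/
def Equivalent (X : Extension d δ E Ep Em) (X' : Extension d δ E Ep' Em') : Prop :=
  ∃ (f : Ep.V ≃ₗ[C.K] Ep'.V) (g : Em.V ≃ₗ[C.K] Em'.V), Ep.IsIsom Ep' f ∧ Em.IsIsom Em' g ∧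
    (∀ v, X'.inc (f v) = X.inc v) ∧ ∀ v, X'.proj v = g (X.proj v)

end Extension

end ParHiggs

end

open ParHiggs

/-!
For discrete data `δ` and weights `w`, put `gap δ w = r⁺ (d + ∑ w) - r (d⁺ + ∑ n⁺ w)`.  It is
affine in `w`, vanishes on the wall of `δ`, and changes sign when `δ` is replaced by the
complementary data.  A PHB `E` is stable at `w` if and only if all its proper nonzero sub-PHBs have
positive gap at `w` (`QPHB.isStable_iff`), so the theorem is a matter of comparing signs of gaps at
`w₀`, near `w₀` and in the two chambers.

Two facts about walls are used.  First, the wall of `δ` determines `δ` up to complement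
(`IsWallCrossing.eq_or_eq_compl`), so a sub-PHB whose gap vanishes at `w₀` has data `δ` or its
complement.  Secondly, there is a ball `U` around `w₀` in which every gap that is positive at `w₀`
stays larger than `r |gap δ w|` (`DiscreteData.exists_ball_lt_gap`).  It follows that `gap δ` is
negative on `Δ⁺` and positive on `Δ⁻`, and that the other gaps keep the sign that they have at `w₀`.

If `E` is stable on `Δ⁻` but not on `Δ⁺`, a destabilizing sub-PHB has gap zero at `w₀`, hence data
`δ`, and gives an extension (`exists_extension`).  Sub-PHBs of `E⁺`, and of `E⁻`, give sub-PHBs of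
`E`, whose jumps rule out the data `δ` and its complement, so their gaps at `w₀` are positive; this
makes the terms stable on `Δ⁺ ∪ U` (`GapsPos.termsStable_of_mem`,
`GapsPos.termsStable_of_gap_neg`).  The extension does not split, as the image of a splitting would
have the complementary data and destabilize `E` on `Δ⁻`.

Conversely, terms which are stable somewhere in `U` are stable at `w₀`. For a sub-PHB `G` of an
extension `E`, let `A` be its intersection with `E⁺` and `B` the saturation of its image in `E⁻`;
then `pdeg G ≤ pdeg A + pdeg B` (`Extension.exists_sub_sub`). So `E` is semistable at `w₀`, and if
the gap of `G` at `w₀` vanishes, each of `A` and `B` is zero or everything. This leaves few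
possibilities for `G`. They show that `E⁺` is the only sub-PHB of `E` with data `δ`, which is the
uniqueness (`Extension.range_inc_eq`), and that a `G` with the complementary data splits the
extension (`Extension.isSplit_of_sub`), which gives the stability of a nonsplit extension on `Δ⁻`
(`Extension.isStable_of_not_isSplit`).

All this rests on the degree being additive in exact sequences, growing with the stalks, and being
equal only if the stalks are.  A bundle is a family of lattices in its generic stalk, so these
properties follow from those of the order of a determinant at each point, once the degree is known
to be independent of the rational frame, i.e. once principal divisors have degree zero
(`Curve.finsum_ord_eq_zero`).  For the latter, the zeros of a nonconstant `f`, counted with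
multiplicity, are as many as the degree of the function field over `ℂ(f)`: they are the primes over
`f` in the integral closure of `ℂ[f]`, by the valuative criterion of properness, with their
ramification indices.  The same holds for the poles, i.e. for `1/f`.
-/

/-! ### Lattices over a local ring of the function field -/

namespace ParHiggs

/-- `v` is the order function of the local ring `R ⊆ K` of a point of a regular curve: either `R` is
a discrete valuation ring with normalized valuation `v`, or `R = K` and `v = 0`.  The value `v 0` is
not restricted beyond `0 ≤ v 0`. -/
structure LocalOrder {K : Type*} [Field K] (R : Subring K) (v : K → ℤ) : Prop where
  mul : ∀ a b, a ≠ 0 → b ≠ 0 → v (a * b) = v a + v b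
  nonneg : ∀ a ∈ R, 0 ≤ v a
  inv_mem : ∀ a ∈ R, a ≠ 0 → v a = 0 → a⁻¹ ∈ R
  pid : IsPrincipalIdealRing R
  frac : ∀ a : K, ∃ s ∈ R, s ≠ 0 ∧ s * a ∈ R

namespace LocalOrder

variable {K : Type*} [Field K] {R : Subring K} {v : K → ℤ}

lemma isFractionRing (h : LocalOrder R v) : IsFractionRing R K := by
  refine .of_field R K fun a => ?_
  obtain ⟨s, hs, hs0, hsa⟩ := h.frac a
  exact ⟨⟨_, hsa⟩, ⟨s, hs⟩, by
    change a = s * a / s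
    field_simp⟩

lemma map_one (h : LocalOrder R v) : v 1 = 0 := by
  have := h.mul 1 1 one_ne_zero one_ne_zero
  rw [one_mul] at this
  omega

lemma map_prod (h : LocalOrder R v) {ι : Type*} (s : Finset ι) (f : ι → K)
    (hf : ∀ i ∈ s, f i ≠ 0) : v (∏ i ∈ s, f i) = ∑ i ∈ s, v (f i) := by
  classical
  induction s using Finset.induction_on with
  | empty => simpa using h.map_one
  | insert a s ha ih =>
    rw [Finset.prod_insert ha, Finset.sum_insert ha, h.mul _ _ (hf a (Finset.mem_insert_self a s))
      (Finset.prod_ne_zero_iff.2 fun i hi => hf i (Finset.mem_insert_of_mem hi)),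
      ih fun i hi => hf i (Finset.mem_insert_of_mem hi)]

end LocalOrder

lemma det_mem_of_entries_mem {K ι : Type*} [Field K] [Fintype ι] [DecidableEq ι] {R : Subring K}
    {M : Matrix ι ι K} (hM : ∀ i j, M i j ∈ R) : M.det ∈ R := by
  let M' : Matrix ι ι R := fun i j => ⟨M i j, hM i j⟩
  have : M = M'.map R.subtype := rfl
  rw [this, ← RingHom.mapMatrix_apply, ← RingHom.map_det]
  exact M'.det.2

section Lattice

variable {K : Type*} [Field K] {R : Subring K} {v : K → ℤ}
variable {V : Type*} [AddCommGroup V] [Module K V]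
variable {W : Type*} [AddCommGroup W] [Module K W]
variable {Q : Type*} [AddCommGroup Q] [Module K Q]

lemma mem_span_basis_iff {ι : Type*} (c : Module.Basis ι K V) (x : V) :
    x ∈ Submodule.span R (Set.range c) ↔ ∀ i, c.repr x i ∈ R := by
  rw [Module.Basis.mem_span_iff_repr_mem]
  exact forall_congr' fun i => ⟨by rintro ⟨a, ha⟩; exact ha ▸ a.2, fun h => ⟨⟨_, h⟩, rfl⟩⟩

/-- `L` is a lattice: the `R`-span of a basis of the vector space. -/
def IsLattice (L : Submodule R V) : Prop :=
  ∃ c : Module.Basis (Fin (Module.finrank K V)) K V, L = Submodule.span R (Set.range c)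

lemma isLattice_span {ι : Type*} [Fintype ι] (c : Module.Basis ι K V) :
    IsLattice (Submodule.span R (Set.range c)) := by
  refine ⟨c.reindex (Fintype.equivFinOfCardEq (Module.finrank_eq_card_basis c).symm), ?_⟩
  rw [Module.Basis.range_reindex]

lemma IsLattice.exists_basis {L : Submodule R V} (hL : IsLattice L) {ι : Type*} [Fintype ι]
    (b : Module.Basis ι K V) : ∃ c : Module.Basis ι K V, L = Submodule.span R (Set.range c) := by
  obtain ⟨c, hc⟩ := hL
  refine ⟨c.reindex (Fintype.equivFinOfCardEq (Module.finrank_eq_card_basis b).symm).symm, ?_⟩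
  rw [Module.Basis.range_reindex, hc]

/-- Over a principal ideal domain, the lattices are the finitely generated submodules which span. -/
lemma isLattice_of_fg (h : LocalOrder R v) {L : Submodule R V} (hfg : L.FG)
    (hspan : Submodule.span K (L : Set V) = ⊤) : IsLattice L := by
  have := h.pid
  have := h.isFractionRing
  have : Module.Finite R L := Module.Finite.iff_fg.2 hfg
  have : Module.IsTorsionFree R V := Module.IsTorsionFree.trans_faithfulSMul R K V
  let b := Module.Free.chooseBasis R L
  have li : LinearIndependent R (fun i => (b i : V)) :=
    b.linearIndependent.map' L.subtype L.ker_subtype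
  have li' : LinearIndependent K (fun i => (b i : V)) :=
    (LinearIndependent.iff_fractionRing R K).1 li
  have hs : Submodule.span R (Set.range fun i => (b i : V)) = L := by
    have : (Set.range fun i => (b i : V)) = L.subtype '' Set.range b := by
      rw [← Set.range_comp]; rfl
    rw [this, Submodule.span_image, b.span_eq, Submodule.map_top, Submodule.range_subtype]
  have hK : ⊤ ≤ Submodule.span K (Set.range fun i => (b i : V)) := by
    rw [← hspan, Submodule.span_le]
    intro x hx
    rw [SetLike.mem_coe, ← hs] at hx
    exact Submodule.span_le_restrictScalars R K _ hx
  have := isLattice_span (R := R) (Module.Basis.mk li' hK)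
  rwa [Module.Basis.coe_mk, hs] at this

lemma IsLattice.fg {L : Submodule R V} (hL : IsLattice L) : L.FG := by
  obtain ⟨c, rfl⟩ := hL
  exact Submodule.fg_span (Set.finite_range _)

lemma IsLattice.span_eq_top {L : Submodule R V} (hL : IsLattice L) :
    Submodule.span K (L : Set V) = ⊤ := by
  obtain ⟨c, rfl⟩ := hL
  rw [eq_top_iff, ← c.span_eq]
  exact Submodule.span_mono Submodule.subset_span

/-- Everything is a fraction of an element of a lattice. -/
lemma exists_smul_mem_of_span_eq_top (h : LocalOrder R v) {L : Submodule R V}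
    (hspan : Submodule.span K (L : Set V) = ⊤) (x : V) : ∃ s ∈ R, s ≠ 0 ∧ s • x ∈ L := by
  have hx : x ∈ Submodule.span K (L : Set V) := hspan ▸ Submodule.mem_top
  induction hx using Submodule.span_induction with
  | mem x hx => exact ⟨1, R.one_mem, one_ne_zero, by simpa using hx⟩
  | zero => exact ⟨1, R.one_mem, one_ne_zero, by simp⟩
  | add x y _ _ hx hy =>
    obtain ⟨s, hs, hs0, hsx⟩ := hx
    obtain ⟨t, ht, ht0, hty⟩ := hy
    refine ⟨s * t, R.mul_mem hs ht, mul_ne_zero hs0 ht0, ?_⟩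
    rw [smul_add]
    refine L.add_mem ?_ ?_
    · rw [mul_comm, mul_smul]
      exact L.smul_mem (⟨t, ht⟩ : R) hsx
    · rw [mul_smul]
      exact L.smul_mem (⟨s, hs⟩ : R) hty
  | smul a x _ hx =>
    obtain ⟨s, hs, hs0, hsx⟩ := hx
    obtain ⟨t, ht, ht0, hta⟩ := h.frac a
    refine ⟨t * s, R.mul_mem ht hs, mul_ne_zero ht0 hs0, ?_⟩
    have : (t * s) • a • x = (t * a) • s • x := by simp only [smul_smul]; ring_nf
    rw [this]
    exact L.smul_mem (⟨t * a, hta⟩ : R) hsx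

lemma IsLattice.of_le (h : LocalOrder R v) {L L' : Submodule R V} (hL : IsLattice L)
    (hL' : L'.FG) (hle : L ≤ L') : IsLattice L' :=
  isLattice_of_fg h hL' <| by
    rw [eq_top_iff, ← hL.span_eq_top]
    exact Submodule.span_mono hle

lemma IsLattice.of_between (h : LocalOrder R v) {L L' L'' : Submodule R V} (hL : IsLattice L)
    (hL'' : IsLattice L'') (hle : L ≤ L') (hle' : L' ≤ L'') : IsLattice L' := by
  have := h.pid
  have : Module.Finite R L'' := Module.Finite.iff_fg.2 hL''.fg
  have : IsNoetherian R L'' := inferInstance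
  exact hL.of_le h (Submodule.FG.of_le hL''.fg hle') hle

open Classical in
/-- The degree of the lattice `L` relative to the basis `b`: the order of the determinant of `b` in
a basis of `L`.  It grows with `L`. -/
noncomputable def latDeg (v : K → ℤ) (L : Submodule R V) {ι : Type*} [Fintype ι]
    (b : Module.Basis ι K V) : ℤ :=
  if h : ∃ c : Module.Basis ι K V, L = Submodule.span R (Set.range c)
  then v (h.choose.toMatrix b).det else 0

lemma det_toMatrix_ne_zero {ι : Type*} [Fintype ι] [DecidableEq ι] (b c : Module.Basis ι K V) :
    (c.toMatrix b).det ≠ 0 := by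
  intro h0
  have := congrArg Matrix.det (c.toMatrix_mul_toMatrix_flip b)
  rw [Matrix.det_mul, h0, zero_mul, Matrix.det_one] at this
  exact zero_ne_one this

lemma map_det_toMatrix (h : LocalOrder R v) {ι : Type*} [Fintype ι] [DecidableEq ι]
    (a b c : Module.Basis ι K V) :
    v (a.toMatrix c).det = v (a.toMatrix b).det + v (b.toMatrix c).det := by
  rw [← h.mul _ _ (det_toMatrix_ne_zero _ _) (det_toMatrix_ne_zero _ _), ← Matrix.det_mul,
    Module.Basis.toMatrix_mul_toMatrix]

lemma toMatrix_mem_of_span_le {ι : Type*} {c c' : Module.Basis ι K V}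
    (hle : Submodule.span R (Set.range c) ≤ Submodule.span R (Set.range c')) (i j : ι) :
    c'.toMatrix c i j ∈ R :=
  (mem_span_basis_iff c' (c j)).1 (hle (Submodule.subset_span ⟨j, rfl⟩)) i

lemma span_le_of_toMatrix_mem {ι : Type*} {c c' : Module.Basis ι K V}
    (hm : ∀ i j, c'.toMatrix c i j ∈ R) :
    Submodule.span R (Set.range c) ≤ Submodule.span R (Set.range c') := by
  rw [Submodule.span_le]
  rintro _ ⟨j, rfl⟩
  exact (mem_span_basis_iff c' (c j)).2 fun i => hm i j

lemma map_det_toMatrix_nonneg (h : LocalOrder R v) {ι : Type*} [Fintype ι] [DecidableEq ι]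
    {c c' : Module.Basis ι K V}
    (hle : Submodule.span R (Set.range c) ≤ Submodule.span R (Set.range c')) :
    0 ≤ v (c'.toMatrix c).det :=
  h.nonneg _ (det_mem_of_entries_mem (toMatrix_mem_of_span_le hle))

lemma span_eq_of_map_det_eq_zero (h : LocalOrder R v) {ι : Type*} [Fintype ι] [DecidableEq ι]
    {c c' : Module.Basis ι K V}
    (hle : Submodule.span R (Set.range c) ≤ Submodule.span R (Set.range c'))
    (h0 : v (c'.toMatrix c).det = 0) :
    Submodule.span R (Set.range c) = Submodule.span R (Set.range c') := by
  refine le_antisymm hle (span_le_of_toMatrix_mem fun i j => ?_)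
  let M : Matrix ι ι R := fun i j => ⟨c'.toMatrix c i j, toMatrix_mem_of_span_le hle i j⟩
  have hM : c'.toMatrix c = M.map R.subtype := rfl
  have hdet : (c'.toMatrix c).det = R.subtype M.det := by
    rw [hM, RingHom.map_det, RingHom.mapMatrix_apply]
  have hu : IsUnit M.det := by
    have hmem := h.inv_mem _ M.det.2 (by
      have := det_toMatrix_ne_zero c c'
      rwa [hdet] at this) (by rw [hdet] at h0; exact h0)
    refine IsUnit.of_mul_eq_one ⟨_, hmem⟩ (Subtype.ext ?_)
    refine mul_inv_cancel₀ ?_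
    have := det_toMatrix_ne_zero c c'
    rwa [hdet] at this
  have hinv : (M⁻¹).map R.subtype * c'.toMatrix c = 1 := by
    rw [hM, ← Matrix.map_mul, Matrix.nonsing_inv_mul _ hu]
    simp
  have : c.toMatrix c' = (M⁻¹).map R.subtype := by
    rw [← mul_one (Matrix.map _ _), ← c'.toMatrix_mul_toMatrix_flip c, ← mul_assoc, hinv, one_mul]
  rw [this]
  exact (M⁻¹ i j).2

lemma latDeg_eq (h : LocalOrder R v) {ι : Type*} [Fintype ι] [DecidableEq ι]
    (b c : Module.Basis ι K V) {L : Submodule R V} (hL : L = Submodule.span R (Set.range c)) :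
    latDeg v L b = v (c.toMatrix b).det := by
  have hex : ∃ c : Module.Basis ι K V, L = Submodule.span R (Set.range c) := ⟨c, hL⟩
  rw [latDeg, dif_pos hex]
  have key : ∀ c c' : Module.Basis ι K V, Submodule.span R (Set.range c) =
      Submodule.span R (Set.range c') → v (c'.toMatrix b).det ≥ v (c.toMatrix b).det := by
    intro c c' he
    rw [map_det_toMatrix h c' c b]
    have := map_det_toMatrix_nonneg h he.le
    omega
  have hc := hex.choose_spec
  convert le_antisymm (key _ _ (hc.symm.trans hL)) (key _ _ (hL.symm.trans hc)) using 3

lemma latDeg_change (h : LocalOrder R v) {ι : Type*} [Fintype ι] [DecidableEq ι]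
    {L : Submodule R V} (hL : IsLattice L) (b b' : Module.Basis ι K V) :
    latDeg v L b' = latDeg v L b + v (b.toMatrix b').det := by
  obtain ⟨c, hc⟩ := hL.exists_basis b
  rw [latDeg_eq h b c hc, latDeg_eq h b' c hc, map_det_toMatrix h c b b']

lemma latDeg_mono (h : LocalOrder R v) {ι : Type*} [Fintype ι] {L L' : Submodule R V}
    (hL : IsLattice L) (hL' : IsLattice L') (hle : L ≤ L') (b : Module.Basis ι K V) :
    latDeg v L b ≤ latDeg v L' b := by
  classical
  obtain ⟨c, hc⟩ := hL.exists_basis b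
  obtain ⟨c', hc'⟩ := hL'.exists_basis b
  rw [latDeg_eq h b c hc, latDeg_eq h b c' hc', map_det_toMatrix h c' c b]
  have := map_det_toMatrix_nonneg h (hc ▸ hc' ▸ hle)
  omega

lemma eq_of_latDeg_eq (h : LocalOrder R v) {ι : Type*} [Fintype ι] {L L' : Submodule R V}
    (hL : IsLattice L) (hL' : IsLattice L') (hle : L ≤ L') (b : Module.Basis ι K V)
    (heq : latDeg v L b = latDeg v L' b) : L = L' := by
  classical
  obtain ⟨c, hc⟩ := hL.exists_basis b
  obtain ⟨c', hc'⟩ := hL'.exists_basis b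
  rw [latDeg_eq h b c hc, latDeg_eq h b c' hc', map_det_toMatrix h c' c b] at heq
  rw [hc, hc']
  exact span_eq_of_map_det_eq_zero h (hc ▸ hc' ▸ hle) (by omega)

/-- Transport of the degree along a linear isomorphism. -/
lemma latDeg_map_equiv (h : LocalOrder R v) {ι : Type*} [Fintype ι] {L : Submodule R V}
    (hL : IsLattice L) (b : Module.Basis ι K V) (e : V ≃ₗ[K] W) :
    IsLattice (L.map (e.toLinearMap.restrictScalars R)) ∧
      latDeg v (L.map (e.toLinearMap.restrictScalars R)) (b.map e) = latDeg v L b := by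
  classical
  obtain ⟨c, hc⟩ := hL.exists_basis b
  have hc' : L.map (e.toLinearMap.restrictScalars R) = Submodule.span R (Set.range (c.map e)) := by
    rw [hc, Submodule.map_span, ← Set.range_comp]
    rfl
  refine ⟨hc' ▸ isLattice_span _, ?_⟩
  rw [latDeg_eq h b c hc, latDeg_eq h _ _ hc']
  congr 2
  ext i j
  simp [Module.Basis.toMatrix_apply]

open scoped Pointwise in
/-- Multiplication of a lattice by an element of order one lowers its degree by the rank. -/
lemma latDeg_smul (h : LocalOrder R v) {ι : Type*} [Fintype ι] {L : Submodule R V}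
    (hL : IsLattice L) (b : Module.Basis ι K V) {I : Ideal R} {π : R} (hI : I = Ideal.span {π})
    (hπ0 : (π : K) ≠ 0) (hπ : v π = 1) :
    IsLattice (I • L) ∧ latDeg v (I • L) b = latDeg v L b - Fintype.card ι := by
  classical
  obtain ⟨c, hc⟩ := hL.exists_basis b
  let u : Kˣ := Units.mk0 _ hπ0
  have hc' : I • L = Submodule.span R (Set.range (c.unitsSMul fun _ => u)) := by
    rw [hI, Submodule.ideal_span_singleton_smul, hc]
    have : (Set.range (c.unitsSMul fun _ => u)) = π • Set.range c := by
      ext x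
      simp only [Set.mem_range, Module.Basis.unitsSMul_apply, Set.mem_smul_set]
      constructor
      · rintro ⟨i, rfl⟩
        exact ⟨c i, ⟨i, rfl⟩, rfl⟩
      · rintro ⟨_, ⟨i, rfl⟩, rfl⟩
        exact ⟨i, rfl⟩
    rw [this, Submodule.span_smul]
  refine ⟨hc' ▸ isLattice_span _, ?_⟩
  have h1 := map_det_toMatrix h c (c.unitsSMul fun _ => u) b
  have h2 : v (c.toMatrix (c.unitsSMul fun _ => u)).det = Fintype.card ι := by
    have : c.toMatrix (c.unitsSMul fun _ => u) = Matrix.diagonal fun _ => (π : K) := by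
      rw [Module.Basis.toMatrix_unitsSMul]
      rfl
    rw [this, Matrix.det_diagonal, h.map_prod _ _ fun _ _ => hπ0]
    simp [hπ]
  rw [latDeg_eq h b c hc, latDeg_eq h _ _ hc']
  omega

end Lattice

end ParHiggs

/-! ### Lattices in exact sequences -/

namespace ParHiggs

section Exact

variable {K : Type*} [Field K] {R : Subring K} {v : K → ℤ}
variable {V : Type*} [AddCommGroup V] [Module K V]
variable {W : Type*} [AddCommGroup W] [Module K W]
variable {Q : Type*} [AddCommGroup Q] [Module K Q]

/-- A short exact sequence `0 → W → V → Q → 0` of vector spaces. -/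
structure ShortExactSeq (inc : W →ₗ[K] V) (proj : V →ₗ[K] Q) : Prop where
  inj : Function.Injective inc
  surj : Function.Surjective proj
  exact : Function.Exact inc proj

namespace ShortExactSeq

variable {inc : W →ₗ[K] V} {proj : V →ₗ[K] Q}

/-- The decomposition of `V` given by a section of the projection. -/
noncomputable def splitting (S : ShortExactSeq inc proj) (s : Q →ₗ[K] V)
    (hs : ∀ q, proj (s q) = q) : (W × Q) ≃ₗ[K] V :=
  LinearEquiv.ofBijective (inc.coprod s) <| by
    constructor
    · rw [← LinearMap.ker_eq_bot, eq_bot_iff]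
      rintro ⟨w, q⟩ h
      have h' : inc w + s q = 0 := by simpa using h
      have hq : q = 0 := by
        have := congrArg proj h'
        simpa [hs, S.exact.apply_apply_eq_zero] using this
      subst hq
      have : inc w = inc 0 := by simpa using h'
      simpa using S.inj this
    · intro x
      obtain ⟨w, hw⟩ := (S.exact (x - s (proj x))).1 (by simp [hs])
      exact ⟨(w, proj x), by simp [hw]⟩

@[simp] lemma splitting_apply (S : ShortExactSeq inc proj) (s : Q →ₗ[K] V)
    (hs : ∀ q, proj (s q) = q) (z : W × Q) : S.splitting s hs z = inc z.1 + s z.2 := rfl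

lemma splitting_symm_inc (S : ShortExactSeq inc proj) (s : Q →ₗ[K] V)
    (hs : ∀ q, proj (s q) = q) (w : W) : (S.splitting s hs).symm (inc w) = (w, 0) := by
  rw [LinearEquiv.symm_apply_eq]
  simp

lemma splitting_symm_snd (S : ShortExactSeq inc proj) (s : Q →ₗ[K] V)
    (hs : ∀ q, proj (s q) = q) (x : V) : ((S.splitting s hs).symm x).2 = proj x := by
  obtain ⟨⟨w, q⟩, rfl⟩ := (S.splitting s hs).surjective x
  rw [LinearEquiv.symm_apply_apply]
  simp [hs, S.exact.apply_apply_eq_zero]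

lemma inc_splitting_symm_fst (S : ShortExactSeq inc proj) (s : Q →ₗ[K] V)
    (hs : ∀ q, proj (s q) = q) (x : V) :
    inc ((S.splitting s hs).symm x).1 = x - s (proj x) := by
  obtain ⟨⟨w, q⟩, rfl⟩ := (S.splitting s hs).surjective x
  rw [LinearEquiv.symm_apply_apply]
  simp [hs, S.exact.apply_apply_eq_zero]

variable {ι κ : Type*}

/-- The basis of `V` consisting of a basis of `W` and lifts `u` of a basis of `Q`. -/
noncomputable def sumBasis (S : ShortExactSeq inc proj) (b' : Module.Basis ι K W)
    (b'' : Module.Basis κ K Q) (u : κ → V) (hu : ∀ i, proj (u i) = b'' i) :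
    Module.Basis (ι ⊕ κ) K V :=
  (b'.prod b'').map <| S.splitting (b''.constr K u) fun q => by
    have : proj ∘ₗ b''.constr K u = LinearMap.id := b''.ext fun i => by simp [hu]
    exact LinearMap.congr_fun this q

section
variable (S : ShortExactSeq inc proj) (b' : Module.Basis ι K W) (b'' : Module.Basis κ K Q)
  (u : κ → V) (hu : ∀ i, proj (u i) = b'' i)

@[simp] lemma sumBasis_inl (i : ι) : S.sumBasis b' b'' u hu (.inl i) = inc (b' i) := by
  simp [sumBasis]

@[simp] lemma sumBasis_inr (i : κ) : S.sumBasis b' b'' u hu (.inr i) = u i := by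
  simp [sumBasis]

lemma sumBasis_repr_inr (x : V) (i : κ) :
    (S.sumBasis b' b'' u hu).repr x (.inr i) = b''.repr (proj x) i := by
  simp [sumBasis, splitting_symm_snd]

lemma sumBasis_repr_inc_inl (w : W) (i : ι) :
    (S.sumBasis b' b'' u hu).repr (inc w) (.inl i) = b'.repr w i := by
  simp [sumBasis, splitting_symm_inc]

lemma det_sumBasis_toMatrix [Fintype ι] [Fintype κ] [DecidableEq ι] [DecidableEq κ]
    (c' : Module.Basis ι K W) (c'' : Module.Basis κ K Q)
    (t : κ → V) (ht : ∀ i, proj (t i) = c'' i) :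
    ((S.sumBasis c' c'' t ht).toMatrix (S.sumBasis b' b'' u hu)).det =
      (c'.toMatrix b').det * (c''.toMatrix b'').det := by
  have : (S.sumBasis c' c'' t ht).toMatrix (S.sumBasis b' b'' u hu) =
      Matrix.fromBlocks (c'.toMatrix b')
        (Matrix.of fun i j => (S.sumBasis c' c'' t ht).repr (u j) (.inl i)) 0
        (c''.toMatrix b'') := by
    ext (i | i) (j | j)
    · simp [Module.Basis.toMatrix_apply, sumBasis_repr_inc_inl]
    · simp [Module.Basis.toMatrix_apply]
    · simp [Module.Basis.toMatrix_apply, sumBasis_repr_inr, S.exact.apply_apply_eq_zero]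
    · simp [Module.Basis.toMatrix_apply, sumBasis_repr_inr, hu]
  rw [this, Matrix.det_fromBlocks_zero₂₁]

lemma comap_span_sumBasis :
    (Submodule.span R (Set.range (S.sumBasis b' b'' u hu))).comap (inc.restrictScalars R) =
      Submodule.span R (Set.range b') := by
  ext w
  rw [Submodule.mem_comap, mem_span_basis_iff, mem_span_basis_iff]
  simp [sumBasis_repr_inc_inl, sumBasis_repr_inr, S.exact.apply_apply_eq_zero, R.zero_mem]

lemma map_span_sumBasis :
    (Submodule.span R (Set.range (S.sumBasis b' b'' u hu))).map (proj.restrictScalars R) =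
      Submodule.span R (Set.range b'') := by
  refine le_antisymm ?_ ?_
  · rw [Submodule.map_span_le]
    rintro _ ⟨i | i, rfl⟩
    · simp [S.exact.apply_apply_eq_zero]
    · simpa [hu] using Submodule.subset_span (Set.mem_range_self i)
  · rw [Submodule.span_le]
    rintro _ ⟨i, rfl⟩
    exact ⟨u i, Submodule.subset_span ⟨.inr i, by simp⟩, hu i⟩

end

lemma isLattice_comap (S : ShortExactSeq inc proj) (h : LocalOrder R v)
    {L : Submodule R V} (hL : IsLattice L) :
    IsLattice (L.comap (inc.restrictScalars R)) := by
  have := h.pid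
  have : Module.Finite R L := Module.Finite.iff_fg.2 hL.fg
  refine isLattice_of_fg h ?_ ?_
  · refine Submodule.fg_of_fg_map_injective (inc.restrictScalars R) S.inj ?_
    exact Submodule.FG.of_le hL.fg (Submodule.map_comap_le _ _)
  · rw [eq_top_iff]
    intro w _
    obtain ⟨s, hs, hs0, hsw⟩ := exists_smul_mem_of_span_eq_top h hL.span_eq_top (inc w)
    have : w = s⁻¹ • s • w := by rw [smul_smul, inv_mul_cancel₀ hs0, one_smul]
    rw [this]
    refine Submodule.smul_mem _ _ (Submodule.subset_span ?_)
    change inc (s • w) ∈ L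
    rwa [map_smul]

lemma isLattice_map (S : ShortExactSeq inc proj) (h : LocalOrder R v)
    {L : Submodule R V} (hL : IsLattice L) :
    IsLattice (L.map (proj.restrictScalars R)) := by
  refine isLattice_of_fg h (hL.fg.map _) ?_
  rw [Submodule.map_coe]
  change Submodule.span K (proj '' L) = ⊤
  rw [Submodule.span_image, hL.span_eq_top, Submodule.map_top, LinearMap.range_eq_top.2 S.surj]

/-- A lattice has a basis adapted to a given exact sequence. -/
lemma exists_adapted_basis (S : ShortExactSeq inc proj) (h : LocalOrder R v)
    {L : Submodule R V} (hL : IsLattice L) [Fintype ι] [Fintype κ]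
    (e' : Module.Basis ι K W) (e'' : Module.Basis κ K Q) :
    ∃ (c' : Module.Basis ι K W) (c'' : Module.Basis κ K Q) (t : κ → V)
      (ht : ∀ i, proj (t i) = c'' i),
      L = Submodule.span R (Set.range (S.sumBasis c' c'' t ht)) := by
  obtain ⟨c', hc'⟩ := (S.isLattice_comap h hL).exists_basis e'
  obtain ⟨c'', hc''⟩ := (S.isLattice_map h hL).exists_basis e''
  have : ∀ i, ∃ t ∈ L, proj t = c'' i := fun i => by
    have : c'' i ∈ L.map (proj.restrictScalars R) := hc'' ▸ Submodule.subset_span ⟨i, rfl⟩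
    exact this
  choose t htL ht using this
  refine ⟨c', c'', t, ht, le_antisymm (fun x hx => ?_) ?_⟩
  · rw [mem_span_basis_iff]
    have hx'' : ∀ i, c''.repr (proj x) i ∈ R := (mem_span_basis_iff c'' _).1 (by
      rw [← hc'']
      exact ⟨x, hx, rfl⟩)
    rintro (i | i)
    · have hsplit := fun hs => S.inc_splitting_symm_fst (c''.constr K t) hs x
      simp only [sumBasis, Module.Basis.map_repr, LinearEquiv.trans_apply,
        Module.Basis.prod_repr_inl]
      refine (mem_span_basis_iff c' _).1 ?_ i
      rw [← hc', Submodule.mem_comap, LinearMap.restrictScalars_apply, hsplit]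
      refine L.sub_mem hx ?_
      rw [Module.Basis.constr_apply_fintype]
      refine L.sum_mem fun i _ => ?_
      exact L.smul_mem (⟨_, hx'' i⟩ : R) (htL i)
    · rw [sumBasis_repr_inr]
      exact hx'' i
  · rw [Submodule.span_le]
    rintro _ ⟨i | i, rfl⟩
    · have : c' i ∈ L.comap (inc.restrictScalars R) := hc' ▸ Submodule.subset_span ⟨i, rfl⟩
      simpa using this
    · simpa using htL i

/-- Additivity of the degree of lattices in exact sequences. -/
lemma latDeg_sumBasis (S : ShortExactSeq inc proj) [Fintype ι] [Fintype κ]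
    (b' : Module.Basis ι K W) (b'' : Module.Basis κ K Q) (u : κ → V)
    (hu : ∀ i, proj (u i) = b'' i) (h : LocalOrder R v)
    {L : Submodule R V} (hL : IsLattice L) :
    latDeg v L (S.sumBasis b' b'' u hu) =
      latDeg v (L.comap (inc.restrictScalars R)) b' +
      latDeg v (L.map (proj.restrictScalars R)) b'' := by
  classical
  obtain ⟨c', c'', t, ht, rfl⟩ := S.exists_adapted_basis h hL b' b''
  rw [latDeg_eq h _ _ rfl, latDeg_eq h b' c' (S.comap_span_sumBasis ..),
    latDeg_eq h b'' c'' (S.map_span_sumBasis ..), det_sumBasis_toMatrix,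
    h.mul _ _ (det_toMatrix_ne_zero _ _) (det_toMatrix_ne_zero _ _)]

/-- A lattice `L` splits compatibly with the exact sequence: there is a retraction of `V` onto `W`
which maps `L` to `L ∩ W`. -/
lemma exists_retraction (S : ShortExactSeq inc proj) (h : LocalOrder R v)
    {L : Submodule R V} (hL : IsLattice L) [Module.Finite K V] :
    ∃ ρ : V →ₗ[K] W, (∀ w, ρ (inc w) = w) ∧ ∀ x ∈ L, inc (ρ x) ∈ L := by
  have : Module.Finite K W := Module.Finite.of_injective inc S.inj
  have : Module.Finite K Q := Module.Finite.of_surjective proj S.surj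
  obtain ⟨c', c'', t, ht, rfl⟩ := S.exists_adapted_basis h hL (Module.finBasis K W)
    (Module.finBasis K Q)
  refine ⟨(S.sumBasis c' c'' t ht).constr K (Sum.elim c' 0), fun w => ?_, fun x hx => ?_⟩
  · have : (S.sumBasis c' c'' t ht).constr K (Sum.elim c' 0) ∘ₗ inc = LinearMap.id := by
      refine c'.ext fun i => ?_
      rw [LinearMap.comp_apply, ← S.sumBasis_inl c' c'' t ht, Module.Basis.constr_basis]
      rfl
    exact LinearMap.congr_fun this w
  · rw [mem_span_basis_iff] at hx
    rw [Module.Basis.constr_apply_fintype, map_sum]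
    refine Submodule.sum_mem _ fun i _ => ?_
    rw [map_smul]
    refine Submodule.smul_mem _ (⟨_, hx i⟩ : R) ?_
    rcases i with i | i
    · exact Submodule.subset_span ⟨.inl i, by simp⟩
    · simp

end ShortExactSeq

end Exact

end ParHiggs

/-! ### Points and local rings of a curve -/

namespace ParHiggs

namespace Curve

variable (C : Curve)

instance : CompactSpace C.X := by
  have := QuasiCompact.compactSpace_of_compactSpace C.str
  exact this

lemma algebraMap_stalk_injective (x : C.X) :
    Function.Injective (algebraMap (C.X.presheaf.stalk x) C.X.functionField) :=
  IsFractionRing.injective _ _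

variable {C}

lemma coheight_eq_one {x : C.X} (hx : IsClosed ({x} : Set C.X)) : Order.coheight x = 1 := by
  have := C.dvr x hx
  have h1 : ringKrullDim (C.X.presheaf.stalk x) = 1 :=
    IsPrincipalIdealRing.ringKrullDim_eq_one _ (IsDiscreteValuationRing.not_isField _)
  rw [ringKrullDim_stalk_eq_coheight] at h1
  exact_mod_cast h1

lemma genericPoint_specializes (x : C.X) : genericPoint C.X ⤳ x :=
  (genericPoint_spec C.X).specializes trivial

lemma lt_of_specializes_of_ne {x y : C.X} (h : x ⤳ y) (hne : x ≠ y) : y < x :=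
  lt_iff_le_not_ge.2 ⟨h, fun h' => hne (Specializes.antisymm h h').eq⟩

variable (C) in
/-- A point of a curve is closed or generic. -/
lemma isClosed_or_eq_genericPoint (x : C.X) :
    IsClosed ({x} : Set C.X) ∨ x = genericPoint C.X := by
  obtain ⟨y, hy, hyc⟩ := (isClosed_closure (s := ({x} : Set C.X))).exists_closed_singleton
    (by simp)
  have hxy : x ⤳ y := specializes_iff_mem_closure.2 hy
  by_cases hne : x = y
  · exact .inl (hne ▸ hyc)
  right
  by_contra hg
  have h1 := Order.coheight_add_one_le (lt_of_specializes_of_ne hxy hne)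
  have h2 := Order.coheight_add_one_le
    (lt_of_specializes_of_ne (genericPoint_specializes x) (Ne.symm hg))
  rw [coheight_eq_one hyc] at h1
  have h3 : (1 : ℕ∞) ≤ Order.coheight x := le_trans (by simp) h2
  have h4 : (1 : ℕ∞) + 1 ≤ 1 := le_trans (by gcongr) h1
  exact absurd h4 (by decide)

variable (C) in
lemma coheight_genericPoint : Order.coheight (genericPoint C.X) = 0 := by
  have h1 : ringKrullDim (C.X.presheaf.stalk (genericPoint C.X)) = 0 :=
    ringKrullDim_eq_zero_of_isField (Field.toIsField C.K)
  rw [ringKrullDim_stalk_eq_coheight] at h1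
  exact_mod_cast h1

variable (C) in
lemma O_genericPoint : C.O (genericPoint C.X) = ⊤ := by
  rw [O, RingHom.range_eq_top]
  intro a
  refine ⟨a, ?_⟩
  rw [RingHom.algebraMap_toAlgebra]
  have := C.X.presheaf.stalkSpecializes_refl (genericPoint C.X)
  rw [this]
  rfl

lemma ord_eq {x : C.X} (hx : IsClosed ({x} : Set C.X)) {a : C.K} (ha : a ≠ 0) {k : ℤ} :
    haveI := C.dvr x hx
    Scheme.ord a x = k ↔ Ring.ordFrac (C.X.presheaf.stalk x) a = WithZero.exp k :=
  Scheme.ord_eq_iff (coheight_eq_one hx) ha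

variable (C) in
lemma localOrder (x : C.X) : LocalOrder (C.O x) fun a : C.K => Scheme.ord a x := by
  have hfrac : ∀ a : C.K, ∃ s ∈ C.O x, s ≠ 0 ∧ s * a ∈ C.O x := fun a => by
    obtain ⟨u, w, hw, rfl⟩ := IsFractionRing.div_surjective (A := C.X.presheaf.stalk x) a
    have hw0 : algebraMap (C.X.presheaf.stalk x) C.X.functionField w ≠ 0 :=
      (map_ne_zero_iff _ (C.algebraMap_stalk_injective x)).2 (nonZeroDivisors.ne_zero hw)
    exact ⟨_, ⟨w, rfl⟩, hw0, u, (mul_div_cancel₀ _ hw0).symm⟩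
  have hmul : ∀ a b : C.K, a ≠ 0 → b ≠ 0 → Scheme.ord (a * b) x = Scheme.ord a x + Scheme.ord b x :=
    fun a b ha hb => Scheme.ord_mul ha hb
  rcases C.isClosed_or_eq_genericPoint x with hx | rfl
  · have := C.dvr x hx
    refine ⟨hmul, ?_, ?_, ?_, hfrac⟩
    · rintro _ ⟨s, rfl⟩
      by_cases hs : s = 0
      · simp [hs]
      · have hs0 := (map_ne_zero_iff _ (C.algebraMap_stalk_injective x)).2 hs
        rw [Scheme.le_ord_iff (coheight_eq_one hx) hs0]
        exact Ring.ordFrac_ge_one_of_ne_zero hs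
    · rintro _ ⟨s, rfl⟩ h0 hv
      have hu : IsUnit s := by
        rw [Ring.isUnit_iff_ordFrac_one_of_isDiscreteValuationRing (K := C.X.functionField)]
        exact (ord_eq hx h0).1 hv
      obtain ⟨u, rfl⟩ := hu
      exact ⟨(u⁻¹ : (C.X.presheaf.stalk x)ˣ), by simp⟩
    · exact IsPrincipalIdealRing.of_surjective _
        (algebraMap (C.X.presheaf.stalk x) C.X.functionField).rangeRestrict_surjective
  · have hO : ∀ a : C.K, a ∈ C.O (genericPoint C.X) := fun a => C.O_genericPoint ▸ Subring.mem_top a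
    have hord : ∀ a : C.K, Scheme.ord a (genericPoint C.X) = 0 := fun a =>
      Scheme.ord_eq_zero_of_coheight_neq_one (by simp [C.coheight_genericPoint]) a
    refine ⟨hmul, fun a _ => (hord a).ge, fun a _ _ _ => hO _, ?_, hfrac⟩
    have : Function.Surjective ((RingHom.id C.K).codRestrict (C.O (genericPoint C.X)) hO) :=
      fun a => ⟨(a : C.K), Subtype.ext rfl⟩
    exact IsPrincipalIdealRing.of_surjective _ this

lemma exists_uniformizer {x : C.X} (hx : IsClosed ({x} : Set C.X)) :
    ∃ π : C.O x, C.m x = Ideal.span {π} ∧ (π : C.K) ≠ 0 ∧ Scheme.ord (π : C.K) x = 1 := by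
  have := C.dvr x hx
  obtain ⟨π, hπ⟩ := IsDiscreteValuationRing.exists_irreducible (C.X.presheaf.stalk x)
  have h0 := (map_ne_zero_iff _ (C.algebraMap_stalk_injective x)).2 hπ.ne_zero
  refine ⟨(algebraMap (C.X.presheaf.stalk x) C.X.functionField).rangeRestrict π, ?_, h0, ?_⟩
  · rw [m, hπ.maximalIdeal_eq]
    exact (Ideal.map_span _ _).trans (by rw [Set.image_singleton]; rfl)
  · exact (ord_eq hx h0).2 (Ring.ordFrac_irreducible hπ)

/-- A rational function which is regular at `x` is regular in a neighbourhood of `x`. -/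
lemma exists_opens_mem_O {x : C.X} {a : C.K} (ha : a ∈ C.O x) :
    ∃ U : C.X.Opens, x ∈ U ∧ ∀ y ∈ U, a ∈ C.O y := by
  obtain ⟨s, rfl⟩ := ha
  obtain ⟨U, hxU, f, rfl⟩ := C.X.presheaf.exists_germ_eq s
  have : Nonempty U := ⟨⟨x, hxU⟩⟩
  refine ⟨U, hxU, fun y hy => ⟨C.X.presheaf.germ U y hy f, ?_⟩⟩
  rw [Scheme.algebraMap_germ_eq_germToFunctionField, Scheme.algebraMap_germ_eq_germToFunctionField]

end Curve

end ParHiggs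

/-! ### The function field has transcendence degree one -/

namespace ParHiggs

/-- A finitely generated domain of Krull dimension at most one has transcendence degree at most
one. -/
lemma trdeg_le_one_of_ringKrullDim_le {k A : Type} [Field k] [CommRing A] [IsDomain A] [Algebra k A]
    [Algebra.FiniteType k A] (hdim : ringKrullDim A ≤ 1) : Algebra.trdeg k A ≤ 1 := by
  obtain ⟨s, g, ginj, gint⟩ := exists_integral_inj_algHom_of_fg k A
  algebraize [g.toRingHom]
  have : Algebra.IsIntegral (MvPolynomial (Fin s) k) A := ⟨gint⟩
  have hA := Ring.krullDimLE_one_iff_of_noZeroDivisors.1 (Ring.krullDimLE_iff.2 hdim)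
  have : FaithfulSMul (MvPolynomial (Fin s) k) A :=
    (faithfulSMul_iff_algebraMap_injective _ _).2 ginj
  -- primes lift along an integral extension, so the polynomial ring has dimension at most one too
  have hP : Ring.KrullDimLE 1 (MvPolynomial (Fin s) k) := by
    rw [Ring.krullDimLE_one_iff_of_noZeroDivisors]
    intro P hP0 hP
    obtain ⟨Q, -, hQ, hQP⟩ := Ideal.exists_ideal_over_prime_of_isIntegral (S := A) P ⊥ (by
      rw [← RingHom.ker_eq_comap_bot]
      exact ((RingHom.injective_iff_ker_eq_bot _).1 ginj).trans_le bot_le)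
    have hQ0 : Q ≠ ⊥ := by
      rintro rfl
      apply hP0
      rw [← hQP, ← RingHom.ker_eq_comap_bot]
      exact (RingHom.injective_iff_ker_eq_bot _).1 ginj
    have := hA Q hQ0 hQ
    rw [← hQP]
    exact Ideal.isMaximal_comap_of_isIntegral_of_isMaximal Q
  have hs : s ≤ 1 := by
    have := Ring.krullDimLE_iff.1 hP
    rw [MvPolynomial.ringKrullDim_of_isNoetherianRing, ringKrullDim_eq_zero_of_field] at this
    simpa using this
  have h0 : Algebra.trdeg (MvPolynomial (Fin s) k) A = 0 := trdeg_eq_zero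
  rw [← trdeg_add_eq k (MvPolynomial (Fin s) k) (A := A), h0, MvPolynomial.trdeg_of_isDomain]
  simpa using hs

namespace Curve

variable (C : Curve)

lemma coheight_le_one (x : C.X) : Order.coheight x ≤ 1 := by
  rcases C.isClosed_or_eq_genericPoint x with hx | rfl
  · exact (coheight_eq_one hx).le
  · simp [C.coheight_genericPoint]

lemma ringKrullDim_le_one {U : C.X.Opens} (hU : IsAffineOpen U) : ringKrullDim Γ(C.X, U) ≤ 1 := by
  rw [ringKrullDim_le_iff_height_le]
  intro P hP
  have h1 := idealHeight_eq_coheight Γ(C.X, U) ⟨P, hP⟩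
  have h2 := coheight_eq_of_isOpenImmersion (x := (⟨P, hP⟩ : Spec Γ(C.X, U))) hU.fromSpec
  change P.height = _ at h1
  rw [h1]
  erw [← h2]
  exact_mod_cast C.coheight_le_one _

/-- The function field is finitely generated over `ℂ`, of transcendence degree at most one. -/
lemma essFiniteType_and_trdeg_le :
    Algebra.EssFiniteType ℂ C.K ∧ Algebra.trdeg ℂ C.K ≤ 1 := by
  obtain ⟨U, hU, hxU, -⟩ := exists_isAffineOpen_mem_and_subset
    (U := ⊤) (x := genericPoint C.X) trivial
  have : Nonempty U := ⟨⟨_, hxU⟩⟩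
  have hft := C.str.finiteType_appLE (isAffineOpen_top (Spec (CommRingCat.of ℂ))) hU le_top
  let φ : ℂ →+* Γ(C.X, U) := ((Scheme.ΓSpecIso (CommRingCat.of ℂ)).inv ≫ C.str.appLE ⊤ U le_top).hom
  have hφ : φ.FiniteType := by
    refine RingHom.FiniteType.comp hft (RingHom.FiniteType.of_surjective _ ?_)
    exact (ConcreteCategory.bijective_of_isIso (Scheme.ΓSpecIso (CommRingCat.of ℂ)).inv).2
  algebraize [φ]
  have hK := functionField_isFractionRing_of_isAffineOpen C.X U hU
  have : IsScalarTower ℂ Γ(C.X, U) C.K := by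
    refine IsScalarTower.of_algebraMap_eq' ?_
    change ((Scheme.ΓSpecIso (CommRingCat.of ℂ)).inv ≫ C.str.appTop ≫
      C.X.presheaf.germ ⊤ (genericPoint C.X) trivial).hom =
      (((Scheme.ΓSpecIso (CommRingCat.of ℂ)).inv ≫ C.str.appLE ⊤ U le_top) ≫
        C.X.germToFunctionField U).hom
    congr 1
    rw [Category.assoc]
    congr 1
    have h1 : C.str.appLE ⊤ U le_top = C.str.appTop ≫ C.X.presheaf.map (homOfLE le_top).op := rfl
    have h2 := C.X.presheaf.germ_res (homOfLE (le_top : U ≤ ⊤)) (genericPoint C.X) hxU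
    rw [h1, Category.assoc]
    exact congrArg (fun t => C.str.appTop ≫ t) h2.symm
  have : Algebra.EssFiniteType Γ(C.X, U) C.K :=
    Algebra.EssFiniteType.of_isLocalization _ (nonZeroDivisors Γ(C.X, U))
  refine ⟨Algebra.EssFiniteType.comp ℂ Γ(C.X, U) C.K, ?_⟩
  have : FaithfulSMul Γ(C.X, U) C.K := inferInstance
  have : Algebra.IsAlgebraic Γ(C.X, U) C.K :=
    IsLocalization.isAlgebraic _ (nonZeroDivisors Γ(C.X, U))
  have h0 : Algebra.trdeg Γ(C.X, U) C.K = 0 := trdeg_eq_zero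
  rw [← trdeg_add_eq ℂ Γ(C.X, U) (A := C.K), h0, add_zero]
  exact trdeg_le_one_of_ringKrullDim_le (C.ringKrullDim_le_one hU)

end Curve

end ParHiggs

/-! ### Points of a curve and valuation rings of its function field -/

namespace ParHiggs

namespace Curve

variable (C : Curve)

lemma fromSpecStalk_genericPoint_comp_str :
    C.X.fromSpecStalk (genericPoint C.X) ≫ C.str =
      Spec.map (CommRingCat.ofHom (algebraMap ℂ C.K)) := by
  rw [← cancel_mono (Spec (CommRingCat.of ℂ)).toSpecΓ, Category.assoc, Scheme.toSpecΓ_naturality,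
    Scheme.fromSpecStalk_toSpecΓ_assoc, ← SpecMap_ΓSpecIso_hom, ← Spec.map_comp,
    ← Spec.map_comp]
  congr 1
  have : (CommRingCat.ofHom (algebraMap ℂ C.K)) = (Scheme.ΓSpecIso (CommRingCat.of ℂ)).inv ≫
    C.str.appTop ≫ C.X.presheaf.germ ⊤ (genericPoint C.X) trivial := rfl
  rw [this, Iso.hom_inv_id_assoc]

variable {C}

/-- The morphism `Spec K → Spec 𝒪_x → C` is the inclusion of the generic point. -/
lemma SpecMap_algebraMap_fromSpecStalk (x : C.X) :
    Spec.map (CommRingCat.ofHom (algebraMap (C.X.presheaf.stalk x) C.X.functionField)) ≫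
      C.X.fromSpecStalk x = C.X.fromSpecStalk (genericPoint C.X) :=
  Scheme.SpecMap_stalkSpecializes_fromSpecStalk (genericPoint_specializes x)

/-- Properness: every valuation ring of the function field which contains `ℂ` dominates the local
ring of some point. -/
lemma exists_center (T : Subring C.K) [ValuationRing T] [IsFractionRing T C.K]
    (hT : ∀ c : ℂ, algebraMap ℂ C.K c ∈ T) :
    ∃ x : C.X, C.O x ≤ T ∧ ∀ a ∈ C.O x, a⁻¹ ∈ T → a⁻¹ ∈ C.O x := by
  let φ : ℂ →+* T := (algebraMap ℂ C.K).codRestrict T hT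
  let S : ValuativeCommSq C.str :=
    { R := T
      K := C.K
      i₁ := C.X.fromSpecStalk (genericPoint C.X)
      i₂ := Spec.map (CommRingCat.ofHom φ)
      commSq := ⟨by
        rw [fromSpecStalk_genericPoint_comp_str, ← Spec.map_comp]
        rfl⟩ }
  have hex : ValuativeCriterion C.str := by
    have : IsProper C.str := C.proper
    rw [IsProper.eq_valuativeCriterion] at this
    exact this.1.1.1
  obtain ⟨⟨l, hl, -⟩⟩ := (hex.existence S).exists_lift
  change Spec (.of T) ⟶ C.X at l
  change Spec.map (CommRingCat.ofHom (algebraMap T C.K)) ≫ l =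
    C.X.fromSpecStalk (genericPoint C.X) at hl
  let x := l (IsLocalRing.closedPoint T)
  let g : C.X.presheaf.stalk x ⟶ CommRingCat.of T := Scheme.stalkClosedPointTo l
  have hg : Spec.map g ≫ C.X.fromSpecStalk x = l := Scheme.Spec_stalkClosedPointTo_fromSpecStalk l
  have hloc : IsLocalHom g.hom := Scheme.isLocalHom_stalkClosedPointTo' l
  have hcomp : g ≫ CommRingCat.ofHom (algebraMap T C.K) =
      CommRingCat.ofHom (algebraMap (C.X.presheaf.stalk x) C.X.functionField) := by
    apply Spec.map_injective
    rw [← cancel_mono (C.X.fromSpecStalk x), SpecMap_algebraMap_fromSpecStalk, Spec.map_comp,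
      Category.assoc, hg, hl]
  have hval : ∀ s, ((g.hom s : T) : C.K) = algebraMap (C.X.presheaf.stalk x) C.X.functionField s :=
    fun s => congrArg (fun f => f.hom s) hcomp
  refine ⟨x, ?_, ?_⟩
  · rintro _ ⟨s, rfl⟩
    rw [← hval]
    exact (g.hom s).2
  · rintro _ ⟨s, rfl⟩ hs
    by_cases h0 : algebraMap (C.X.presheaf.stalk x) C.X.functionField s = 0
    · rw [h0, inv_zero]
      exact (C.O x).zero_mem
    have hu : IsUnit (g.hom s) := by
      refine IsUnit.of_mul_eq_one ⟨_, hs⟩ (Subtype.ext ?_)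
      change ((g.hom s : T) : C.K) * _ = 1
      rw [hval]
      exact mul_inv_cancel₀ h0
    obtain ⟨u, rfl⟩ := (isUnit_map_iff g.hom s).1 hu
    exact ⟨(u⁻¹ : (C.X.presheaf.stalk x)ˣ), by simp⟩

lemma SpecMap_fromSpecStalk_closedPoint {X : Scheme} {R : CommRingCat} [IsLocalRing R] (x : X)
    (f : X.presheaf.stalk x ⟶ R) [IsLocalHom f.hom] :
    (Spec.map f ≫ X.fromSpecStalk x) (IsLocalRing.closedPoint R) = x :=
  (congrArg (X.fromSpecStalk x) (Spec_closedPoint (f := f))).trans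
    Scheme.fromSpecStalk_closedPoint

lemma isDominant_SpecMap {R S : CommRingCat} [IsReduced R] (f : R ⟶ S)
    (hf : Function.Injective f.hom) : IsDominant (Spec.map f) := by
  refine ⟨?_⟩
  have := (PrimeSpectrum.denseRange_comap_iff_ker_le_nilRadical f.hom).2
    (by rw [(RingHom.injective_iff_ker_eq_bot _).1 hf]; exact bot_le)
  exact this

/-- Separatedness: a point is determined by its local ring. -/
lemma eq_of_O_eq {x y : C.X} (h : C.O x = C.O y) : x = y := by
  let ι : C.X.presheaf.stalk x ⟶ .of C.K :=
    CommRingCat.ofHom (algebraMap (C.X.presheaf.stalk x) C.X.functionField)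
  -- the inclusion of the other stalk, which has the same image in the function field
  have hbij : ∀ z : C.X, Function.Bijective
      (algebraMap (C.X.presheaf.stalk z) C.X.functionField).rangeRestrict := fun z =>
    ⟨fun a b hab => C.algebraMap_stalk_injective z (congrArg Subtype.val hab),
        RingHom.rangeRestrict_surjective _⟩
  let ex : C.X.presheaf.stalk x ≃+* C.O x := RingEquiv.ofBijective _ (hbij x)
  let ey : C.X.presheaf.stalk y ≃+* C.O y := RingEquiv.ofBijective _ (hbij y)
  let e : C.X.presheaf.stalk y ≃+* C.X.presheaf.stalk x :=
    (ey.trans (RingEquiv.subringCongr h.symm)).trans ex.symm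
  let g : C.X.presheaf.stalk y ⟶ C.X.presheaf.stalk x := CommRingCat.ofHom e.toRingHom
  have hg : g ≫ ι =
      CommRingCat.ofHom (algebraMap (C.X.presheaf.stalk y) C.X.functionField) := by
    ext s
    change ((ex (e s) : C.O x) : C.K) = _
    simp only [e, RingEquiv.trans_apply, RingEquiv.apply_symm_apply]
    rfl
  have hι : IsDominant (Spec.map ι) :=
    isDominant_SpecMap ι (C.algebraMap_stalk_injective x)
  have hx : Spec.map ι ≫ C.X.fromSpecStalk x = C.X.fromSpecStalk (genericPoint C.X) :=
    SpecMap_algebraMap_fromSpecStalk x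
  have hy : Spec.map ι ≫ Spec.map g ≫ C.X.fromSpecStalk y =
      C.X.fromSpecStalk (genericPoint C.X) := by
    rw [← Spec.map_comp_assoc, hg]
    exact SpecMap_algebraMap_fromSpecStalk y
  have h1 : C.X.fromSpecStalk x ≫ C.str = (Spec.map g ≫ C.X.fromSpecStalk y) ≫ C.str := by
    refine ext_of_isDominant (Spec.map ι) ?_
    rw [← Category.assoc, hx, ← hy, Category.assoc, Category.assoc]
  have h2 : C.X.fromSpecStalk x = Spec.map g ≫ C.X.fromSpecStalk y :=
    ext_of_isDominant_of_isSeparated C.str h1 (Spec.map ι) (hx.trans hy.symm)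
  have hloc : IsLocalHom g.hom := ⟨fun a ha => (isUnit_map_iff e a).1 ha⟩
  have h3 := SpecMap_fromSpecStalk_closedPoint y g
  rw [← h2, Scheme.fromSpecStalk_closedPoint] at h3
  exact h3

end Curve

end ParHiggs

/-! ### Principal divisors have degree zero -/

namespace ParHiggs

lemma inertiaDeg_eq_one (k : Type*) {R S : Type*} [Field k] [IsAlgClosed k] [CommRing R]
    [CommRing S] [Algebra k R] [Algebra k S] [Algebra R S] [IsScalarTower k R S]
    [Algebra.FiniteType k S] (p : Ideal R) (q : Ideal S) [q.LiesOver p] [p.IsMaximal]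
    [q.IsMaximal] : q.inertiaDeg R = 1 := by
  let : Field (R ⧸ p) := Ideal.Quotient.field p
  let : Field (S ⧸ q) := Ideal.Quotient.field q
  have h1 : Algebra.FiniteType k (S ⧸ q) :=
    Algebra.FiniteType.of_surjective (Ideal.Quotient.mkₐ k q) (Ideal.Quotient.mkₐ_surjective k q)
  have h2 : Module.Finite k (S ⧸ q) := finite_of_finite_type_of_isJacobsonRing k _
  have h3 : Function.Bijective (algebraMap k (S ⧸ q)) :=
    IsAlgClosed.algebraMap_bijective_of_isIntegral
  rw [Ideal.inertiaDeg_eq_of_isMaximal p q]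
  refine finrank_eq_one_iff'.2 ⟨1, one_ne_zero, fun w => ?_⟩
  obtain ⟨c, rfl⟩ := h3.2 w
  refine ⟨Ideal.Quotient.mk p (algebraMap k R c), ?_⟩
  rw [Algebra.smul_def, mul_one, Ideal.Quotient.algebraMap_mk_of_liesOver,
    ← IsScalarTower.algebraMap_apply]
  rfl

lemma ramificationIdx_eq_ord {R S : Type*} [CommRing R] [CommRing S] [Algebra R S] (f : R)
    (q : Ideal S) [q.IsPrime] [q.LiesOver (Ideal.span {f})] :
    q.ramificationIdx R =
      (Ring.ord (Localization.AtPrime q) (algebraMap R (Localization.AtPrime q) f)).toNat := by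
  rw [Ideal.ramificationIdx_eq (Ideal.span {f}) q, Ideal.map_span, Set.image_singleton]
  rfl

lemma ringOrd_map_equiv {R S : Type*} [CommRing R] [CommRing S] [IsDomain R] [IsDomain S]
    [IsDiscreteValuationRing R] (e : R ≃+* S) (a : R) (ha : a ≠ 0) :
    Ring.ord S (e a) = Ring.ord R a := by
  have : IsDiscreteValuationRing S :=
    IsDiscreteValuationRing.RingEquivClass.isDiscreteValuationRing e
  obtain ⟨π, hπ⟩ := IsDiscreteValuationRing.exists_irreducible R
  have hπ' : Irreducible (e π) := (MulEquiv.irreducible_iff e).2 hπ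
  obtain ⟨k, u, rfl⟩ := IsDiscreteValuationRing.eq_unit_mul_pow_irreducible ha hπ
  have h1 : π ∈ nonZeroDivisors R := mem_nonZeroDivisors_of_ne_zero hπ.ne_zero
  have h2 : e π ∈ nonZeroDivisors S := mem_nonZeroDivisors_of_ne_zero hπ'.ne_zero
  rw [map_mul, map_pow, Ring.ord_mul _ (pow_mem h1 k), Ring.ord_mul _ (pow_mem h2 k),
    Ring.ord_pow h1, Ring.ord_pow h2, Ring.ord_of_irreducible hπ, Ring.ord_of_irreducible hπ',
    Ring.ord_of_isUnit u.isUnit, Ring.ord_of_isUnit (u.isUnit.map e)]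

namespace Curve

variable {C : Curve}

lemma ord_eq_toNat_ord {x : C.X} (hx : IsClosed ({x} : Set C.X)) {s : C.X.presheaf.stalk x}
    (hs : s ≠ 0) : Scheme.ord (algebraMap (C.X.presheaf.stalk x) C.X.functionField s) x =
      (Ring.ord (C.X.presheaf.stalk x) s).toNat := by
  have := C.dvr x hx
  have h0 := (map_ne_zero_iff _ (C.algebraMap_stalk_injective x)).2 hs
  have h1 : s ∈ nonZeroDivisors (C.X.presheaf.stalk x) := mem_nonZeroDivisors_of_ne_zero hs
  rw [ord_eq hx h0, Ring.ordFrac_eq_ord _ hs]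
  obtain ⟨n, hn⟩ := ENat.ne_top_iff_exists.1 (Ring.ord_ne_top h1)
  rw [Ring.ordMonoidWithZeroHom_eq_coe _ h1 hn.symm, ← hn]
  rfl

lemma algebraMap_complex_mem_O (x : C.X) (c : ℂ) : algebraMap ℂ C.K c ∈ C.O x := by
  refine ⟨(C.X.presheaf.germ ⊤ x trivial).hom
    (C.str.appTop.hom ((Scheme.ΓSpecIso (CommRingCat.of ℂ)).inv.hom c)), ?_⟩
  have := C.X.presheaf.germ_stalkSpecializes (U := ⊤) (x := genericPoint C.X) (y := x) trivial
    (genericPoint_specializes x)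
  rw [RingHom.algebraMap_toAlgebra]
  exact congrArg (fun f => f.hom
    (C.str.appTop.hom ((Scheme.ΓSpecIso (CommRingCat.of ℂ)).inv.hom c))) this

lemma ord_genericPoint (a : C.K) : Scheme.ord a (genericPoint C.X) = 0 :=
  Scheme.ord_eq_zero_of_coheight_neq_one (by simp [C.coheight_genericPoint]) a

end Curve

end ParHiggs

namespace ParHiggs

open IntermediateField IntermediateField.algebraAdjoinAdjoin in
lemma finiteDimensional_adjoin_simple {K : Type} [Field K] [Algebra ℂ K]
    [Algebra.EssFiniteType ℂ K] (h : Algebra.trdeg ℂ K ≤ 1) {f : K} (hf : Transcendental ℂ f) :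
    FiniteDimensional ℂ⟮f⟯ K := by
  have h1 : AlgebraicIndependent ℂ ![f] := algebraicIndependent_iff_transcendental.2 hf
  have h2 : IsTranscendenceBasis ℂ ![f] :=
    h1.isTranscendenceBasis_of_trdeg_le_of_finite (by simpa using h)
  have h3 := h2.isAlgebraic
  have h4 : Set.range ![f] = {f} := by simp
  rw [h4] at h3
  have h5 : Algebra.IsAlgebraic ℂ⟮f⟯ K := by
    refine ⟨fun a => ?_⟩
    obtain ⟨P, hP0, hP⟩ := h3.isAlgebraic a
    refine ⟨P.map (algebraMap (Algebra.adjoin ℂ {f}) ℂ⟮f⟯), ?_, ?_⟩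
    · rwa [Ne, Polynomial.map_eq_zero_iff (FaithfulSMul.algebraMap_injective _ _)]
    · rwa [Polynomial.aeval_map_algebraMap]
  have : Algebra.EssFiniteType ℂ⟮f⟯ K := .of_comp ℂ _ _
  exact Algebra.finite_of_essFiniteType_of_isAlgebraic

section

variable {K : Type} [Field K] [Algebra ℂ K] {f : K}

lemma isPrincipalIdealRing_adjoin_simple (hf : Transcendental ℂ f) :
    IsPrincipalIdealRing (Algebra.adjoin ℂ {f}) :=
  IsPrincipalIdealRing.of_surjective (Polynomial.algEquivOfTranscendental ℂ f hf)
    (AlgEquiv.surjective _)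

lemma isMaximal_span_adjoin_simple (hf : Transcendental ℂ f) :
    (Ideal.span {(⟨f, Algebra.self_mem_adjoin_singleton ℂ f⟩ : Algebra.adjoin ℂ {f})}).IsMaximal
    := by
  have := isPrincipalIdealRing_adjoin_simple hf
  have h : Polynomial.algEquivOfTranscendental ℂ f hf Polynomial.X =
      ⟨f, Algebra.self_mem_adjoin_singleton ℂ f⟩ := by
    simp
  rw [← h]
  exact PrincipalIdealRing.isMaximal_of_irreducible
    ((MulEquiv.irreducible_iff (Polynomial.algEquivOfTranscendental ℂ f hf)).2
      Polynomial.irreducible_X)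

end

namespace Curve

variable {C : Curve}

/-- Let `B` be a Dedekind domain with fraction field the function field, and `q` a prime of `B`
which is the trace of the maximal ideal of `𝒪_x`.  Then `𝒪_x` is the localization of `B` at `q`. -/
lemma isLocalization_stalk {x : C.X} (B : Type) [CommRing B] [IsDedekindDomain B]
    [Algebra B C.K] [IsFractionRing B C.K] (φ : B →+* C.X.presheaf.stalk x)
    (hφ : ∀ b, algebraMap (C.X.presheaf.stalk x) C.X.functionField (φ b) = algebraMap B C.K b)
    (q : Ideal B) [q.IsPrime] (hq0 : q ≠ ⊥)
    (hq : q = (IsLocalRing.maximalIdeal (C.X.presheaf.stalk x)).comap φ) :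
    letI := φ.toAlgebra
    IsLocalization.AtPrime (C.X.presheaf.stalk x) q := by
  let := φ.toAlgebra
  let T := Localization.subalgebra.ofField C.K q.primeCompl q.primeCompl_le_nonZeroDivisors
  have hT : IsLocalization.AtPrime T q :=
    Localization.subalgebra.isLocalization_ofField _ _ _
  have hD : IsDiscreteValuationRing T :=
    IsLocalization.AtPrime.isDiscreteValuationRing_of_dedekind_domain B hq0 T
  have hF : IsFractionRing T C.K := inferInstance
  have hu : ∀ b, b ∉ q ↔ IsUnit (φ b) := fun b => by
    rw [hq, Ideal.mem_comap, IsLocalRing.mem_maximalIdeal, mem_nonunits_iff, not_not]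
  have hinj := C.algebraMap_stalk_injective x
  refine ⟨fun s => (hu s).1 s.2, fun z => ?_, fun {a b} hab => ⟨1, ?_⟩⟩
  · let a := algebraMap (C.X.presheaf.stalk x) C.X.functionField z
    -- `T` is a valuation ring dominated by `𝒪_x`
    have hval : a ∈ T := by
      by_contra hcon
      have ha0 : a ≠ 0 := fun h => hcon (h ▸ T.zero_mem)
      obtain ⟨t, ht⟩ | ⟨t, ht⟩ := ValuationRing.isInteger_or_isInteger T a
      · exact hcon (ht ▸ t.2)
      · obtain ⟨b, s, hs, hbs⟩ := t.2
        have hbs' : a⁻¹ = algebraMap B C.K b * (algebraMap B C.K s)⁻¹ := by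
          rw [← hbs]; exact ht.symm
        have hs0 : algebraMap B C.K s ≠ 0 := by
          rw [Ne, FaithfulSMul.algebraMap_eq_zero_iff]
          rintro rfl
          exact hs q.zero_mem
        have hb : b ∈ q := by
          by_contra hb
          refine hcon ⟨s, b, hb, ?_⟩
          rw [← inv_inv a, hbs', mul_inv, inv_inv, mul_comm]
        have h1 : z * φ b = φ s := by
          apply hinj
          rw [map_mul, hφ, hφ]
          have : algebraMap B C.K b = a⁻¹ * algebraMap B C.K s := by
            rw [hbs', inv_mul_cancel_right₀ hs0]
          rw [this, ← mul_assoc, mul_inv_cancel₀ ha0, one_mul]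
        refine (hu b).not.1 (not_not.2 hb) (isUnit_of_mul_isUnit_right (x := z) ?_)
        rw [h1]
        exact (hu s).1 hs
    obtain ⟨b, s, hs, hbs⟩ := hval
    have hs0 : algebraMap B C.K s ≠ 0 := by
      rw [Ne, FaithfulSMul.algebraMap_eq_zero_iff]
      rintro rfl
      exact hs q.zero_mem
    refine ⟨(b, ⟨s, hs⟩), hinj ?_⟩
    change algebraMap _ C.X.functionField (z * φ s) = algebraMap _ C.X.functionField (φ b)
    rw [map_mul, hφ, hφ]
    change a * _ = _
    rw [hbs, inv_mul_cancel_right₀ hs0]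
  · congr 1
    apply FaithfulSMul.algebraMap_injective B C.K
    rw [← hφ, ← hφ]
    exact congrArg _ hab

/-- The local ring at `x` as a subring of the function field is the stalk. -/
noncomputable def stalkEquiv (x : C.X) : C.X.presheaf.stalk x ≃+* C.O x :=
  RingEquiv.ofBijective (algebraMap (C.X.presheaf.stalk x) C.X.functionField).rangeRestrict
    ⟨fun _ _ hab => C.algebraMap_stalk_injective x (congrArg Subtype.val hab),
      RingHom.rangeRestrict_surjective _⟩

lemma algebraMap_stalkEquiv_symm {x : C.X} (a : C.O x) :
    algebraMap (C.X.presheaf.stalk x) C.X.functionField ((stalkEquiv x).symm a) = a :=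
  congrArg Subtype.val ((stalkEquiv x).apply_symm_apply a)

lemma exists_ringHom_stalk {x : C.X} {B : Type} [CommRing B] [Algebra B C.K]
    (h : ∀ b, algebraMap B C.K b ∈ C.O x) :
    ∃ φ : B →+* C.X.presheaf.stalk x,
      ∀ b, algebraMap (C.X.presheaf.stalk x) C.X.functionField (φ b) = algebraMap B C.K b :=
  ⟨(stalkEquiv x).symm.toRingHom.comp ((algebraMap B C.K).codRestrict (C.O x) h),
    fun _ => algebraMap_stalkEquiv_symm _⟩

lemma O_le_of_trace_eq {x y : C.X} (B : Type) [CommRing B] [IsDedekindDomain B]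
    [Algebra B C.K] [IsFractionRing B C.K] (φ : B →+* C.X.presheaf.stalk x)
    (hφ : ∀ b, algebraMap (C.X.presheaf.stalk x) C.X.functionField (φ b) = algebraMap B C.K b)
    (ψ : B →+* C.X.presheaf.stalk y)
    (hψ : ∀ b, algebraMap (C.X.presheaf.stalk y) C.X.functionField (ψ b) = algebraMap B C.K b)
    (q : Ideal B) [q.IsPrime] (hq0 : q ≠ ⊥)
    (hx : q = (IsLocalRing.maximalIdeal (C.X.presheaf.stalk x)).comap φ)
    (hy : q = (IsLocalRing.maximalIdeal (C.X.presheaf.stalk y)).comap ψ) : C.O x ≤ C.O y := by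
  let := φ.toAlgebra
  have hloc : IsLocalization.AtPrime (C.X.presheaf.stalk x) q :=
    isLocalization_stalk B φ hφ q hq0 hx
  rintro _ ⟨z, rfl⟩
  obtain ⟨⟨b, s⟩, hbs⟩ := IsLocalization.surj q.primeCompl z
  have hs : IsUnit (ψ s) := by
    by_contra h
    have hmem : (s : B) ∈ (IsLocalRing.maximalIdeal (C.X.presheaf.stalk y)).comap ψ := h
    rw [← hy] at hmem
    exact s.2 hmem
  obtain ⟨u, hu⟩ := hs
  refine ⟨ψ b * (u⁻¹ : (C.X.presheaf.stalk y)ˣ), ?_⟩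
  have h1 : z * φ s = φ b := hbs
  have h2 := congrArg (algebraMap (C.X.presheaf.stalk x) C.X.functionField) h1
  rw [map_mul, hφ, hφ, ← hψ, ← hψ, ← hu] at h2
  rw [map_mul, ← h2, mul_assoc, ← map_mul, Units.mul_inv, map_one, mul_one]

/-- Every prime of a Dedekind domain `B` with fraction field the function field is the trace of the
maximal ideal of the local ring at some closed point. -/
lemma exists_point_of_prime (B : Type) [CommRing B] [IsDedekindDomain B]
    [Algebra B C.K] [IsFractionRing B C.K]
    (hB : ∀ c : ℂ, ∃ b, algebraMap B C.K b = algebraMap ℂ C.K c) (q : Ideal B) [q.IsPrime]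
    (hq0 : q ≠ ⊥) :
    ∃ x : C.X, IsClosed ({x} : Set C.X) ∧ ∃ φ : B →+* C.X.presheaf.stalk x,
      (∀ b, algebraMap (C.X.presheaf.stalk x) C.X.functionField (φ b) = algebraMap B C.K b) ∧
      q = (IsLocalRing.maximalIdeal (C.X.presheaf.stalk x)).comap φ := by
  let T := Localization.subalgebra.ofField C.K q.primeCompl q.primeCompl_le_nonZeroDivisors
  have hT : IsLocalization.AtPrime T q :=
    Localization.subalgebra.isLocalization_ofField _ _ _
  have hD : IsDiscreteValuationRing T :=
    IsLocalization.AtPrime.isDiscreteValuationRing_of_dedekind_domain B hq0 T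
  have hV : ValuationRing T.toSubring := inferInstanceAs (ValuationRing T)
  have hF : IsFractionRing T.toSubring C.K := inferInstanceAs (IsFractionRing T C.K)
  obtain ⟨x, hxT, hx⟩ := exists_center T.toSubring fun c => by
    obtain ⟨b, hb⟩ := hB c
    rw [← hb]
    exact T.algebraMap_mem b
  have hinv : ∀ b : B, b ≠ 0 → ((algebraMap B C.K b)⁻¹ ∈ T ↔ b ∉ q) := fun b hb0 => by
    have hb0' : algebraMap B C.K b ≠ 0 := by rwa [Ne, FaithfulSMul.algebraMap_eq_zero_iff]
    refine ⟨?_, fun hb => ⟨1, b, hb, by simp⟩⟩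
    rintro ⟨c, s, hs, hcs⟩ hb
    have hs0 : algebraMap B C.K s ≠ 0 := by
      rw [Ne, FaithfulSMul.algebraMap_eq_zero_iff]
      rintro rfl
      exact hs q.zero_mem
    refine hs ?_
    have : s = b * c := by
      apply FaithfulSMul.algebraMap_injective B C.K
      rw [map_mul]
      field_simp at hcs
      exact hcs
    rw [this]
    exact q.mul_mem_right _ hb
  have hclosed : IsClosed ({x} : Set C.X) := by
    refine (C.isClosed_or_eq_genericPoint x).resolve_right ?_
    rintro rfl
    obtain ⟨b, hb, hb0⟩ := Submodule.exists_mem_ne_zero_of_ne_bot hq0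
    refine (hinv b hb0).1 (hxT ?_) hb
    rw [O_genericPoint]
    trivial
  have := C.dvr x hclosed
  have hTx : ∀ a ∈ T, a ∈ C.O x := fun a ha => by
    obtain ⟨t, ht⟩ | ⟨t, ht⟩ := ValuationRing.isInteger_or_isInteger (C.X.presheaf.stalk x) a
    · exact ⟨t, ht⟩
    · rw [← inv_inv a]
      refine hx a⁻¹ ⟨t, ht⟩ ?_
      rw [inv_inv]
      exact ha
  obtain ⟨φ, hφ⟩ := exists_ringHom_stalk (x := x) (B := B) fun b => hTx _ (T.algebraMap_mem b)
  refine ⟨x, hclosed, φ, hφ, ?_⟩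
  ext b
  rw [Ideal.mem_comap, IsLocalRing.mem_maximalIdeal, mem_nonunits_iff, ← not_iff_not, not_not]
  by_cases hb0 : b = 0
  · simp [hb0]
  rw [← hinv b hb0]
  have hb0' : algebraMap B C.K b ≠ 0 := by rwa [Ne, FaithfulSMul.algebraMap_eq_zero_iff]
  constructor
  · intro h
    obtain ⟨s, hs⟩ := hTx _ h
    refine IsUnit.of_mul_eq_one s (C.algebraMap_stalk_injective x ?_)
    rw [map_mul, hφ, hs, mul_inv_cancel₀ hb0', map_one]
  · rintro ⟨u, hu⟩
    refine hxT ⟨(u⁻¹ : (C.X.presheaf.stalk x)ˣ), ?_⟩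
    rw [← hφ, ← hu]
    simp

end Curve

end ParHiggs

namespace ParHiggs

open IntermediateField IntermediateField.algebraAdjoinAdjoin in
/-- The properties of the integral closure of `ℂ[f]` in a function field of one variable in which
`f` is not constant. -/
lemma exists_integralClosure {K : Type} [Field K] [Algebra ℂ K]
    [Algebra.EssFiniteType ℂ K] (h : Algebra.trdeg ℂ K ≤ 1) {f : K} (hf : Transcendental ℂ f) :
    ∃ (R B : Type) (_ : CommRing R) (_ : IsDomain R) (_ : CommRing B) (_ : IsDedekindDomain B)
      (_ : Algebra ℂ R) (_ : Algebra ℂ B) (_ : Algebra R B) (_ : IsScalarTower ℂ R B)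
      (_ : Algebra B K) (_ : IsFractionRing B K) (_ : Algebra.FiniteType ℂ B)
      (_ : Module.Finite R B) (_ : Module.IsTorsionFree R B) (_ : Module.Flat R B) (a : R),
      (Ideal.span {a}).IsMaximal ∧ algebraMap B K (algebraMap R B a) = f ∧
      (∀ c : ℂ, algebraMap B K (algebraMap ℂ B c) = algebraMap ℂ K c) ∧
      (∀ S : Subring K, (∀ c : ℂ, algebraMap ℂ K c ∈ S) → f ∈ S →
        (∀ z : K, IsIntegral S z → z ∈ S) → ∀ b, algebraMap B K b ∈ S) ∧
      Module.finrank ℂ⟮f⟯ K = Module.finrank R B := by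
  have hfin := finiteDimensional_adjoin_simple h hf
  have hpid := isPrincipalIdealRing_adjoin_simple hf
  have hBfin : Module.Finite (Algebra.adjoin ℂ {f})
      (integralClosure (Algebra.adjoin ℂ {f}) K) :=
    IsIntegralClosure.finite _ ℂ⟮f⟯ K _
  have hBded : IsDedekindDomain (integralClosure (Algebra.adjoin ℂ {f}) K) :=
    IsIntegralClosure.isDedekindDomain (Algebra.adjoin ℂ {f}) ℂ⟮f⟯ K _
  have hBfrac : IsFractionRing (integralClosure (Algebra.adjoin ℂ {f}) K) K :=
    IsIntegralClosure.isFractionRing_of_finite_extension (Algebra.adjoin ℂ {f}) ℂ⟮f⟯ K _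
  have hRft : Algebra.FiniteType ℂ (Algebra.adjoin ℂ {f}) :=
    (Subalgebra.fg_iff_finiteType _).1 ⟨{f}, by simp⟩
  have hBft : Algebra.FiniteType ℂ (integralClosure (Algebra.adjoin ℂ {f}) K) :=
    hRft.trans inferInstance
  refine ⟨Algebra.adjoin ℂ {f}, integralClosure (Algebra.adjoin ℂ {f}) K, inferInstance,
    inferInstance, inferInstance, hBded, inferInstance, inferInstance, inferInstance,
    inferInstance, inferInstance, hBfrac, hBft, hBfin, inferInstance, inferInstance,
    ⟨f, Algebra.self_mem_adjoin_singleton ℂ f⟩, isMaximal_span_adjoin_simple hf, rfl,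
    fun c => rfl, fun S hS hfS hint b => ?_, ?_⟩
  · have hle : ∀ r : Algebra.adjoin ℂ {f}, (r : K) ∈ S := by
      rintro ⟨r, hr⟩
      induction hr using Algebra.adjoin_induction with
      | mem x hx =>
        change x ∈ S
        rwa [Set.mem_singleton_iff.1 hx]
      | algebraMap c => exact hS c
      | add x y _ _ hx hy => exact S.add_mem hx hy
      | mul x y _ _ hx hy => exact S.mul_mem hx hy
    refine hint _ ?_
    exact (b.2 : IsIntegral (Algebra.adjoin ℂ {f}) (b : K)).map_of_comp_eq
      ((algebraMap (Algebra.adjoin ℂ {f}) K).codRestrict S hle) (RingHom.id K)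
      (RingHom.ext fun _ => rfl)
  · exact IsFractionRing.finrank_eq (Algebra.adjoin ℂ {f}) ℂ⟮f⟯
      (integralClosure (Algebra.adjoin ℂ {f}) K) K

namespace Curve

variable {C : Curve}

lemma ord_pos_iff {x : C.X} (hx : IsClosed ({x} : Set C.X)) {s : C.X.presheaf.stalk x}
    (hs : s ≠ 0) : 0 < Scheme.ord (algebraMap (C.X.presheaf.stalk x) C.X.functionField s) x ↔
      s ∈ IsLocalRing.maximalIdeal (C.X.presheaf.stalk x) := by
  rw [IsLocalRing.mem_maximalIdeal, mem_nonunits_iff]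
  have h0 := (map_ne_zero_iff _ (C.algebraMap_stalk_injective x)).2 hs
  have h := C.localOrder x
  constructor
  · intro hpos hu
    obtain ⟨u, rfl⟩ := hu
    rw [ord_eq_toNat_ord hx hs, Ring.ord_of_isUnit u.isUnit] at hpos
    exact absurd hpos (by simp)
  · intro hu
    refine lt_of_le_of_ne (h.nonneg _ ⟨s, rfl⟩) fun heq => hu ?_
    obtain ⟨t, ht⟩ := h.inv_mem _ ⟨s, rfl⟩ h0 heq.symm
    refine IsUnit.of_mul_eq_one t (C.algebraMap_stalk_injective x ?_)
    rw [map_mul, ht, map_one, mul_inv_cancel₀ h0]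

lemma isClosed_of_ord_ne_zero {x : C.X} {a : C.K} (h : Scheme.ord a x ≠ 0) :
    IsClosed ({x} : Set C.X) :=
  (C.isClosed_or_eq_genericPoint x).resolve_right fun hx => h (hx ▸ ord_genericPoint a)

lemma mem_O_of_ord_pos {x : C.X} {a : C.K} (h : 0 < Scheme.ord a x) : a ∈ C.O x := by
  have := C.dvr x (isClosed_of_ord_ne_zero h.ne')
  have hl := C.localOrder x
  obtain ⟨t, ht⟩ | ⟨t, ht⟩ := ValuationRing.isInteger_or_isInteger (C.X.presheaf.stalk x) a
  · exact ⟨t, ht⟩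
  · by_cases ha : a = 0
    · rw [ha]; exact (C.O x).zero_mem
    have h1 := hl.mul a a⁻¹ ha (inv_ne_zero ha)
    have h2 := hl.nonneg a⁻¹ ⟨t, ht⟩
    have h3 := hl.map_one
    rw [mul_inv_cancel₀ ha] at h1
    omega

/-- The zeros of `f` are the primes over `f` of a Dedekind domain `B` with fraction field the
function field and contained in the local rings at these zeros; their orders are the ramification
indices, and the residue field extensions are trivial. -/
lemma finsum_ord_zeros_eq_finrank {R B : Type} [CommRing R] [IsDomain R] [CommRing B]
    [IsDedekindDomain B] [Algebra ℂ R] [Algebra ℂ B] [Algebra R B] [IsScalarTower ℂ R B]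
    [Algebra B C.K] [IsFractionRing B C.K] [Algebra.FiniteType ℂ B] [Module.Finite R B]
    [Module.IsTorsionFree R B] [Module.Flat R B] (f : R) [(Ideal.span {f}).IsMaximal] (a : C.K)
    (ha : algebraMap B C.K (algebraMap R B f) = a) (ha0 : a ≠ 0)
    (hC : ∀ c : ℂ, algebraMap B C.K (algebraMap ℂ B c) = algebraMap ℂ C.K c)
    (hB : ∀ x : C.X, 0 < Scheme.ord a x → ∀ b, algebraMap B C.K b ∈ C.O x) :
    {x : C.X | 0 < Scheme.ord a x}.Finite ∧
      ∑ᶠ x ∈ {x : C.X | 0 < Scheme.ord a x}, Scheme.ord a x = Module.finrank R B := by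
  let P := (Ideal.span {f}).primesOver B
  let _ : Fintype P := (IsDedekindDomain.primesOver_finite (Ideal.span {f}) B).fintype
  have hsum := Ideal.sum_ramification_inertia_eq_finrank (Ideal.span {f}) B
  have hprime : ∀ q : P, (q : Ideal B).IsPrime := fun q => q.2.1
  have hover : ∀ q : P, (q : Ideal B).LiesOver (Ideal.span {f}) := fun q => q.2.2
  have hfB0 : algebraMap R B f ≠ 0 := fun h => ha0 (by rw [← ha, h, map_zero])
  have hmem : ∀ q : P, algebraMap R B f ∈ (q : Ideal B) := fun q => by
    rw [← Ideal.mem_comap, ← Ideal.under_def, ← (hover q).over]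
    exact Ideal.mem_span_singleton_self f
  have hbot : ∀ q : P, (q : Ideal B) ≠ ⊥ := fun q h => hfB0 (by
    have := hmem q
    rwa [h, Ideal.mem_bot] at this)
  choose Φ hclosed φ hφ hqφ using fun q : P =>
    exists_point_of_prime (C := C) B (fun c => ⟨_, hC c⟩) (q : Ideal B) (hbot q)
  have hmap : ∀ q, algebraMap (C.X.presheaf.stalk (Φ q)) C.X.functionField
      (φ q (algebraMap R B f)) = a := fun q => (hφ q _).trans ha
  have hne : ∀ q, φ q (algebraMap R B f) ≠ 0 := fun q h => ha0 (by
    rw [← hmap q, h, map_zero])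
  have hord : ∀ q : P, Scheme.ord a (Φ q) = (q : Ideal B).ramificationIdx R := fun q => by
    have := C.dvr _ (hclosed q)
    let := (φ q).toAlgebra
    have hloc := isLocalization_stalk B (φ q) (hφ q) (q : Ideal B) (hbot q) (hqφ q)
    have hdvr : IsDiscreteValuationRing (Localization.AtPrime (q : Ideal B)) :=
      IsLocalization.AtPrime.isDiscreteValuationRing_of_dedekind_domain B (hbot q) _
    let e := IsLocalization.algEquiv (q : Ideal B).primeCompl
      (Localization.AtPrime (q : Ideal B)) (C.X.presheaf.stalk (Φ q))
    have he : e (algebraMap R (Localization.AtPrime (q : Ideal B)) f) =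
        φ q (algebraMap R B f) := by
      rw [IsScalarTower.algebraMap_apply R B]
      exact e.commutes _
    have hne' : algebraMap R (Localization.AtPrime (q : Ideal B)) f ≠ 0 := fun h => hne q (by
      rw [← he, h, map_zero])
    rw [← hmap q, ord_eq_toNat_ord (hclosed q) (hne q), ramificationIdx_eq_ord f (q : Ideal B),
      ← he]
    exact congrArg (fun k : ℕ∞ => (k.toNat : ℤ)) (ringOrd_map_equiv e.toRingEquiv _ hne')
  have hinj : Function.Injective Φ := fun q q' hqq' => by
    have hcomm : ∀ (x : C.X) (ψ ψ' : B →+* C.X.presheaf.stalk x),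
        (∀ b, algebraMap (C.X.presheaf.stalk x) C.X.functionField (ψ b) = algebraMap B C.K b) →
        (∀ b, algebraMap (C.X.presheaf.stalk x) C.X.functionField (ψ' b) = algebraMap B C.K b) →
        ψ = ψ' := fun x ψ ψ' h h' => RingHom.ext fun b =>
      C.algebraMap_stalk_injective x ((h b).trans (h' b).symm)
    have hext : ∀ (x : C.X) (ψ : B →+* C.X.presheaf.stalk x), Φ q = x →
        (∀ b, algebraMap (C.X.presheaf.stalk x) C.X.functionField (ψ b) = algebraMap B C.K b) →
        (q : Ideal B) = (IsLocalRing.maximalIdeal (C.X.presheaf.stalk x)).comap ψ := by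
      rintro x ψ rfl hψ
      rw [← hcomm _ _ _ (hφ q) hψ]
      exact hqφ q
    exact Subtype.ext ((hext _ (φ q') hqq' (hφ q')).trans (hqφ q').symm)
  have hrange : {x : C.X | 0 < Scheme.ord a x} = Set.range Φ := by
    ext x
    constructor
    · intro hx
      have hxc := isClosed_of_ord_ne_zero (ne_of_gt hx)
      obtain ⟨ψ, hψ⟩ := exists_ringHom_stalk (hB x hx)
      have hψa : algebraMap (C.X.presheaf.stalk x) C.X.functionField (ψ (algebraMap R B f)) = a :=
        (hψ _).trans ha
      have hψ0 : ψ (algebraMap R B f) ≠ 0 := fun h => ha0 (by rw [← hψa, h, map_zero])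
      have hψm : ψ (algebraMap R B f) ∈ IsLocalRing.maximalIdeal (C.X.presheaf.stalk x) := by
        rw [← ord_pos_iff hxc hψ0, hψa]
        exact hx
      let q := (IsLocalRing.maximalIdeal (C.X.presheaf.stalk x)).comap ψ
      have hqp : q.IsPrime := Ideal.comap_isPrime _ _
      have hqo : q.LiesOver (Ideal.span {f}) := by
        refine ⟨Ideal.IsMaximal.eq_of_le inferInstance ?_ ?_⟩
        · exact Ideal.IsPrime.ne_top inferInstance
        · rw [Ideal.span_singleton_le_iff_mem]
          exact hψm
      let q' : P := ⟨q, hqp, hqo⟩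
      refine ⟨q', eq_of_O_eq (le_antisymm ?_ ?_)⟩
      · exact O_le_of_trace_eq B (φ q') (hφ q') ψ hψ q (hbot q') (hqφ q') rfl
      · exact O_le_of_trace_eq B ψ hψ (φ q') (hφ q') q (hbot q') rfl (hqφ q')
    · rintro ⟨q, rfl⟩
      change 0 < Scheme.ord a (Φ q)
      rw [← hmap q, ord_pos_iff (hclosed q) (hne q), ← Ideal.mem_comap, ← hqφ q]
      exact hmem q
  refine ⟨hrange ▸ Set.finite_range Φ, ?_⟩
  rw [hrange, finsum_mem_range hinj, finsum_eq_sum_of_fintype, ← hsum, Nat.cast_sum]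
  refine Finset.sum_congr rfl fun q _ => ?_
  have : (q : Ideal B).IsMaximal :=
    Ideal.IsMaximal.of_liesOver_isMaximal (q : Ideal B) (Ideal.span {f})
  rw [hord, inertiaDeg_eq_one ℂ (Ideal.span {f}) (q : Ideal B), mul_one]

/-- A nonconstant rational function `f` has as many zeros as the degree of the function field over
`ℂ(f)`. -/
lemma finsum_ord_zeros {f : C.K} (hf : Transcendental ℂ f) :
    {x : C.X | 0 < Scheme.ord f x}.Finite ∧
      ∑ᶠ x ∈ {x : C.X | 0 < Scheme.ord f x}, Scheme.ord f x =
        Module.finrank (IntermediateField.adjoin ℂ {f}) C.K := by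
  obtain ⟨hess, htr⟩ := C.essFiniteType_and_trdeg_le
  have hf0 : f ≠ 0 := fun h => hf (h ▸ isAlgebraic_zero)
  obtain ⟨R, B, _, _, _, _, _, _, _, _, _, _, _, _, _, _, a, _, ha, hc, hS, hrank⟩ :=
    exists_integralClosure htr hf
  rw [hrank]
  refine finsum_ord_zeros_eq_finrank a f ha hf0 hc fun x hx =>
    hS (C.O x) (algebraMap_complex_mem_O x) (mem_O_of_ord_pos hx) fun z hz => ?_
  have := C.dvr x (isClosed_of_ord_ne_zero hx.ne')
  have h1 : IsIntegral (C.X.presheaf.stalk x) z :=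
    hz.map_of_comp_eq (stalkEquiv x).symm.toRingHom (RingHom.id C.K)
      (RingHom.ext algebraMap_stalkEquiv_symm)
  exact IsIntegrallyClosed.isIntegral_iff.1 h1

lemma ord_inv (x : C.X) (a : C.K) : Scheme.ord a⁻¹ x = -Scheme.ord a x := by
  have h := C.localOrder x
  by_cases ha : a = 0
  · rw [ha, inv_zero, Scheme.ord_zero]
    simp
  · have h1 := h.mul a a⁻¹ ha (inv_ne_zero ha)
    have h2 := h.map_one
    rw [mul_inv_cancel₀ ha] at h1
    omega

lemma ord_algebraMap_complex (x : C.X) (c : ℂ) : Scheme.ord (algebraMap ℂ C.K c) x = 0 := by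
  have h := C.localOrder x
  have h1 := h.nonneg _ (algebraMap_complex_mem_O x c)
  have h2 := h.nonneg _ (algebraMap_complex_mem_O x c⁻¹)
  rw [map_inv₀] at h2
  have h3 := ord_inv x (algebraMap ℂ C.K c)
  omega

lemma adjoin_inv {K : Type} [Field K] [Algebra ℂ K] (f : K) :
    IntermediateField.adjoin ℂ {f⁻¹} = IntermediateField.adjoin ℂ {f} := by
  apply le_antisymm <;> rw [IntermediateField.adjoin_simple_le_iff]
  · exact inv_mem (IntermediateField.mem_adjoin_simple_self ℂ f)
  · have := inv_mem (IntermediateField.mem_adjoin_simple_self ℂ f⁻¹)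
    rwa [inv_inv] at this

/-- The divisor of a rational function is a finite sum of points, and has degree zero. -/
theorem finsum_ord_eq_zero (f : C.K) :
    (Function.support fun x : C.X => Scheme.ord f x).Finite ∧
      ∑ᶠ x : C.X, Scheme.ord f x = 0 := by
  by_cases hf : Transcendental ℂ f
  · have hf' : Transcendental ℂ f⁻¹ := by
      rwa [Transcendental, IsAlgebraic.inv_iff]
    obtain ⟨h1, h2⟩ := finsum_ord_zeros hf
    obtain ⟨h3, h4⟩ := finsum_ord_zeros hf'
    have hsupp : (Function.support fun x : C.X => Scheme.ord f x) =
        {x : C.X | 0 < Scheme.ord f x} ∪ {x : C.X | 0 < Scheme.ord f⁻¹ x} := by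
      ext x
      simp only [Function.mem_support, Set.mem_union, Set.mem_ofPred_eq, ord_inv]
      omega
    have hdisj : Disjoint {x : C.X | 0 < Scheme.ord f x} {x : C.X | 0 < Scheme.ord f⁻¹ x} := by
      rw [Set.disjoint_left]
      intro x hx hx'
      simp only [Set.mem_ofPred_eq, ord_inv] at hx hx'
      omega
    refine ⟨hsupp ▸ h1.union h3, ?_⟩
    rw [← finsum_mem_support, hsupp, finsum_mem_union hdisj h1 h3, h2]
    have h5 : ∑ᶠ x ∈ {x : C.X | 0 < Scheme.ord f⁻¹ x}, Scheme.ord f x =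
        -∑ᶠ x ∈ {x : C.X | 0 < Scheme.ord f⁻¹ x}, Scheme.ord f⁻¹ x := by
      rw [← finsum_mem_neg_distrib _ h3]
      exact finsum_mem_congr rfl fun x _ => by rw [ord_inv, neg_neg]
    rw [h5, h4, adjoin_inv]
    exact add_neg_cancel _
  · rw [Transcendental, not_not] at hf
    obtain ⟨c, rfl⟩ : ∃ c, algebraMap ℂ C.K c = f := by
      have hint := hf.isIntegral
      have h1 := IsAlgClosed.degree_eq_one_of_irreducible ℂ (minpoly.irreducible hint)
      exact minpoly.mem_range_of_degree_eq_one ℂ f h1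
    have h0 : (fun x : C.X => Scheme.ord (algebraMap ℂ C.K c) x) = 0 :=
      funext fun x => ord_algebraMap_complex x c
    rw [h0]
    exact ⟨by simp, finsum_zero⟩

end Curve

end ParHiggs

/-! ### Degrees of vector bundles -/

namespace ParHiggs

lemma latDeg_reindex {K : Type*} [Field K] {R : Subring K} {v : K → ℤ} {V : Type*}
    [AddCommGroup V] [Module K V] (h : LocalOrder R v) {ι κ : Type*} [Fintype ι] [Fintype κ]
    {L : Submodule R V} (hL : IsLattice L) (b : Module.Basis ι K V) (e : ι ≃ κ) :
    latDeg v L (b.reindex e) = latDeg v L b := by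
  classical
  obtain ⟨c, hc⟩ := hL.exists_basis b
  rw [latDeg_eq h b c hc, latDeg_eq h (b.reindex e) (c.reindex e) (by rw [c.range_reindex, hc])]
  have : (c.reindex e).toMatrix (b.reindex e) = (c.toMatrix b).submatrix e.symm e.symm := by
    ext i j
    simp [Module.Basis.toMatrix_apply]
  rw [this, Matrix.det_submatrix_equiv_self]

/-- The degree of a lattice at the point `x` with respect to a rational basis. -/
noncomputable abbrev latDegAt {C : Curve} {V : Type} [AddCommGroup V] [Module C.K V] {x : C.X}
    (L : Submodule (C.O x) V) {ι : Type*} [Fintype ι] (b : Module.Basis ι C.K V) : ℤ :=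
  latDeg (fun a : C.K => Scheme.ord a x) L b

/-- A family of lattices in a vector space over the function field, one at each point, which is
locally the family spanned by a rational basis. -/
def IsLocallyFree {C : Curve} {V : Type} [AddCommGroup V] [Module C.K V]
    (L : ∀ x : C.X, Submodule (C.O x) V) : Prop :=
  ∀ x : C.X, ∃ U : C.X.Opens, x ∈ U ∧
    ∃ b : Module.Basis (Fin (Module.finrank C.K V)) C.K V,
      ∀ y ∈ U, L y = Submodule.span (C.O y) (Set.range b)

namespace IsLocallyFree

variable {C : Curve} {V : Type} [AddCommGroup V] [Module C.K V]
  {L : ∀ x : C.X, Submodule (C.O x) V}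

lemma isLattice (hL : IsLocallyFree L) (x : C.X) : IsLattice (L x) := by
  obtain ⟨U, hx, b, hb⟩ := hL x
  exact ⟨b, hb x hx⟩

lemma finite_support (hL : IsLocallyFree L) {ι : Type*} [Fintype ι]
    (b : Module.Basis ι C.K V) : (Function.support fun x => latDegAt (L x) b).Finite := by
  classical
  choose U hxU c hc using hL
  obtain ⟨t, ht⟩ := isCompact_univ.elim_finite_subcover (fun x => (U x : Set C.X))
    (fun x => (U x).isOpen) fun x _ => Set.mem_iUnion.2 ⟨x, hxU x⟩
  let e := Fintype.equivFinOfCardEq (Module.finrank_eq_card_basis b).symm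
  refine (t.finite_toSet.biUnion fun x _ =>
    (C.finsum_ord_eq_zero ((((c x).reindex e.symm).toMatrix b).det : C.K)).1).subset
      fun y hy => ?_
  obtain ⟨x, hxt, hyx⟩ := Set.mem_iUnion₂.1 (ht (Set.mem_univ y))
  refine Set.mem_iUnion₂.2 ⟨x, hxt, ?_⟩
  rw [Function.mem_support] at hy ⊢
  rwa [latDegAt, latDeg_eq (C.localOrder y) b ((c x).reindex e.symm)
    (by rw [Module.Basis.range_reindex]; exact hc x y hyx)] at hy

lemma finsum_latDegAt_change (hL : IsLocallyFree L) {ι : Type*} [Fintype ι]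
    (b b' : Module.Basis ι C.K V) :
    ∑ᶠ x, latDegAt (L x) b' = ∑ᶠ x, latDegAt (L x) b := by
  classical
  obtain ⟨h1, h2⟩ := C.finsum_ord_eq_zero ((b.toMatrix b').det : C.K)
  rw [finsum_congr fun x => latDeg_change (C.localOrder x) (hL.isLattice x) b b',
    finsum_add_distrib (hL.finite_support b) h1, h2, add_zero]

end IsLocallyFree

namespace VectorBundle

variable {C : Curve} (E : VectorBundle C)

lemma stalk_eq_span_frame (x : C.X) :
    E.stalk x = Submodule.span (C.O x) (Set.range (E.frame x)) :=
  (E.locallyFree x).choose_spec.2.choose_spec x (E.locallyFree x).choose_spec.1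

lemma finrank_eq : Module.finrank C.K E.V = E.rank := by
  rw [Module.finrank_eq_card_basis E.rationalFrame, Fintype.card_fin]

instance : Module.Finite C.K E.V := Module.Finite.of_basis E.rationalFrame

lemma isLocallyFree : IsLocallyFree E.stalk := fun x => by
  obtain ⟨U, hx, b, hb⟩ := E.locallyFree x
  refine ⟨U, hx, b.reindex (finCongr E.finrank_eq.symm), fun y hy => ?_⟩
  rw [Module.Basis.range_reindex, hb y hy]

lemma isLattice (x : C.X) : IsLattice (E.stalk x) := E.isLocallyFree.isLattice x

/-- The degree may be computed with any rational basis: a change of basis changes the divisor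
of its determinant by a principal one. -/
lemma degree_eq {ι : Type*} [Fintype ι] (b : Module.Basis ι C.K E.V) :
    E.degree = ∑ᶠ x, latDegAt (E.stalk x) b := by
  let e : ι ≃ Fin E.rank := Fintype.equivOfCardEq (by
    rw [← Module.finrank_eq_card_basis b, E.finrank_eq, Fintype.card_fin])
  have h1 : E.degree = ∑ᶠ x, latDegAt (E.stalk x) E.rationalFrame := finsum_congr fun x =>
    (latDeg_eq (C.localOrder x) E.rationalFrame (E.frame x) (E.stalk_eq_span_frame x)).symm
  rw [h1, E.isLocallyFree.finsum_latDegAt_change (b.reindex e) E.rationalFrame]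
  exact finsum_congr fun x => latDeg_reindex (C.localOrder x) (E.isLattice x) b e

/-- The bundle with given generic stalk and stalks. -/
noncomputable def ofStalks {V : Type} [AddCommGroup V] [Module C.K V]
    (L : ∀ x : C.X, Submodule (C.O x) V) (hL : IsLocallyFree L) : VectorBundle C where
  V := V
  rank := Module.finrank C.K V
  stalk := L
  locallyFree := hL

/-- Additivity of the degree. -/
lemma degree_add {E' E E'' : VectorBundle C} {inc : E'.V →ₗ[C.K] E.V}
    {proj : E.V →ₗ[C.K] E''.V} (S : ShortExactSeq inc proj)
    (h' : ∀ x, (E.stalk x).comap (atPt inc x) = E'.stalk x)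
    (h'' : ∀ x, (E.stalk x).map (atPt proj x) = E''.stalk x) :
    E.degree = E'.degree + E''.degree := by
  choose u hu using fun i => S.surj (E''.rationalFrame i)
  rw [E.degree_eq (S.sumBasis E'.rationalFrame E''.rationalFrame u hu),
    E'.degree_eq E'.rationalFrame, E''.degree_eq E''.rationalFrame,
    ← finsum_add_distrib (E'.isLocallyFree.finite_support _)
      (E''.isLocallyFree.finite_support _)]
  refine finsum_congr fun x => ?_
  rw [latDegAt, S.latDeg_sumBasis _ _ u hu (C.localOrder x) (E.isLattice x)]
  rw [← h', ← h'']

lemma rank_add {E' E E'' : VectorBundle C} {inc : E'.V →ₗ[C.K] E.V}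
    {proj : E.V →ₗ[C.K] E''.V} (S : ShortExactSeq inc proj) :
    E.rank = E'.rank + E''.rank := by
  rw [← E.finrank_eq, ← E'.finrank_eq, ← E''.finrank_eq]
  choose u hu using fun i => S.surj (E''.rationalFrame i)
  rw [Module.finrank_eq_card_basis (S.sumBasis E'.rationalFrame E''.rationalFrame u hu),
    Fintype.card_sum, Fintype.card_fin, Fintype.card_fin, E'.finrank_eq, E''.finrank_eq]

lemma latDegAt_le_of_map_le {E' E : VectorBundle C} (f : E'.V ≃ₗ[C.K] E.V)
    (b : Module.Basis (Fin E'.rank) C.K E'.V) (x : C.X)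
    (hf : (E'.stalk x).map (atPt f.toLinearMap x) ≤ E.stalk x) :
    latDegAt (E'.stalk x) b ≤ latDegAt (E.stalk x) (b.map f) := by
  obtain ⟨h1, h2⟩ := latDeg_map_equiv (C.localOrder x) (E'.isLattice x) b f
  rw [latDegAt, ← h2]
  exact latDeg_mono (C.localOrder x) h1 (E.isLattice x) hf _

/-- The degree grows with the stalks, by at least the sum of the growths of the degrees of the
stalks at finitely many given points. -/
lemma degree_add_le {E' E : VectorBundle C} (f : E'.V ≃ₗ[C.K] E.V)
    (hf : ∀ x, (E'.stalk x).map (atPt f.toLinearMap x) ≤ E.stalk x)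
    (b : Module.Basis (Fin E'.rank) C.K E'.V) (s : Finset C.X) :
    E'.degree + ∑ x ∈ s, (latDegAt (E.stalk x) (b.map f) - latDegAt (E'.stalk x) b) ≤
      E.degree := by
  have h0 : ∀ x, 0 ≤ latDegAt (E.stalk x) (b.map f) - latDegAt (E'.stalk x) b := fun x =>
    sub_nonneg.2 (latDegAt_le_of_map_le f b x (hf x))
  have hfin1 := E.isLocallyFree.finite_support (b.map f)
  have hfin2 := E'.isLocallyFree.finite_support b
  have hfin : (Function.support fun x =>
      latDegAt (E.stalk x) (b.map f) - latDegAt (E'.stalk x) b).Finite :=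
    (hfin1.union hfin2).subset (Function.support_sub _ _)
  have h2 : E.degree - E'.degree =
      ∑ᶠ x, (latDegAt (E.stalk x) (b.map f) - latDegAt (E'.stalk x) b) := by
    rw [finsum_sub_distrib hfin1 hfin2, ← E.degree_eq, ← E'.degree_eq]
  classical
  have h3 : ∑ x ∈ s, (latDegAt (E.stalk x) (b.map f) - latDegAt (E'.stalk x) b) ≤
      ∑ᶠ x, (latDegAt (E.stalk x) (b.map f) - latDegAt (E'.stalk x) b) := by
    rw [finsum_eq_sum_of_support_subset (s := s ∪ hfin.toFinset) _ (by simp)]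
    exact Finset.sum_le_sum_of_subset_of_nonneg Finset.subset_union_left fun x _ _ => h0 x
  linarith

lemma stalk_eq_of_degree_eq {E' E : VectorBundle C} (f : E'.V ≃ₗ[C.K] E.V)
    (hf : ∀ x, (E'.stalk x).map (atPt f.toLinearMap x) ≤ E.stalk x)
    (hdeg : E.degree ≤ E'.degree) (x : C.X) :
    (E'.stalk x).map (atPt f.toLinearMap x) = E.stalk x := by
  have h := degree_add_le f hf E'.rationalFrame {x}
  rw [Finset.sum_singleton] at h
  obtain ⟨h1, h2⟩ := latDeg_map_equiv (C.localOrder x) (E'.isLattice x) E'.rationalFrame f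
  refine eq_of_latDeg_eq (C.localOrder x) h1 (E.isLattice x) (hf x) (E'.rationalFrame.map f)
    (le_antisymm (latDeg_mono (C.localOrder x) h1 (E.isLattice x) (hf x) _) ?_)
  rw [h2]
  simp only [latDegAt] at h
  linarith

end VectorBundle

/-! ### Subbundles and quotient bundles -/

namespace ShortExactSeq

variable {C : Curve} {W V Q : Type} [AddCommGroup V] [Module C.K V] [AddCommGroup W]
  [Module C.K W] [AddCommGroup Q] [Module C.K Q] {inc : W →ₗ[C.K] V} {proj : V →ₗ[C.K] Q}

/-- A basis adapted to the exact sequence at one point is adapted to it nearby. -/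
lemma exists_opens_adapted_basis [Module.Finite C.K V] (S : ShortExactSeq inc proj)
    {L : ∀ x : C.X, Submodule (C.O x) V} (hL : IsLocallyFree L) (x : C.X) :
    ∃ U : C.X.Opens, x ∈ U ∧ ∃ (c' : Module.Basis (Fin (Module.finrank C.K W)) C.K W)
      (c'' : Module.Basis (Fin (Module.finrank C.K Q)) C.K Q) (t : _ → V)
      (ht : ∀ i, proj (t i) = c'' i), ∀ y ∈ U,
      L y = Submodule.span (C.O y) (Set.range (S.sumBasis c' c'' t ht)) := by
  have : Module.Finite C.K W := Module.Finite.of_injective inc S.inj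
  have : Module.Finite C.K Q := Module.Finite.of_surjective proj S.surj
  obtain ⟨c', c'', t, ht, hx⟩ := S.exists_adapted_basis (C.localOrder x) (hL.isLattice x)
    (Module.finBasis C.K W) (Module.finBasis C.K Q)
  obtain ⟨U, hxU, b, hb⟩ := hL x
  let c := S.sumBasis c' c'' t ht
  have h1 : ∀ j, c j ∈ Submodule.span (C.O x) (Set.range b) := fun j => by
    rw [← hb x hxU, hx]
    exact Submodule.subset_span ⟨j, rfl⟩
  have h2 : ∀ j, b j ∈ Submodule.span (C.O x) (Set.range c) := fun j => by
    rw [← hx, hb x hxU]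
    exact Submodule.subset_span ⟨j, rfl⟩
  simp only [mem_span_basis_iff] at h1 h2
  have key : ∀ a ∈ C.O x, ∀ᶠ y in 𝓝 x, a ∈ C.O y := fun a ha => by
    obtain ⟨U, hxU, hU⟩ := C.exists_opens_mem_O ha
    exact Filter.eventually_of_mem (U.isOpen.mem_nhds hxU) hU
  have h3 : ∀ᶠ y in 𝓝 x, y ∈ U ∧ (∀ j i, b.repr (c j) i ∈ C.O y) ∧
      ∀ j i, c.repr (b j) i ∈ C.O y := by
    refine Filter.Eventually.and (U.isOpen.mem_nhds hxU) (Filter.Eventually.and ?_ ?_)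
    · exact Filter.eventually_all.2 fun j => Filter.eventually_all.2 fun i => key _ (h1 j i)
    · exact Filter.eventually_all.2 fun j => Filter.eventually_all.2 fun i => key _ (h2 j i)
  obtain ⟨U', hU', hopen, hxU'⟩ := eventually_nhds_iff.1 h3
  refine ⟨⟨U', hopen⟩, hxU', c', c'', t, ht, fun y hy => ?_⟩
  obtain ⟨hyU, h4, h5⟩ := hU' y hy
  rw [hb y hyU]
  refine le_antisymm ?_ ?_ <;> rw [Submodule.span_le] <;> rintro _ ⟨j, rfl⟩
  · exact (mem_span_basis_iff c (b j)).2 fun i => h5 j i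
  · exact (mem_span_basis_iff b (c j)).2 fun i => h4 j i

lemma isLocallyFree_comap [Module.Finite C.K V] (S : ShortExactSeq inc proj)
    {L : ∀ x : C.X, Submodule (C.O x) V} (hL : IsLocallyFree L) :
    IsLocallyFree fun x => (L x).comap (atPt inc x) := fun x => by
  obtain ⟨U, hx, c', c'', t, ht, h⟩ := S.exists_opens_adapted_basis hL x
  exact ⟨U, hx, c', fun y hy => by
    beta_reduce
    rw [h y hy, S.comap_span_sumBasis]⟩

lemma isLocallyFree_map [Module.Finite C.K V] (S : ShortExactSeq inc proj)
    {L : ∀ x : C.X, Submodule (C.O x) V} (hL : IsLocallyFree L) :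
    IsLocallyFree fun x => (L x).map (atPt proj x) := fun x => by
  obtain ⟨U, hx, c', c'', t, ht, h⟩ := S.exists_opens_adapted_basis hL x
  exact ⟨U, hx, c'', fun y hy => by
    beta_reduce
    rw [h y hy, S.map_span_sumBasis]⟩

end ShortExactSeq

end ParHiggs

/-! ### Parabolic bundles with weakly increasing flags -/

namespace ParHiggs

lemma latDeg_sub_latDeg {K : Type*} [Field K] {R : Subring K} {v : K → ℤ} {V : Type*}
    [AddCommGroup V] [Module K V] (h : LocalOrder R v) {ι κ : Type*} [Fintype ι] [Fintype κ]
    {L L' : Submodule R V} (hL : IsLattice L) (hL' : IsLattice L') (b : Module.Basis ι K V)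
    (b' : Module.Basis κ K V) :
    latDeg v L' b - latDeg v L b = latDeg v L' b' - latDeg v L b' := by
  classical
  let e : ι ≃ κ := Fintype.equivOfCardEq (by
    rw [← Module.finrank_eq_card_basis b, Module.finrank_eq_card_basis b'])
  rw [← latDeg_reindex h hL b e, ← latDeg_reindex h hL' b e, latDeg_change h hL b' (b.reindex e),
    latDeg_change h hL' b' (b.reindex e)]
  ring

/-- Summation by parts, for weights decreasing in `[0, 1)`. -/
lemma sum_sub_mul_le {r : ℕ} (a : ℕ → ℝ) (ha : ∀ j, 0 ≤ a j) (w : Fin r → ℝ)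
    (hw1 : ∀ j, w j < 1) (hw : ∀ j k, j < k → w k < w j) (hw0 : ∀ j, 0 ≤ w j) :
    ∑ j : Fin r, (a j - a (j + 1)) * w j ≤ a 0 := by
  let w' : ℕ → ℝ := fun j => if h : j < r then w ⟨j, h⟩ else 0
  have hw'0 : ∀ j, 0 ≤ w' j := fun j => by
    simp only [w']
    split_ifs
    exacts [hw0 _, le_rfl]
  have hw'1 : ∀ j, w' j ≤ 1 := fun j => by
    simp only [w']
    split_ifs
    exacts [(hw1 _).le, zero_le_one]
  have hanti : ∀ j, w' (j + 1) ≤ w' j := fun j => by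
    by_cases h : j + 1 < r
    · simp only [w', h, dif_pos, Nat.lt_of_succ_lt h]
      exact (hw _ _ (Fin.mk_lt_mk.2 j.lt_succ_self)).le
    · simp only [w', h, dif_neg, not_false_iff]
      exact hw'0 j
  have key : ∀ m, ∑ j ∈ Finset.range m, (a j - a (j + 1)) * w' j ≤ a 0 - a m * w' m := by
    intro m
    induction m with
    | zero =>
      rw [Finset.sum_range_zero]
      nlinarith [ha 0, hw'1 0]
    | succ m ih =>
      rw [Finset.sum_range_succ]
      nlinarith [ha (m + 1), hanti m]
  have h1 : ∑ j : Fin r, (a j - a (j + 1)) * w j =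
      ∑ j ∈ Finset.range r, (a j - a (j + 1)) * w' j := by
    rw [Finset.sum_range]
    exact Finset.sum_congr rfl fun j _ => by simp [w']
  rw [h1]
  refine (key r).trans ?_
  simp [w']

/-- A vector bundle with chains `0 = E_{i,0} ⊆ ⋯ ⊆ E_{i,r} = E_{p_i}` of subspaces of the fibres,
where successive subspaces may coincide, recorded by their inverse images in the stalks. -/
structure ParBundle (C : Curve) {n : ℕ} (p : Fin n → C.X) (r : ℕ) extends VectorBundle C where
  /-- the chains -/
  flag : (i : Fin n) → ℕ → Submodule (C.O (p i)) V
  flag_zero : ∀ i, flag i 0 = C.m (p i) • stalk (p i)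
  flag_mono : ∀ i, Monotone (flag i)
  flag_top : ∀ i j, r ≤ j → flag i j = stalk (p i)

namespace ParBundle

variable {C : Curve} {n : ℕ} {p : Fin n → C.X} {r : ℕ} (P : ParBundle C p r)

/-- The dimension of the quotient of two successive subspaces in a fibre, computed as the difference
of the degrees of their inverse images in the stalk. -/
noncomputable def jump (i : Fin n) (j : ℕ) : ℤ :=
  latDegAt (P.flag i (j + 1)) P.rationalFrame - latDegAt (P.flag i j) P.rationalFrame

/-- The parabolic degree. -/
noncomputable def pdeg (w : Weights n r) : ℝ :=
  (P.degree : ℝ) + ∑ i, ∑ j : Fin r, (P.jump i j : ℝ) * w i j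

lemma isLattice_flag (hp : ∀ i, IsClosed ({p i} : Set C.X)) (i : Fin n) (j : ℕ) :
    IsLattice (P.flag i j) := by
  obtain ⟨π, hπ, hπ0, hπ1⟩ := Curve.exists_uniformizer (hp i)
  have h0 := (latDeg_smul (C.localOrder (p i)) (P.isLattice (p i)) P.rationalFrame hπ hπ0 hπ1).1
  rw [← P.flag_zero i] at h0
  refine h0.of_between (C.localOrder (p i)) (P.isLattice (p i)) (P.flag_mono i (Nat.zero_le j)) ?_
  rw [← P.flag_top i (max j r) (le_max_right _ _)]
  exact P.flag_mono i (le_max_left _ _)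

lemma jump_eq (hp : ∀ i, IsClosed ({p i} : Set C.X)) {ι : Type*} [Fintype ι]
    (b : Module.Basis ι C.K P.V) (i : Fin n) (j : ℕ) :
    P.jump i j = latDegAt (P.flag i (j + 1)) b - latDegAt (P.flag i j) b :=
  latDeg_sub_latDeg (C.localOrder _) (P.isLattice_flag hp i _) (P.isLattice_flag hp i _) _ _

lemma jump_nonneg (hp : ∀ i, IsClosed ({p i} : Set C.X)) (i : Fin n) (j : ℕ) :
    0 ≤ P.jump i j :=
  sub_nonneg.2 (latDeg_mono (C.localOrder _) (P.isLattice_flag hp i _) (P.isLattice_flag hp i _)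
    (P.flag_mono i j.le_succ) _)

lemma jump_eq_zero_iff (hp : ∀ i, IsClosed ({p i} : Set C.X)) (i : Fin n) (j : ℕ) :
    P.jump i j = 0 ↔ P.flag i j = P.flag i (j + 1) := by
  refine ⟨fun h => ?_, fun h => by rw [jump, h, sub_self]⟩
  exact eq_of_latDeg_eq (C.localOrder _) (P.isLattice_flag hp i _) (P.isLattice_flag hp i _)
    (P.flag_mono i j.le_succ) P.rationalFrame (sub_eq_zero.1 h).symm

lemma sum_range_jump (hp : ∀ i, IsClosed ({p i} : Set C.X)) {ι : Type*} [Fintype ι]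
    (b : Module.Basis ι C.K P.V) (i : Fin n) (m : ℕ) :
    ∑ j ∈ Finset.range m, P.jump i j = latDegAt (P.flag i m) b - latDegAt (P.flag i 0) b := by
  rw [← Finset.sum_range_sub (fun j => latDegAt (P.flag i j) b)]
  exact Finset.sum_congr rfl fun j _ => P.jump_eq hp b i j

/-- The dimension of the fibre is the rank. -/
lemma latDegAt_flag_zero (hp : ∀ i, IsClosed ({p i} : Set C.X))
    (b : Module.Basis (Fin P.rank) C.K P.V) (i : Fin n) :
    latDegAt (P.flag i 0) b = latDegAt (P.stalk (p i)) b - P.rank := by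
  obtain ⟨π, hπ, hπ0, hπ1⟩ := Curve.exists_uniformizer (hp i)
  have := (latDeg_smul (C.localOrder (p i)) (P.isLattice (p i)) b hπ hπ0 hπ1).2
  rw [Fintype.card_fin] at this
  rw [P.flag_zero, latDegAt, this]

lemma sum_jump (hp : ∀ i, IsClosed ({p i} : Set C.X)) (i : Fin n) :
    ∑ j : Fin r, P.jump i j = P.rank := by
  rw [Fin.sum_univ_eq_sum_range (fun j => P.jump i j) r, P.sum_range_jump hp P.rationalFrame,
    P.latDegAt_flag_zero hp, P.flag_top i r le_rfl]
  ring

/-- An exact sequence of parabolic bundles: the sub and the quotient carry the induced flags. -/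
structure IsExact (P' P P'' : ParBundle C p r) (inc : P'.V →ₗ[C.K] P.V)
    (proj : P.V →ₗ[C.K] P''.V) : Prop extends ShortExactSeq inc proj where
  stalk_inc : ∀ x, (P.stalk x).comap (atPt inc x) = P'.stalk x
  stalk_proj : ∀ x, (P.stalk x).map (atPt proj x) = P''.stalk x
  flag_inc : ∀ i j, (P.flag i j).comap (atPt inc (p i)) = P'.flag i j
  flag_proj : ∀ i j, (P.flag i j).map (atPt proj (p i)) = P''.flag i j

namespace IsExact

variable {P' P P'' : ParBundle C p r} {inc : P'.V →ₗ[C.K] P.V} {proj : P.V →ₗ[C.K] P''.V}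

lemma degree_add (S : IsExact P' P P'' inc proj) : P.degree = P'.degree + P''.degree :=
  VectorBundle.degree_add S.toShortExactSeq S.stalk_inc S.stalk_proj

lemma rank_add (S : IsExact P' P P'' inc proj) : P.rank = P'.rank + P''.rank :=
  VectorBundle.rank_add S.toShortExactSeq

lemma jump_add (S : IsExact P' P P'' inc proj) (hp : ∀ i, IsClosed ({p i} : Set C.X))
    (i : Fin n) (j : ℕ) : P.jump i j = P'.jump i j + P''.jump i j := by
  choose u hu using fun i => S.surj (P''.rationalFrame i)
  rw [P.jump_eq hp (S.toShortExactSeq.sumBasis P'.rationalFrame P''.rationalFrame u hu), latDegAt,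
    latDegAt, S.toShortExactSeq.latDeg_sumBasis _ _ u hu (C.localOrder _) (P.isLattice_flag hp i _),
    S.toShortExactSeq.latDeg_sumBasis _ _ u hu (C.localOrder _) (P.isLattice_flag hp i _)]
  have h1 := S.flag_inc i
  have h2 := S.flag_proj i
  simp only [atPt] at h1 h2
  simp only [h1, h2, jump, latDegAt]
  ring

lemma pdeg_add (S : IsExact P' P P'' inc proj) (hp : ∀ i, IsClosed ({p i} : Set C.X))
    (w : Weights n r) : P.pdeg w = P'.pdeg w + P''.pdeg w := by
  simp only [pdeg, S.degree_add, S.jump_add hp, Int.cast_add, add_mul, Finset.sum_add_distrib]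
  ring

end IsExact

variable {P}

/-- A homomorphism of parabolic bundles which is generically an isomorphism does not decrease the
parabolic degree. -/
lemma pdeg_le {P' : ParBundle C p r} (hp : ∀ i, IsClosed ({p i} : Set C.X))
    (hpi : Function.Injective p) (f : P'.V ≃ₗ[C.K] P.V)
    (hf : ∀ x, (P'.stalk x).map (atPt f.toLinearMap x) ≤ P.stalk x)
    (hflag : ∀ i j, (P'.flag i j).map (atPt f.toLinearMap (p i)) ≤ P.flag i j)
    {w : Weights n r} (hw : w ∈ weightSpace n r) : P'.pdeg w ≤ P.pdeg w := by
  classical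
  let b := P'.rationalFrame
  let a : Fin n → ℕ → ℤ := fun i j =>
    latDegAt (P.flag i j) (b.map f) - latDegAt (P'.flag i j) b
  have ha : ∀ i j, 0 ≤ a i j := fun i j => by
    obtain ⟨h1, h2⟩ := latDeg_map_equiv (C.localOrder (p i)) (P'.isLattice_flag hp i j) b f
    simp only [a, latDegAt]
    rw [← h2]
    exact sub_nonneg.2 (latDeg_mono (C.localOrder _) h1 (P.isLattice_flag hp i j) (hflag i j) _)
  have hrank : P'.rank = P.rank := by
    rw [← P'.finrank_eq, ← P.finrank_eq, f.finrank_eq]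
  have ha0 : ∀ i, a i 0 =
      latDegAt (P.stalk (p i)) (b.map f) - latDegAt (P'.stalk (p i)) b := fun i => by
    have h1 := P'.latDegAt_flag_zero hp b i
    have h2 := P.latDegAt_flag_zero hp ((b.map f).reindex (finCongr hrank)) i
    rw [latDegAt, latDegAt, latDeg_reindex (C.localOrder _) (P.isLattice_flag hp i 0),
      latDeg_reindex (C.localOrder _) (P.isLattice _)] at h2
    simp only [a, latDegAt] at h1 ⊢
    omega
  have hdeg := VectorBundle.degree_add_le f hf b (Finset.univ.image p)
  rw [Finset.sum_image fun i _ j _ h => hpi h] at hdeg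
  have hsum : ∀ i, ∑ j : Fin r, (P'.jump i j : ℝ) * w i j - ∑ j : Fin r, (P.jump i j : ℝ) * w i j ≤
      a i 0 := fun i => by
    refine le_trans (le_of_eq ?_) (sum_sub_mul_le (fun j => (a i j : ℝ))
      (fun j => by exact_mod_cast ha i j) (w i) (hw i).1 (hw i).2.1 (hw i).2.2)
    rw [← Finset.sum_sub_distrib]
    refine Finset.sum_congr rfl fun j _ => ?_
    rw [P'.jump_eq hp b, P.jump_eq hp (b.map f), ← sub_mul]
    simp only [a]
    push_cast
    ring
  have hdeg' : (P'.degree : ℝ) + ∑ i, (a i 0 : ℝ) ≤ P.degree := by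
    simp only [ha0]
    exact_mod_cast hdeg
  have := Finset.sum_le_sum fun i (_ : i ∈ Finset.univ) => hsum i
  rw [Finset.sum_sub_distrib] at this
  simp only [pdeg]
  linarith

/-- In the situation of `pdeg_le`, the flags agree if the stalks and the dimensions do. -/
lemma flag_eq_of_jump_eq {P' : ParBundle C p r} (hp : ∀ i, IsClosed ({p i} : Set C.X))
    (f : P'.V ≃ₗ[C.K] P.V)
    (hf : ∀ x, (P'.stalk x).map (atPt f.toLinearMap x) = P.stalk x)
    (hflag : ∀ i j, (P'.flag i j).map (atPt f.toLinearMap (p i)) ≤ P.flag i j)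
    (hjump : ∀ i j, j < r → P'.jump i j = P.jump i j) (i : Fin n) (j : ℕ) :
    (P'.flag i j).map (atPt f.toLinearMap (p i)) = P.flag i j := by
  by_cases hj : r ≤ j
  · rw [P'.flag_top i j hj, P.flag_top i j hj, hf]
  rw [not_le] at hj
  let b := P'.rationalFrame
  obtain ⟨h1, h2⟩ := latDeg_map_equiv (C.localOrder (p i)) (P'.isLattice_flag hp i j) b f
  refine eq_of_latDeg_eq (C.localOrder _) h1 (P.isLattice_flag hp i j) (hflag i j) (b.map f) ?_
  rw [h2]
  have h3 := P'.sum_range_jump hp b i j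
  rw [Finset.sum_congr rfl fun k hk =>
      hjump i k (lt_of_lt_of_le (Finset.mem_range.1 hk) hj.le),
    P.sum_range_jump hp (b.map f)] at h3
  have h4 : latDegAt (P.flag i 0) (b.map f) = latDegAt (P'.flag i 0) b := by
    have h5 : (P'.flag i 0).map (atPt f.toLinearMap (p i)) = P.flag i 0 := by
      rw [P'.flag_zero, P.flag_zero, ← hf, Submodule.map_smul'']
    obtain ⟨-, h6⟩ := latDeg_map_equiv (C.localOrder (p i)) (P'.isLattice_flag hp i 0) b f
    rw [latDegAt, latDegAt, ← h6, ← h5]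
  simp only [latDegAt] at h3 h4 ⊢
  omega

end ParBundle

end ParHiggs

namespace ParHiggs

open Pointwise in
lemma comap_smul_span_singleton {K : Type*} [Field K] {R : Subring K} {V W : Type*}
    [AddCommGroup V] [Module K V] [AddCommGroup W] [Module K W] (inc : W →ₗ[K] V)
    (L : Submodule R V) {π : R} (hπ : (π : K) ≠ 0) {I : Ideal R} (hI : I = Ideal.span {π}) :
    (I • L).comap (inc.restrictScalars R) = I • L.comap (inc.restrictScalars R) := by
  subst hI
  ext v
  rw [Submodule.mem_comap, Submodule.ideal_span_singleton_smul, Submodule.ideal_span_singleton_smul,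
    Submodule.mem_smul_pointwise_iff_exists, Submodule.mem_smul_pointwise_iff_exists]
  constructor
  · rintro ⟨u, hu, huv⟩
    have hv : u = inc ((π : K)⁻¹ • v) := by
      rw [map_smul, ← LinearMap.coe_restrictScalars R inc, ← huv]
      exact (inv_smul_smul₀ hπ u).symm
    refine ⟨(π : K)⁻¹ • v, ?_, smul_inv_smul₀ hπ v⟩
    rw [Submodule.mem_comap]
    exact hv ▸ hu
  · rintro ⟨u, hu, rfl⟩
    exact ⟨inc u, hu, (map_smul (inc.restrictScalars R) π u).symm⟩

lemma Curve.comap_m_smul {C : Curve} {x : C.X} (hx : IsClosed ({x} : Set C.X)) {V W : Type}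
    [AddCommGroup V] [Module C.K V] [AddCommGroup W] [Module C.K W] (inc : W →ₗ[C.K] V)
    (L : Submodule (C.O x) V) :
    (C.m x • L).comap (atPt inc x) = C.m x • L.comap (atPt inc x) := by
  obtain ⟨π, hπ, hπ0, -⟩ := exists_uniformizer hx
  exact comap_smul_span_singleton inc L hπ0 hπ

lemma shortExactSeq_mkQ {K V W : Type*} [Field K] [AddCommGroup V] [Module K V] [AddCommGroup W]
    [Module K W] (inc : W →ₗ[K] V) (h : Function.Injective inc) :
    ShortExactSeq inc (LinearMap.range inc).mkQ :=
  ⟨h, Submodule.mkQ_surjective _, LinearMap.exact_iff.2 (by rw [Submodule.ker_mkQ])⟩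

lemma shortExactSeq_subtype_ker {K V Q : Type*} [Field K] [AddCommGroup V] [Module K V]
    [AddCommGroup Q] [Module K Q] (proj : V →ₗ[K] Q) (h : Function.Surjective proj) :
    ShortExactSeq (LinearMap.ker proj).subtype proj :=
  ⟨Subtype.val_injective, h, LinearMap.exact_iff.2 (by rw [Submodule.range_subtype])⟩

namespace ParBundle

variable {C : Curve} {n : ℕ} {p : Fin n → C.X} {r : ℕ}

/-- The quotient bundle of a parabolic bundle with a given generic stalk. -/
noncomputable def quot (P : ParBundle C p r) {Q : Type}
    [AddCommGroup Q] [Module C.K Q] (proj : P.V →ₗ[C.K] Q) (h : Function.Surjective proj) :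
    ParBundle C p r where
  toVectorBundle := VectorBundle.ofStalks (fun x => (P.stalk x).map (atPt proj x))
    ((shortExactSeq_subtype_ker proj h).isLocallyFree_map P.isLocallyFree)
  flag i j := (P.flag i j).map (atPt proj (p i))
  flag_zero i := (congrArg (Submodule.map (atPt proj (p i))) (P.flag_zero i)).trans
    (Submodule.map_smul'' (C.m (p i)) (P.stalk (p i)) (atPt proj (p i)))
  flag_mono i _ _ hjk := Submodule.map_mono (P.flag_mono i hjk)
  flag_top i j hj := congrArg (Submodule.map (atPt proj (p i))) (P.flag_top i j hj)

end ParBundle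

lemma ParBundle.IsExact.jump_le {C : Curve} {n : ℕ} {p : Fin n → C.X} {r : ℕ}
    {P' P P'' : ParBundle C p r} {inc : P'.V →ₗ[C.K] P.V} {proj : P.V →ₗ[C.K] P''.V}
    (S : ParBundle.IsExact P' P P'' inc proj) (hp : ∀ i, IsClosed ({p i} : Set C.X))
    (i : Fin n) (j : ℕ) : P'.jump i j ≤ P.jump i j := by
  rw [S.jump_add hp]
  exact le_add_of_nonneg_right (P''.jump_nonneg hp i j)

/-! ### Sub-PHBs and their discrete data -/

namespace QPHB

variable {C : Curve} {n : ℕ} {p : Fin n → C.X} {r : ℕ}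

lemma flag_mono (E : QPHB C p r) (i : Fin n) : Monotone (E.flag i) := by
  refine monotone_nat_of_le_succ fun j => ?_
  by_cases hj : j < r
  · exact (E.flag_lt i j hj).le
  · rw [E.flag_top i j (not_lt.1 hj), E.flag_top i (j + 1) (Nat.le_succ_of_le (not_lt.1 hj))]

/-- The parabolic bundle underlying a quasi-parabolic Higgs bundle. -/
def toPar (E : QPHB C p r) : ParBundle C p r where
  toVectorBundle := E.toVectorBundle
  flag := E.flag
  flag_zero := E.flag_zero
  flag_mono := E.flag_mono
  flag_top := E.flag_top

lemma toPar_jump (E : QPHB C p r) (hp : ∀ i, IsClosed ({p i} : Set C.X)) (i : Fin n) (j : Fin r) :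
    E.toPar.jump i j = 1 := by
  -- the `r` dimensions are positive, and their sum is the rank `r`
  have h1 : ∀ j : Fin r, 1 ≤ E.toPar.jump i j := fun j => by
    refine lt_of_le_of_ne (E.toPar.jump_nonneg hp i j) fun h => ?_
    exact (E.flag_lt i j j.2).ne ((E.toPar.jump_eq_zero_iff hp i j).1 h.symm)
  have h2 : ∑ j : Fin r, E.toPar.jump i j = ∑ _j : Fin r, 1 := by
    rw [E.toPar.sum_jump hp, Finset.sum_const, Finset.card_univ, Fintype.card_fin]
    change ((E.rank : ℕ) : ℤ) = _
    rw [E.rank_eq]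
    simp
  exact ((Finset.sum_eq_sum_iff_of_le fun j _ => h1 j).1 h2.symm j (Finset.mem_univ j)).symm

lemma toPar_pdeg (E : QPHB C p r) (hp : ∀ i, IsClosed ({p i} : Set C.X)) (w : Weights n r) :
    E.toPar.pdeg w = E.pdeg w := by
  simp only [ParBundle.pdeg, pdeg, E.toPar_jump hp, Int.cast_one, one_mul]
  rfl

namespace Sub

variable {E : QPHB C p r}

/-- The parabolic bundle underlying a sub-PHB. -/
noncomputable def toPar (F : E.Sub) (hp : ∀ i, IsClosed ({p i} : Set C.X)) : ParBundle C p r where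
  toVectorBundle := F.toVectorBundle
  flag i j := (E.flag i j).comap (atPt F.incl (p i))
  flag_zero i := by
    rw [E.flag_zero, Curve.comap_m_smul (hp i), F.stalk_eq]
  flag_mono i _ _ hjk := Submodule.comap_mono (E.flag_mono i hjk)
  flag_top i j hj := by
    rw [E.flag_top i j hj, F.stalk_eq]

lemma isExact (F : E.Sub) (hp : ∀ i, IsClosed ({p i} : Set C.X)) {Q : Type} [AddCommGroup Q]
    [Module C.K Q] {proj : E.V →ₗ[C.K] Q} (S : ShortExactSeq F.incl proj) :
    ParBundle.IsExact (F.toPar hp) E.toPar (E.toPar.quot proj S.surj) F.incl proj where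
  inj := S.inj
  surj := S.surj
  exact := S.exact
  stalk_inc := F.stalk_eq
  stalk_proj _ := rfl
  flag_inc _ _ := rfl
  flag_proj _ _ := rfl

lemma toPar_jump (F : E.Sub) (hp : ∀ i, IsClosed ({p i} : Set C.X)) (i : Fin n) (j : Fin r) :
    (F.toPar hp).jump i j = F.mult i j := by
  have S := F.isExact hp (shortExactSeq_mkQ F.incl F.incl_injective)
  have h1 := S.jump_le hp i j
  have h3 := (F.toPar hp).jump_nonneg hp i j
  have h4 := (F.toPar hp).jump_eq_zero_iff hp i j
  rw [E.toPar_jump hp] at h1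
  rw [mult]
  split_ifs with h
  · exact h4.2 h
  · have : (F.toPar hp).jump i j ≠ 0 := fun h0 => h (h4.1 h0)
    push_cast
    omega

lemma toPar_pdeg (F : E.Sub) (hp : ∀ i, IsClosed ({p i} : Set C.X)) (w : Weights n r) :
    (F.toPar hp).pdeg w = F.pdeg w := by
  simp only [ParBundle.pdeg, pdeg, F.toPar_jump hp, Int.cast_natCast]
  rfl

lemma mult_eq_zero_or_one (F : E.Sub) (i : Fin n) (j : Fin r) :
    F.mult i j = 0 ∨ F.mult i j = 1 := by
  rw [mult]
  split_ifs <;> simp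

/-- The set of indices where the dimension of the intersection with the flag jumps. -/
noncomputable def jumps (F : E.Sub) (i : Fin n) : Finset (Fin r) :=
  Finset.univ.filter fun j => F.mult i j = 1

lemma mult_eq (F : E.Sub) (i : Fin n) (j : Fin r) :
    F.mult i j = if j ∈ F.jumps i then 1 else 0 := by
  rcases F.mult_eq_zero_or_one i j with h | h <;> simp [jumps, h]

lemma card_jumps (F : E.Sub) (hp : ∀ i, IsClosed ({p i} : Set C.X)) (i : Fin n) :
    (F.jumps i).card = F.rank := by
  have h := (F.toPar hp).sum_jump hp i
  simp only [F.toPar_jump hp, mult_eq] at h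
  rw [← Nat.cast_sum, Finset.sum_boole, Finset.filter_mem_eq_inter, Finset.univ_inter] at h
  exact_mod_cast h

/-- The discrete data of a sub-PHB. -/
noncomputable def data (F : E.Sub) (hp : ∀ i, IsClosed ({p i} : Set C.X)) (h0 : 0 < F.rank)
    (hr : F.rank < r) : DiscreteData n r where
  rk := F.rank
  deg := F.degree
  N := F.jumps
  rk_pos := h0
  rk_lt := hr
  card_N := F.card_jumps hp

lemma pdeg_eq (F : E.Sub) (w : Weights n r) :
    F.pdeg w = F.degree + ∑ i, ∑ j ∈ F.jumps i, w i j := by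
  simp only [pdeg, mult_eq, Nat.cast_ite, Nat.cast_one, Nat.cast_zero, ite_mul, one_mul, zero_mul,
    Finset.sum_ite_mem, Finset.univ_inter]

end Sub

end QPHB

end ParHiggs

/-! ### Induced Higgs fields -/

namespace ParHiggs

section

variable {K Ω V W Q : Type*} [Field K] [AddCommGroup Ω] [Module K Ω] [AddCommGroup V] [Module K V]
  [AddCommGroup W] [Module K W] [AddCommGroup Q] [Module K Q]

lemma lTensor_lTensor_apply (f : V →ₗ[K] W) (g : W →ₗ[K] Q) (t : Ω ⊗[K] V) :
    g.lTensor Ω (f.lTensor Ω t) = (g ∘ₗ f).lTensor Ω t := by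
  rw [LinearMap.lTensor_comp, LinearMap.comp_apply]

lemma exists_linearMap_sub (inc : W →ₗ[K] V) (hinj : Function.Injective inc)
    (φ : V →ₗ[K] Ω ⊗[K] V) (hφ : ∀ v, φ (inc v) ∈ LinearMap.range (inc.lTensor Ω)) :
    ∃ φ' : W →ₗ[K] Ω ⊗[K] W, ∀ v, φ (inc v) = inc.lTensor Ω (φ' v) := by
  obtain ⟨ρ, hρ⟩ := inc.exists_leftInverse_of_injective (LinearMap.ker_eq_bot.2 hinj)
  refine ⟨ρ.lTensor Ω ∘ₗ φ ∘ₗ inc, fun v => ?_⟩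
  obtain ⟨y, hy⟩ := hφ v
  simp only [LinearMap.comp_apply]
  have h := lTensor_lTensor_apply (Ω := Ω) inc ρ y
  rw [hρ, LinearMap.lTensor_id, LinearMap.id_apply] at h
  rw [← hy, h]

lemma ShortExactSeq.exists_linearMap_quot {inc : W →ₗ[K] V} {proj : V →ₗ[K] Q}
    (S : ShortExactSeq inc proj) (φ : V →ₗ[K] Ω ⊗[K] V)
    (hφ : ∀ v, φ (inc v) ∈ LinearMap.range (inc.lTensor Ω)) :
    ∃ φ'' : Q →ₗ[K] Ω ⊗[K] Q, ∀ v, φ'' (proj v) = proj.lTensor Ω (φ v) := by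
  obtain ⟨s, hs⟩ := proj.exists_rightInverse_of_surjective (LinearMap.range_eq_top.2 S.surj)
  refine ⟨proj.lTensor Ω ∘ₗ φ ∘ₗ s, fun v => ?_⟩
  have hv : proj (s (proj v) - v) = 0 := by
    rw [map_sub, ← LinearMap.comp_apply proj s, hs, LinearMap.id_apply, sub_self]
  obtain ⟨u, hu⟩ := (S.exact _).1 hv
  obtain ⟨y, hy⟩ := hφ u
  have h0 : proj.lTensor Ω (φ (s (proj v) - v)) = 0 := by
    rw [← hu, ← hy, lTensor_lTensor_apply, S.exact.linearMap_comp_eq_zero, LinearMap.lTensor_zero,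
      LinearMap.zero_apply]
  rw [map_sub, map_sub, sub_eq_zero] at h0
  exact h0

/-- A subspace is invariant if and only if the field vanishes on it modulo the subspace. -/
lemma ShortExactSeq.mem_range_lTensor_iff {inc : W →ₗ[K] V} {proj : V →ₗ[K] Q}
    (S : ShortExactSeq inc proj) (t : Ω ⊗[K] V) :
    t ∈ LinearMap.range (inc.lTensor Ω) ↔ proj.lTensor Ω t = 0 :=
  (lTensor_exact Ω S.exact S.surj t).symm

end

variable {C : Curve} {n : ℕ} {p : Fin n → C.X} {V W Q : Type} [AddCommGroup V] [Module C.K V]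
  [AddCommGroup W] [Module C.K W] [AddCommGroup Q] [Module C.K Q]

lemma lTensor_mem_twist {x : C.X} {L : Submodule (C.O x) V} {L' : Submodule (C.O x) W}
    (f : V →ₗ[C.K] W) (hf : ∀ v ∈ L, f v ∈ L') {t : C.Om ⊗[C.K] V} (ht : t ∈ twist p x L) :
    f.lTensor C.Om t ∈ twist p x L' := by
  have : twist p x L ≤ (twist p x L').comap ((f.lTensor C.Om).restrictScalars (C.O x)) := by
    rw [twist, Submodule.span_le]
    rintro _ ⟨w, hw, v, hv, rfl⟩
    exact Submodule.subset_span ⟨w, hw, f v, hf v hv, by simp⟩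
  exact this ht

/-- As a lattice is the direct sum of its intersection with a subspace and a complement, twisting
commutes with intersecting with a subspace. -/
lemma ShortExactSeq.mem_twist_comap [Module.Finite C.K V] {inc : W →ₗ[C.K] V}
    {proj : V →ₗ[C.K] Q} (S : ShortExactSeq inc proj) {x : C.X} {L : Submodule (C.O x) V}
    (hL : IsLattice L) {y : C.Om ⊗[C.K] W} (hy : inc.lTensor C.Om y ∈ twist p x L) :
    y ∈ twist p x (L.comap (atPt inc x)) := by
  obtain ⟨ρ, hρ, hρL⟩ := S.exists_retraction (C.localOrder x) hL
  have h1 : ρ ∘ₗ inc = LinearMap.id := LinearMap.ext hρ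
  have h2 := lTensor_mem_twist (L' := L.comap (atPt inc x)) ρ (fun v hv => hρL v hv) hy
  rwa [lTensor_lTensor_apply, h1, LinearMap.lTensor_id, LinearMap.id_apply] at h2

/-! ### Jumps of flags -/

namespace DiscreteData

variable {r : ℕ} (δ : DiscreteData n r)

lemma count_zero (i : Fin n) : δ.count i 0 = 0 := by simp [count]

lemma count_of_le (i : Fin n) {j : ℕ} (hj : r ≤ j) : δ.count i j = δ.rk := by
  rw [count, Finset.filter_true_of_mem fun k _ => lt_of_lt_of_le k.2 hj, δ.card_N]

lemma count_mono (i : Fin n) : Monotone (δ.count i) := fun _ _ hjk =>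
  Finset.card_le_card (Finset.monotone_filter_right _ fun _ _ h => lt_of_lt_of_le h hjk)

lemma count_succ (i : Fin n) (j : Fin r) :
    δ.count i (j + 1) = δ.count i j + if j ∈ δ.N i then 1 else 0 := by
  have h1 : (δ.N i).filter (fun k : Fin r => k.val < j + 1) =
      (δ.N i).filter (fun k : Fin r => k.val < j) ∪ (δ.N i).filter (fun k : Fin r => k = j) := by
    ext k
    simp only [Finset.mem_filter, Finset.mem_union, Fin.ext_iff]
    constructor
    · rintro ⟨h, h'⟩
      rcases Nat.lt_succ_iff_lt_or_eq.1 h' with h'' | h''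
      exacts [Or.inl ⟨h, h''⟩, Or.inr ⟨h, h''⟩]
    · rintro (⟨h, h'⟩ | ⟨h, h'⟩)
      exacts [⟨h, by omega⟩, ⟨h, by omega⟩]
  rw [count, h1, Finset.card_union_of_disjoint, Finset.filter_eq', count]
  · split_ifs <;> simp
  · rw [Finset.disjoint_left]
    intro k hk hk'
    simp only [Finset.mem_filter] at hk hk'
    exact hk.2.ne (congrArg Fin.val hk'.2)

/-- The index of the step of the flag where the dimension grows from `k` to `k + 1`. -/
noncomputable def step (i : Fin n) (k : ℕ) : ℕ :=
  if h : k < δ.rk then ((δ.N i).orderEmbOfFin (δ.card_N i) ⟨k, h⟩).val else r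

lemma count_orderEmbOfFin (i : Fin n) (k : Fin δ.rk) :
    δ.count i ((δ.N i).orderEmbOfFin (δ.card_N i) k) = k := by
  have h : (δ.N i).filter
      (fun l : Fin r => l.val < ((δ.N i).orderEmbOfFin (δ.card_N i) k : Fin r).val) =
      (Finset.Iio k).map ((δ.N i).orderEmbOfFin (δ.card_N i)).toEmbedding := by
    ext l
    simp only [Finset.mem_filter, Finset.mem_map, Finset.mem_Iio]
    constructor
    · rintro ⟨hl, hlt⟩
      obtain ⟨m, rfl⟩ : ∃ m, (δ.N i).orderEmbOfFin (δ.card_N i) m = l := by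
        rw [← Set.mem_range, Finset.range_orderEmbOfFin]
        exact hl
      exact ⟨m, ((δ.N i).orderEmbOfFin (δ.card_N i)).lt_iff_lt.1 hlt, rfl⟩
    · rintro ⟨m, hm, rfl⟩
      exact ⟨Finset.orderEmbOfFin_mem _ _ _,
        ((δ.N i).orderEmbOfFin (δ.card_N i)).lt_iff_lt.2 hm⟩
  rw [count, h, Finset.card_map, Fin.card_Iio]

lemma count_step (i : Fin n) {k : ℕ} (hk : k ≤ δ.rk) : δ.count i (δ.step i k) = k := by
  rw [step]
  split_ifs with h
  · exact δ.count_orderEmbOfFin i ⟨k, h⟩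
  · rw [δ.count_of_le i le_rfl]
    omega

lemma count_step_add_one (i : Fin n) {k : ℕ} (hk : k < δ.rk) :
    δ.step i k < r ∧ δ.count i (δ.step i k + 1) = k + 1 := by
  rw [step, dif_pos hk]
  refine ⟨Fin.is_lt _, ?_⟩
  rw [count_succ, count_orderEmbOfFin, if_pos (Finset.orderEmbOfFin_mem _ _ _)]

/-- A sum over the steps of the flags of a parabolic bundle of rank `r` to which only the jumps
contribute, as a sum over the flags with repetitions removed. -/
lemma sum_restrict {M : Type*} [AddCommMonoid M] (i : Fin n) (f : Fin r → M)
    (hf : ∀ j ∉ δ.N i, f j = 0) :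
    ∑ j, f j = ∑ k : Fin δ.rk, f ((δ.N i).orderEmbOfFin (δ.card_N i) k) := by
  have h := Finset.sum_map Finset.univ ((δ.N i).orderEmbOfFin (δ.card_N i)).toEmbedding f
  rw [Finset.map_orderEmbOfFin_univ] at h
  rw [← Finset.sum_subset (Finset.subset_univ (δ.N i)) fun j _ hj => hf j hj]
  exact h

end DiscreteData

namespace ParBundle

variable {r : ℕ} (P : ParBundle C p r) (δ : DiscreteData n r)

/-- The flags of `P` jump where `δ` prescribes it. -/
def HasJumps : Prop := ∀ i (j : Fin r), P.jump i j = if j ∈ δ.N i then 1 else 0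

variable {P δ}

lemma HasJumps.latDegAt_flag (h : P.HasJumps δ) (i : Fin n) (j : ℕ) :
    latDegAt (P.flag i j) P.rationalFrame =
      latDegAt (P.flag i 0) P.rationalFrame + δ.count i j := by
  have key : ∀ j ≤ r, latDegAt (P.flag i j) P.rationalFrame =
      latDegAt (P.flag i 0) P.rationalFrame + δ.count i j := fun j => by
    induction j with
    | zero => simp [δ.count_zero]
    | succ j ih =>
      intro hj
      have h1 := h i ⟨j, hj⟩
      have h2 := δ.count_succ i ⟨j, hj⟩
      have h3 := ih (Nat.le_of_succ_le hj)
      simp only [jump] at h1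
      simp only at h2
      rw [h2]
      split_ifs at * <;> push_cast <;> linarith
  rcases le_total j r with hj | hj
  · exact key j hj
  · have := key r le_rfl
    rw [δ.count_of_le i hj, ← δ.count_of_le i le_rfl, ← this, P.flag_top i j hj,
      P.flag_top i r le_rfl]

lemma HasJumps.flag_eq (h : P.HasJumps δ) (hp : ∀ i, IsClosed ({p i} : Set C.X))
    (i : Fin n) {j k : ℕ} (hjk : δ.count i j = δ.count i k) : P.flag i j = P.flag i k := by
  wlog hle : j ≤ k
  · exact (this h hp i hjk.symm (le_of_not_ge hle)).symm
  refine eq_of_latDeg_eq (C.localOrder _) (P.isLattice_flag hp i _) (P.isLattice_flag hp i _)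
    (P.flag_mono i hle) P.rationalFrame ?_
  have h1 := h.latDegAt_flag i j
  have h2 := h.latDegAt_flag i k
  simp only [latDegAt] at h1 h2
  rw [h1, h2, hjk]

lemma HasJumps.flag_lt (h : P.HasJumps δ) (i : Fin n) {j k : ℕ}
    (hjk : δ.count i j < δ.count i k) : P.flag i j < P.flag i k := by
  have hle : j ≤ k := le_of_lt (lt_of_not_ge fun h => absurd (δ.count_mono i h) (not_le.2 hjk))
  refine lt_of_le_of_ne (P.flag_mono i hle) fun heq => ?_
  have h1 := h.latDegAt_flag i j
  have h2 := h.latDegAt_flag i k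
  rw [heq, h2] at h1
  omega

/-- The quasi-parabolic Higgs bundle obtained from a parabolic bundle with a Higgs field by removing
the repetitions from the flags. -/
noncomputable def toQPHB (h : P.HasJumps δ) (hp : ∀ i, IsClosed ({p i} : Set C.X))
    (hr : P.rank = δ.rk)
    (φ : P.V →ₗ[C.K] C.Om ⊗[C.K] P.V)
    (hφ : ∀ x, ∀ v ∈ P.stalk x, φ v ∈ twist p x (P.stalk x))
    (hφ' : ∀ i j, j < r → ∀ v ∈ P.flag i (j + 1), φ v ∈ twist p (p i) (P.flag i j)) :
    QPHB C p δ.rk where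
  toVectorBundle := P.toVectorBundle
  rank_eq := hr
  flag i k := P.flag i (δ.step i k)
  flag_zero i := by
    rw [← P.flag_zero]
    exact h.flag_eq hp i (by rw [δ.count_step i (Nat.zero_le _), δ.count_zero])
  flag_lt i k hk := h.flag_lt i (by
    rw [δ.count_step i hk.le, δ.count_step i hk]
    exact k.lt_succ_self)
  flag_top i k hk := by
    rw [DiscreteData.step, dif_neg (not_lt.2 hk), P.flag_top i r le_rfl]
  higgs := φ
  higgs_regular := hφ
  higgs_flag i k hk v hv := by
    obtain ⟨h1, h2⟩ := δ.count_step_add_one i hk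
    refine hφ' i _ h1 v ?_
    rwa [h.flag_eq hp i (h2.trans (δ.count_step i hk).symm)]

end ParBundle

end ParHiggs

namespace ParHiggs

variable {C : Curve} {n : ℕ} {p : Fin n → C.X} {r : ℕ}

namespace ParBundle

/-- A parabolic bundle of rank `δ.rk`, regarded as one with flags of length `r` which jump at most
where `δ` prescribes it. -/
noncomputable def expand {δ : DiscreteData n r} (P : ParBundle C p δ.rk) : ParBundle C p r where
  toVectorBundle := P.toVectorBundle
  flag i j := P.flag i (δ.count i j)
  flag_zero i := by rw [δ.count_zero, P.flag_zero]
  flag_mono i _ _ hjk := P.flag_mono i (δ.count_mono i hjk)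
  flag_top i j hj := P.flag_top i _ (δ.count_of_le i hj).ge

variable {δ : DiscreteData n r} (P : ParBundle C p δ.rk)

lemma expand_jump_of_notMem (i : Fin n) {j : Fin r} (hj : j ∉ δ.N i) : P.expand.jump i j = 0 := by
  change latDegAt (P.flag i (δ.count i (j + 1))) _ - latDegAt (P.flag i (δ.count i j)) _ = 0
  rw [δ.count_succ, if_neg hj, add_zero, sub_self]

lemma expand_jump (i : Fin n) (k : Fin δ.rk) :
    P.expand.jump i ((δ.N i).orderEmbOfFin (δ.card_N i) k : Fin r) = P.jump i k := by
  change latDegAt (P.flag i (δ.count i (_ + 1))) _ - latDegAt (P.flag i (δ.count i _)) _ = _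
  rw [δ.count_succ, if_pos (Finset.orderEmbOfFin_mem _ _ _), δ.count_orderEmbOfFin]
  rfl

lemma expand_pdeg (w : Weights n r) : P.expand.pdeg w = P.pdeg (δ.restrict w) := by
  have h : P.expand.degree = P.degree := rfl
  rw [pdeg, pdeg, h]
  congr 1
  refine Finset.sum_congr rfl fun i _ => ?_
  rw [δ.sum_restrict i _ fun j hj => by rw [P.expand_jump_of_notMem i hj]; simp]
  refine Finset.sum_congr rfl fun k _ => ?_
  rw [expand_jump]
  rfl

end ParBundle

namespace QPHB

/-- The sub-PHB with a given generic stalk. -/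
noncomputable def subOf (E : QPHB C p r) {W : Type} [AddCommGroup W] [Module C.K W]
    (inc : W →ₗ[C.K] E.V) (h : Function.Injective inc)
    (hinv : ∀ v, E.higgs (inc v) ∈ LinearMap.range (inc.lTensor C.Om)) : E.Sub where
  toVectorBundle := VectorBundle.ofStalks (fun x => (E.stalk x).comap (atPt inc x))
    ((shortExactSeq_mkQ inc h).isLocallyFree_comap E.isLocallyFree)
  incl := inc
  incl_injective := h
  stalk_eq _ := rfl
  invariant := hinv

end QPHB

/-! ### Extensions and subbundles -/

section

variable {d : ℤ} {δ : DiscreteData n r} {E : QPHB C p r}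

lemma compl_count (i : Fin n) (j : Fin r) :
    (if j ∈ (δ.compl d).N i then 1 else 0 : ℤ) = 1 - if j ∈ δ.N i then 1 else 0 := by
  have : j ∈ (δ.compl d).N i ↔ j ∉ δ.N i := Finset.mem_compl
  simp only [this]
  split_ifs <;> simp_all

/-- A sub-PHB with discrete data `δ` gives an extension. -/
theorem exists_extension (hp : ∀ i, IsClosed ({p i} : Set C.X)) (hE : E.degree = d) (F : E.Sub)
    (hrk : F.rank = δ.rk) (hdeg : F.degree = δ.deg) (hN : F.jumps = δ.N) :
    ∃ (Ep : QPHB C p δ.rk) (Em : QPHB C p (δ.compl d).rk) (X : Extension d δ E Ep Em),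
      LinearMap.range X.inc = LinearMap.range F.incl ∧ Ep.degree = δ.deg ∧
      Em.degree = (δ.compl d).deg := by
  have S := shortExactSeq_mkQ F.incl F.incl_injective
  have hS := F.isExact hp S
  let P'' := E.toPar.quot (LinearMap.range F.incl).mkQ S.surj
  have hJ' : (F.toPar hp).HasJumps δ := fun i j => by
    rw [F.toPar_jump, F.mult_eq, hN]
    split_ifs <;> simp
  have hJ'' : P''.HasJumps (δ.compl d) := fun i j => by
    have h1 := hS.jump_add hp i j
    rw [E.toPar_jump hp, hJ' i j] at h1
    rw [compl_count]
    linarith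
  have hrk'' : P''.rank = (δ.compl d).rk := by
    have h1 : E.toPar.rank = (F.toPar hp).rank + P''.rank := hS.rank_add
    have h2 : E.toPar.rank = r := E.rank_eq
    have h3 : (F.toPar hp).rank = δ.rk := hrk
    change P''.rank = r - δ.rk
    omega
  obtain ⟨φ', hφ'⟩ := exists_linearMap_sub F.incl F.incl_injective E.higgs F.invariant
  obtain ⟨φ'', hφ''⟩ := S.exists_linearMap_quot E.higgs F.invariant
  have hreg' : ∀ x, ∀ v ∈ F.stalk x, φ' v ∈ twist p x (F.stalk x) := fun x v hv => by
    rw [← F.stalk_eq] at hv ⊢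
    refine S.mem_twist_comap (E.isLattice x) ?_
    rw [← hφ']
    exact E.higgs_regular x _ hv
  have hflag' : ∀ i j, j < r → ∀ v ∈ (E.flag i (j + 1)).comap (atPt F.incl (p i)),
      φ' v ∈ twist p (p i) ((E.flag i j).comap (atPt F.incl (p i))) := fun i j hj v hv => by
    refine S.mem_twist_comap (E.toPar.isLattice_flag hp i j) ?_
    change _ ∈ twist p (p i) (E.flag i j)
    rw [← hφ']
    exact E.higgs_flag i j hj _ hv
  have hmap : ∀ (x : C.X) (L L' : Submodule (C.O x) E.V),
      (∀ v ∈ L', E.higgs v ∈ twist p x L) →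
      ∀ v ∈ L'.map (atPt (LinearMap.range F.incl).mkQ x),
        φ'' v ∈ twist p x (L.map (atPt (LinearMap.range F.incl).mkQ x)) := by
    rintro x L L' hL _ ⟨u, hu, rfl⟩
    change φ'' ((LinearMap.range F.incl).mkQ u) ∈ _
    rw [hφ'']
    exact lTensor_mem_twist (L' := L.map (atPt (LinearMap.range F.incl).mkQ x)) _
      (fun v hv => ⟨v, hv, rfl⟩) (hL u hu)
  let Ep : QPHB C p δ.rk := ParBundle.toQPHB hJ' hp hrk φ' hreg' hflag'
  let Em : QPHB C p (δ.compl d).rk := ParBundle.toQPHB hJ'' hp hrk'' φ''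
    (fun x => hmap x _ _ (E.higgs_regular x)) (fun i j hj => hmap (p i) _ _ (E.higgs_flag i j hj))
  have hcount : ∀ (ε : DiscreteData n r) i j, ε.count i j = ε.count i (ε.step i (ε.count i j)) :=
    fun ε i j => (ε.count_step i ((Finset.card_filter_le _ _).trans (ε.card_N i).le)).symm
  let X : Extension d δ E Ep Em :=
    { inc := F.incl
      proj := (LinearMap.range F.incl).mkQ
      inc_injective := S.inj
      proj_surjective := S.surj
      exact := S.exact
      stalk_inc := F.stalk_eq
      stalk_proj := fun _ => rfl
      flag_inc := fun i j => hJ'.flag_eq hp i (hcount δ i j)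
      flag_proj := fun i j => hJ''.flag_eq hp i (hcount _ i j)
      higgs_inc := hφ'
      higgs_proj := hφ'' }
  refine ⟨Ep, Em, X, rfl, hdeg, ?_⟩
  have h1 : E.toPar.degree = (F.toPar hp).degree + P''.degree := hS.degree_add
  have h2 : E.toPar.degree = d := hE
  have h3 : (F.toPar hp).degree = δ.deg := hdeg
  change P''.degree = d - δ.deg
  omega

end

end ParHiggs

namespace ParHiggs

variable {C : Curve} {n : ℕ} {p : Fin n → C.X} {r : ℕ}

lemma DiscreteData.count_succ_of_notMem (δ : DiscreteData n r) (i : Fin n) {j : Fin r}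
    (hj : j ∉ δ.N i) : δ.count i (j + 1) = δ.count i j := by
  rw [δ.count_succ, if_neg hj, add_zero]

lemma DiscreteData.exists_of_mem (δ : DiscreteData n r) (i : Fin n) {j : Fin r}
    (hj : j ∈ δ.N i) : ∃ k, (δ.N i).orderEmbOfFin (δ.card_N i) k = j := by
  rw [← Set.mem_range, Finset.range_orderEmbOfFin]
  exact hj

lemma DiscreteData.count_orderEmbOfFin_succ (δ : DiscreteData n r) (i : Fin n) (k : Fin δ.rk) :
    δ.count i (((δ.N i).orderEmbOfFin (δ.card_N i) k : Fin r) + 1) = k + 1 := by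
  rw [δ.count_succ, if_pos (Finset.orderEmbOfFin_mem _ _ _), δ.count_orderEmbOfFin]

lemma QPHB.Sub.jumps_eq {E : QPHB C p r} (F : E.Sub) {δ : DiscreteData n r}
    (L : ∀ i, ℕ → Submodule (C.O (p i)) F.V) (hL : ∀ i k, k < δ.rk → L i k < L i (k + 1))
    (h : ∀ i j, (E.flag i j).comap (atPt F.incl (p i)) = L i (δ.count i j)) : F.jumps = δ.N := by
  funext i
  ext j
  rw [jumps, Finset.mem_filter, mult, h, h]
  constructor
  · rintro ⟨-, h1⟩
    by_contra hj
    rw [δ.count_succ_of_notMem i hj, if_pos rfl] at h1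
    exact zero_ne_one h1
  · intro hj
    obtain ⟨k, rfl⟩ := δ.exists_of_mem i hj
    rw [δ.count_orderEmbOfFin, δ.count_orderEmbOfFin_succ, if_neg (hL i k k.2).ne]
    exact ⟨Finset.mem_univ _, rfl⟩

namespace Extension

variable {d : ℤ} {δ : DiscreteData n r} {E : QPHB C p r}
  {Ep : QPHB C p δ.rk} {Em : QPHB C p (δ.compl d).rk} (X : Extension d δ E Ep Em)

lemma shortExactSeq (X : Extension d δ E Ep Em) : ShortExactSeq X.inc X.proj :=
  ⟨X.inc_injective, X.proj_surjective, X.exact⟩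

lemma isExact (X : Extension d δ E Ep Em) :
    ParBundle.IsExact (Ep.toPar.expand (δ := δ)) E.toPar (Em.toPar.expand (δ := δ.compl d))
      X.inc X.proj where
  inj := X.inc_injective
  surj := X.proj_surjective
  exact := X.exact
  stalk_inc := X.stalk_inc
  stalk_proj := X.stalk_proj
  flag_inc := X.flag_inc
  flag_proj := X.flag_proj

lemma pdeg_add (X : Extension d δ E Ep Em) (hp : ∀ i, IsClosed ({p i} : Set C.X))
    (w : Weights n r) :
    E.pdeg w = Ep.pdeg (δ.restrict w) + Em.pdeg ((δ.compl d).restrict w) := by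
  rw [← E.toPar_pdeg hp, X.isExact.pdeg_add hp, ParBundle.expand_pdeg, ParBundle.expand_pdeg,
    Ep.toPar_pdeg hp, Em.toPar_pdeg hp]

/-- The sub-PHB `E⁺` of `E`. -/
noncomputable def subInc (X : Extension d δ E Ep Em) : E.Sub where
  toVectorBundle := Ep.toVectorBundle
  incl := X.inc
  incl_injective := X.inc_injective
  stalk_eq := X.stalk_inc
  invariant v := ⟨Ep.higgs v, (X.higgs_inc v).symm⟩

lemma subInc_jumps (X : Extension d δ E Ep Em) : X.subInc.jumps = δ.N :=
  X.subInc.jumps_eq (fun i k => Ep.flag i k) Ep.flag_lt X.flag_inc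

/-- A sub-PHB of `E⁺` as a sub-PHB of `E`. -/
noncomputable def incSub (X : Extension d δ E Ep Em) (A : Ep.Sub) : E.Sub where
  toVectorBundle := A.toVectorBundle
  incl := X.inc ∘ₗ A.incl
  incl_injective := X.inc_injective.comp A.incl_injective
  stalk_eq x := by
    rw [← A.stalk_eq, ← X.stalk_inc]
    rfl
  invariant v := by
    obtain ⟨y, hy⟩ := A.invariant v
    refine ⟨y, ?_⟩
    rw [← lTensor_lTensor_apply, hy, LinearMap.comp_apply, X.higgs_inc]

lemma incSub_mult (X : Extension d δ E Ep Em) (A : Ep.Sub) (i : Fin n) (j : Fin r) :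
    (X.incSub A).mult i j =
      if (Ep.flag i (δ.count i j)).comap (atPt A.incl (p i)) =
        (Ep.flag i (δ.count i (j + 1))).comap (atPt A.incl (p i)) then 0 else 1 := by
  rw [← X.flag_inc, ← X.flag_inc]
  rfl

lemma incSub_mult_of_notMem (X : Extension d δ E Ep Em) (A : Ep.Sub) (i : Fin n) {j : Fin r}
    (hj : j ∉ δ.N i) : (X.incSub A).mult i j = 0 := by
  rw [incSub_mult, δ.count_succ_of_notMem i hj, if_pos rfl]

lemma incSub_jumps_subset (X : Extension d δ E Ep Em) (A : Ep.Sub) (i : Fin n) :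
    (X.incSub A).jumps i ⊆ δ.N i := fun j hj => by
  by_contra h
  have h1 := (Finset.mem_filter.1 hj).2
  rw [X.incSub_mult_of_notMem A i h] at h1
  exact zero_ne_one h1

lemma incSub_pdeg (X : Extension d δ E Ep Em) (A : Ep.Sub) (w : Weights n r) :
    (X.incSub A).pdeg w = A.pdeg (δ.restrict w) := by
  have h : (X.incSub A).degree = A.degree := rfl
  rw [QPHB.Sub.pdeg, QPHB.Sub.pdeg, h]
  congr 1
  refine Finset.sum_congr rfl fun i _ => ?_
  rw [δ.sum_restrict i _ fun j hj => by rw [X.incSub_mult_of_notMem A i hj]; simp]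
  refine Finset.sum_congr rfl fun k _ => ?_
  have : (X.incSub A).mult i ((δ.N i).orderEmbOfFin (δ.card_N i) k) = A.mult i k := by
    rw [incSub_mult, δ.count_orderEmbOfFin, δ.count_orderEmbOfFin_succ]
    rfl
  rw [this]
  rfl

lemma shortExactSeq_projSub (X : Extension d δ E Ep Em) (B : Em.Sub) :
    ShortExactSeq ((LinearMap.range B.incl).comap X.proj).subtype
      ((LinearMap.range B.incl).mkQ ∘ₗ X.proj) :=
  ⟨Subtype.val_injective, (Submodule.mkQ_surjective _).comp X.proj_surjective,
    LinearMap.exact_iff.2 (by rw [LinearMap.ker_comp, Submodule.ker_mkQ, Submodule.range_subtype])⟩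

/-- The preimage in `E` of a sub-PHB of `E⁻`. -/
noncomputable def projSub (X : Extension d δ E Ep Em) (B : Em.Sub) : E.Sub :=
  E.subOf ((LinearMap.range B.incl).comap X.proj).subtype Subtype.val_injective <| by
    rintro ⟨v, hv⟩
    obtain ⟨b, hb⟩ := hv
    rw [(X.shortExactSeq_projSub B).mem_range_lTensor_iff, ← lTensor_lTensor_apply]
    change _ = X.proj v at hb
    change LinearMap.lTensor _ _ (LinearMap.lTensor _ _ (E.higgs v)) = 0
    rw [← X.higgs_proj, ← hb,
      ← (shortExactSeq_mkQ B.incl B.incl_injective).mem_range_lTensor_iff]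
    exact B.invariant b

lemma exists_isExact_projSub (X : Extension d δ E Ep Em)
    (hp : ∀ i, IsClosed ({p i} : Set C.X)) (B : Em.Sub) :
    ∃ inc proj, ParBundle.IsExact (Ep.toPar.expand (δ := δ)) ((X.projSub B).toPar hp)
      ((B.toPar hp).expand (δ := δ.compl d)) inc proj := by
  let W := (LinearMap.range B.incl).comap X.proj
  have hinc : ∀ v, X.inc v ∈ W := fun v => by
    change X.proj (X.inc v) ∈ LinearMap.range B.incl
    rw [X.exact.apply_apply_eq_zero]
    exact (LinearMap.range B.incl).zero_mem
  let inc : Ep.V →ₗ[C.K] W := X.inc.codRestrict W hinc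
  let e : B.V ≃ₗ[C.K] LinearMap.range B.incl := LinearEquiv.ofInjective B.incl B.incl_injective
  let proj : W →ₗ[C.K] B.V := e.symm.toLinearMap ∘ₗ X.proj.restrict (q := LinearMap.range B.incl)
    fun _ h => h
  have hproj : ∀ v : W, B.incl (proj v) = X.proj v := fun v =>
    congrArg Subtype.val (e.apply_symm_apply _)
  have hmap : ∀ (x : C.X) (L : Submodule (C.O x) E.V),
      (L.comap (atPt W.subtype x)).map (atPt proj x) =
        (L.map (atPt X.proj x)).comap (atPt B.incl x) := fun x L => by
    ext b
    constructor
    · rintro ⟨v, hv, rfl⟩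
      exact ⟨v, hv, (hproj v).symm⟩
    · rintro ⟨v, hv, hvb⟩
      have hvW : v ∈ W := ⟨b, hvb.symm⟩
      exact ⟨⟨v, hvW⟩, hv, B.incl_injective ((hproj ⟨v, hvW⟩).trans hvb)⟩
  refine ⟨inc, proj, ⟨⟨?_, ?_, ?_⟩, ?_, ?_, ?_, ?_⟩⟩
  · exact fun a b hab => X.inc_injective (congrArg Subtype.val hab)
  · intro b
    obtain ⟨v, hv⟩ := X.proj_surjective (B.incl b)
    have hvW : v ∈ W := ⟨b, hv.symm⟩
    exact ⟨⟨v, hvW⟩, B.incl_injective ((hproj ⟨v, hvW⟩).trans hv)⟩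
  · rintro ⟨v, hv⟩
    have h1 : proj ⟨v, hv⟩ = 0 ↔ X.proj v = 0 := by
      rw [← B.incl_injective.eq_iff, hproj, map_zero]
    exact h1.trans ((X.exact v).trans
      ⟨fun ⟨u, hu⟩ => ⟨u, Subtype.ext hu⟩, fun ⟨u, hu⟩ => ⟨u, congrArg Subtype.val hu⟩⟩)
  · intro x
    exact X.stalk_inc x
  · intro x
    refine (hmap x (E.stalk x)).trans ?_
    rw [X.stalk_proj]
    exact B.stalk_eq x
  · intro i j
    exact X.flag_inc i j
  · intro i j
    refine (hmap (p i) (E.flag i j)).trans ?_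
    rw [X.flag_proj]
    rfl

lemma projSub_rank (X : Extension d δ E Ep Em) (hp : ∀ i, IsClosed ({p i} : Set C.X))
    (B : Em.Sub) : (X.projSub B).rank = δ.rk + B.rank := by
  obtain ⟨inc, proj, S⟩ := X.exists_isExact_projSub hp B
  have h1 := S.rank_add
  have h2 : (Ep.toPar.expand (δ := δ)).rank = δ.rk := Ep.rank_eq
  rw [h2] at h1
  exact h1

lemma projSub_pdeg (X : Extension d δ E Ep Em) (hp : ∀ i, IsClosed ({p i} : Set C.X))
    (B : Em.Sub) (w : Weights n r) :
    (X.projSub B).pdeg w = Ep.pdeg (δ.restrict w) + B.pdeg ((δ.compl d).restrict w) := by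
  obtain ⟨inc, proj, S⟩ := X.exists_isExact_projSub hp B
  rw [← (X.projSub B).toPar_pdeg hp, S.pdeg_add hp, ParBundle.expand_pdeg, ParBundle.expand_pdeg,
    Ep.toPar_pdeg hp, B.toPar_pdeg hp]

lemma subset_projSub_jumps (X : Extension d δ E Ep Em) (hp : ∀ i, IsClosed ({p i} : Set C.X))
    (B : Em.Sub) (i : Fin n) : δ.N i ⊆ (X.projSub B).jumps i := fun j hj => by
  obtain ⟨inc, proj, S⟩ := X.exists_isExact_projSub hp B
  obtain ⟨k, rfl⟩ := δ.exists_of_mem i hj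
  have h1 := S.jump_le hp i ((δ.N i).orderEmbOfFin (δ.card_N i) k : Fin r)
  rw [ParBundle.expand_jump, Ep.toPar_jump hp, QPHB.Sub.toPar_jump] at h1
  rw [QPHB.Sub.jumps, Finset.mem_filter]
  refine ⟨Finset.mem_univ _, ?_⟩
  rcases (X.projSub B).mult_eq_zero_or_one i ((δ.N i).orderEmbOfFin (δ.card_N i) k) with h | h
  · rw [h] at h1
    simp at h1
  · exact h

end Extension

end ParHiggs

namespace ParHiggs

variable {C : Curve} {n : ℕ} {p : Fin n → C.X} {r : ℕ}

lemma VectorBundle.degree_eq_zero (E : VectorBundle C) (h : E.rank = 0) : E.degree = 0 := by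
  have : IsEmpty (Fin E.rank) := by rw [h]; infer_instance
  have h1 : ∀ x : C.X, Scheme.ord (((E.frame x).toMatrix E.rationalFrame).det : C.K) x = 0 :=
    fun x => by
      rw [Matrix.det_isEmpty]
      exact (C.localOrder x).map_one
  rw [degree, finsum_congr h1, finsum_zero]

lemma ParBundle.pdeg_eq_zero (P : ParBundle C p r) (hp : ∀ i, IsClosed ({p i} : Set C.X))
    (h : P.rank = 0) (w : Weights n r) : P.pdeg w = 0 := by
  have h1 : ∀ i (j : Fin r), P.jump i j = 0 := fun i j => by
    have h2 := P.sum_jump hp i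
    rw [h, Nat.cast_zero] at h2
    exact (Finset.sum_eq_zero_iff_of_nonneg (f := fun j : Fin r => P.jump i j)
      fun j _ => P.jump_nonneg hp i j).1 h2 j (Finset.mem_univ j)
  rw [pdeg, P.degree_eq_zero h]
  simp [h1]

namespace QPHB

variable {E : QPHB C p r}

lemma Sub.pdeg_eq_zero (F : E.Sub) (hp : ∀ i, IsClosed ({p i} : Set C.X)) (h : F.rank = 0)
    (w : Weights n r) : F.pdeg w = 0 := by
  rw [← F.toPar_pdeg hp]
  exact (F.toPar hp).pdeg_eq_zero hp h w

lemma Sub.rank_le (F : E.Sub) : F.rank ≤ r := by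
  have h := LinearMap.finrank_le_finrank_of_injective F.incl_injective
  rw [F.finrank_eq, E.finrank_eq] at h
  exact h.trans E.rank_eq.le

lemma Sub.pdeg_eq_of_rank_eq (F : E.Sub) (hp : ∀ i, IsClosed ({p i} : Set C.X))
    (h : F.rank = r) (w : Weights n r) : F.pdeg w = E.pdeg w := by
  have S₀ := shortExactSeq_mkQ F.incl F.incl_injective
  let P'' := E.toPar.quot (LinearMap.range F.incl).mkQ S₀.surj
  have S : ParBundle.IsExact (F.toPar hp) E.toPar P'' F.incl (LinearMap.range F.incl).mkQ :=
    F.isExact hp S₀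
  have h1 : E.toPar.rank = (F.toPar hp).rank + P''.rank := S.rank_add
  have h2 : E.toPar.rank = r := E.rank_eq
  have h3 : (F.toPar hp).rank = r := h
  have h4 := P''.pdeg_eq_zero hp (by omega) w
  have h5 := S.pdeg_add hp w
  rw [E.toPar_pdeg hp, F.toPar_pdeg hp, h4, add_zero] at h5
  exact h5.symm

/-- Stability for all subbundles, without denominators. -/
lemma IsStable.mul_pdeg_lt {w : Weights n r} (hE : E.IsStable w) (F : E.Sub) (h0 : 0 < F.rank)
    (hr : F.rank < r) : r * F.pdeg w < F.rank * E.pdeg w := by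
  have h1 := hE F h0 hr
  have h2 : (0 : ℝ) < F.rank := by exact_mod_cast h0
  have h3 : (0 : ℝ) < r := by exact_mod_cast h0.trans hr
  rw [div_lt_div_iff₀ h2 h3] at h1
  linarith

lemma IsStable.mul_pdeg_le {w : Weights n r} (hE : E.IsStable w)
    (hp : ∀ i, IsClosed ({p i} : Set C.X)) (F : E.Sub) :
    r * F.pdeg w ≤ F.rank * E.pdeg w := by
  rcases Nat.eq_zero_or_pos F.rank with h0 | h0
  · rw [F.pdeg_eq_zero hp h0, h0]
    simp
  rcases F.rank_le.lt_or_eq with hr | hr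
  · exact (hE.mul_pdeg_lt F h0 hr).le
  · rw [F.pdeg_eq_of_rank_eq hp hr, hr]

end QPHB

namespace Extension

variable {d : ℤ} {δ : DiscreteData n r} {E : QPHB C p r}
  {Ep : QPHB C p δ.rk} {Em : QPHB C p (δ.compl d).rk}

/-- A sub-PHB `G` of an extension determines sub-PHBs of the terms, the intersection with `E⁺` and
the saturation of the image in `E⁻`.  The parabolic degree of `G` is at most the sum of theirs, as
saturating the image does not decrease the parabolic degree. -/
lemma exists_sub_sub (X : Extension d δ E Ep Em) (hp : ∀ i, IsClosed ({p i} : Set C.X))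
    (hpi : Function.Injective p) (G : E.Sub) :
    ∃ (A : Ep.Sub) (B : Em.Sub), G.rank = A.rank + B.rank ∧
      (∀ v, v ∈ LinearMap.range A.incl ↔ X.inc v ∈ LinearMap.range G.incl) ∧
      ∀ w ∈ weightSpace n r,
        G.pdeg w ≤ A.pdeg (δ.restrict w) + B.pdeg ((δ.compl d).restrict w) := by
  let f : G.V →ₗ[C.K] Em.V := X.proj ∘ₗ G.incl
  obtain ⟨φ, hφ⟩ := exists_linearMap_sub G.incl G.incl_injective E.higgs G.invariant
  let B : Em.Sub := Em.subOf (LinearMap.range f).subtype Subtype.val_injective <| by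
    rintro ⟨_, g, rfl⟩
    refine ⟨f.rangeRestrict.lTensor C.Om (φ g), ?_⟩
    rw [lTensor_lTensor_apply, LinearMap.subtype_comp_codRestrict]
    change LinearMap.lTensor C.Om (X.proj ∘ₗ G.incl) (φ g) = Em.higgs (X.proj (G.incl g))
    rw [X.higgs_proj, hφ, lTensor_lTensor_apply]
  let a : LinearMap.ker f →ₗ[C.K] Ep.V :=
    (LinearEquiv.ofInjective X.inc X.inc_injective).symm.toLinearMap ∘ₗ
      G.incl.restrict (p := LinearMap.ker f) (q := LinearMap.range X.inc)
        fun v hv => (X.exact (G.incl v)).1 hv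
  have ha : ∀ v : LinearMap.ker f, X.inc (a v) = G.incl v := fun v =>
    congrArg Subtype.val
      ((LinearEquiv.ofInjective X.inc X.inc_injective).apply_symm_apply _)
  have hainj : Function.Injective a := fun v v' h => by
    apply Subtype.ext
    apply G.incl_injective
    rw [← ha, ← ha, h]
  have Sf : ShortExactSeq (LinearMap.ker f).subtype f.rangeRestrict :=
    ⟨Subtype.val_injective, f.surjective_rangeRestrict, LinearMap.exact_iff.2 (by
      rw [LinearMap.ker_rangeRestrict, Submodule.range_subtype])⟩
  have hX := X.shortExactSeq
  have hflat : Function.Injective (X.inc.lTensor C.Om) :=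
    Module.Flat.lTensor_preserves_injective_linearMap X.inc X.inc_injective
  have hflat' : Function.Injective ((LinearMap.range f).subtype.lTensor C.Om) :=
    Module.Flat.lTensor_preserves_injective_linearMap _ Subtype.val_injective
  let A : Ep.Sub := Ep.subOf a hainj <| fun v => by
    have h1 : X.inc.lTensor C.Om (Ep.higgs (a v)) = G.incl.lTensor C.Om (φ v) := by
      rw [← X.higgs_inc, ha, hφ]
    obtain ⟨z, hz⟩ : φ v ∈ LinearMap.range ((LinearMap.ker f).subtype.lTensor C.Om) := by
      rw [Sf.mem_range_lTensor_iff]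
      apply hflat'
      rw [lTensor_lTensor_apply, LinearMap.subtype_comp_codRestrict, map_zero,
        ← lTensor_lTensor_apply, ← h1, ← hX.mem_range_lTensor_iff]
      exact ⟨_, rfl⟩
    refine ⟨z, hflat ?_⟩
    rw [h1, ← hz, lTensor_lTensor_apply, lTensor_lTensor_apply]
    congr 2
    exact LinearMap.ext ha
  have hcomap : ∀ (x : C.X) (L : Submodule (C.O x) E.V),
      (L.comap (atPt G.incl x)).comap (atPt (LinearMap.ker f).subtype x) =
        (L.comap (atPt X.inc x)).comap (atPt a x) := fun x L => by
    ext v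
    change G.incl v ∈ L ↔ X.inc (a v) ∈ L
    rw [ha]
  have S : ParBundle.IsExact ((A.toPar hp).expand (δ := δ)) (G.toPar hp)
      ((G.toPar hp).quot f.rangeRestrict Sf.surj) (LinearMap.ker f).subtype f.rangeRestrict :=
    { inj := Sf.inj
      surj := Sf.surj
      exact := Sf.exact
      stalk_inc := fun x => by
        have h := hcomap x (E.stalk x)
        rw [G.stalk_eq, X.stalk_inc] at h
        exact h
      stalk_proj := fun _ => rfl
      flag_inc := fun i j => by
        have h := hcomap (p i) (E.flag i j)
        rw [X.flag_inc] at h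
        exact h
      flag_proj := fun _ _ => rfl }
  refine ⟨A, B, S.rank_add, fun v => ?_, fun w hw => ?_⟩
  · constructor
    · rintro ⟨u, rfl⟩
      exact ⟨(show LinearMap.ker f from u).1, (ha u).symm⟩
    · rintro ⟨g, hg⟩
      have hgk : g ∈ LinearMap.ker f := by
        rw [LinearMap.mem_ker]
        change X.proj (G.incl g) = 0
        rw [hg, X.exact.apply_apply_eq_zero]
      exact ⟨⟨g, hgk⟩, X.inc_injective ((ha ⟨g, hgk⟩).trans hg)⟩
  · have hmap : ∀ (x : C.X) (L : Submodule (C.O x) E.V),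
        ((L.comap (atPt G.incl x)).map (atPt f.rangeRestrict x)).map
          (atPt (LinearEquiv.refl C.K (LinearMap.range f)).toLinearMap x) ≤
        (L.map (atPt X.proj x)).comap (atPt (LinearMap.range f).subtype x) := fun x L => by
      rintro _ ⟨_, ⟨g, hg, rfl⟩, rfl⟩
      exact ⟨G.incl g, hg, rfl⟩
    have hle : ((G.toPar hp).quot f.rangeRestrict Sf.surj).pdeg w ≤
        ((B.toPar hp).expand (δ := δ.compl d)).pdeg w := by
      refine ParBundle.pdeg_le hp hpi (LinearEquiv.refl C.K (LinearMap.range f)) ?_ ?_ hw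
      · intro x
        have h := hmap x (E.stalk x)
        rw [G.stalk_eq, X.stalk_proj] at h
        exact h
      · intro i j
        have h := hmap (p i) (E.flag i j)
        rw [X.flag_proj] at h
        exact h
    rw [← G.toPar_pdeg hp, S.pdeg_add hp, ParBundle.expand_pdeg, A.toPar_pdeg hp]
    rw [ParBundle.expand_pdeg, B.toPar_pdeg hp] at hle
    linarith

end Extension

end ParHiggs

namespace ParHiggs

/-! ### Splittings and isomorphisms of extensions -/

variable {C : Curve} {n : ℕ} {p : Fin n → C.X} {r : ℕ}

lemma lt_of_weight_lt {w : Weights n r} (hw : w ∈ weightSpace n r) {i : Fin n} {j k : Fin r}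
    (h : w i k < w i j) : j < k := by
  rcases lt_trichotomy j k with h1 | rfl | h1
  · exact h1
  · exact absurd h (lt_irrefl _)
  · exact absurd ((hw i).2.1 k j h1) h.asymm

namespace Extension

variable {d : ℤ} {δ : DiscreteData n r} {E : QPHB C p r}
  {Ep : QPHB C p δ.rk} {Em : QPHB C p (δ.compl d).rk}

/-- An extension splits if `E` has a sub-PHB which meets `E⁺` trivially and has the same discrete
data as `E⁻`: it projects to `E⁻` injectively, and then isomorphically because the degrees and the
jumps of the flags agree. -/
theorem isSplit_of_sub (X : Extension d δ E Ep Em) (hp : ∀ i, IsClosed ({p i} : Set C.X))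
    (G : E.Sub) (h0 : ∀ v, X.inc v ∈ LinearMap.range G.incl → v = 0)
    (hrk : G.rank = (δ.compl d).rk) (hdeg : Em.degree ≤ G.degree)
    (hN : G.jumps = (δ.compl d).N) {w : Weights n r} (hw : w ∈ weightSpace n r) :
    X.IsSplit w := by
  let f₀ : G.V →ₗ[C.K] Em.V := X.proj ∘ₗ G.incl
  have hf₀ : Function.Injective f₀ := by
    rw [injective_iff_map_eq_zero]
    intro g hg
    obtain ⟨v, hv⟩ := (X.exact (G.incl g)).1 hg
    have h1 := h0 v ⟨g, hv.symm⟩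
    rw [h1, map_zero] at hv
    exact G.incl_injective (hv.symm.trans (map_zero _).symm)
  have hdim : Module.finrank C.K G.V = Module.finrank C.K Em.V := by
    rw [G.finrank_eq, Em.finrank_eq, Em.rank_eq, hrk]
  let f : G.V ≃ₗ[C.K] Em.V := LinearMap.linearEquivOfInjective f₀ hf₀ hdim
  have hf : ∀ g, f g = X.proj (G.incl g) := fun _ => rfl
  have hstalk : ∀ x, (G.stalk x).map (atPt f.toLinearMap x) = Em.stalk x := by
    refine VectorBundle.stalk_eq_of_degree_eq f (fun x => ?_) hdeg
    rintro _ ⟨g, hg, rfl⟩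
    rw [← X.stalk_proj]
    rw [← G.stalk_eq] at hg
    exact ⟨G.incl g, hg, rfl⟩
  have hflag : ∀ i j, ((E.flag i j).comap (atPt G.incl (p i))).map (atPt f.toLinearMap (p i)) =
      Em.flag i ((δ.compl d).count i j) := by
    refine ParBundle.flag_eq_of_jump_eq (P := Em.toPar.expand (δ := δ.compl d))
      (P' := G.toPar hp) hp f hstalk ?_ ?_
    · rintro i j _ ⟨g, hg, rfl⟩
      change X.proj (G.incl g) ∈ Em.flag i ((δ.compl d).count i j)
      rw [← X.flag_proj]
      exact ⟨G.incl g, hg, rfl⟩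
    · intro i j hj
      obtain ⟨j, rfl⟩ : ∃ j' : Fin r, (j' : ℕ) = j := ⟨⟨j, hj⟩, rfl⟩
      rw [G.toPar_jump, G.mult_eq, hN]
      by_cases hjN : j ∈ (δ.compl d).N i
      · obtain ⟨k, rfl⟩ := (δ.compl d).exists_of_mem i hjN
        rw [if_pos hjN, ParBundle.expand_jump, Em.toPar_jump hp, Nat.cast_one]
      · rw [if_neg hjN, ParBundle.expand_jump_of_notMem _ i hjN, Nat.cast_zero]
  obtain ⟨φ, hφ⟩ := exists_linearMap_sub G.incl G.incl_injective E.higgs G.invariant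
  let s : Em.V →ₗ[C.K] E.V := G.incl ∘ₗ f.symm.toLinearMap
  have hs : ∀ g, s (f g) = G.incl g := fun g => by
    change G.incl (f.symm (f g)) = _
    rw [f.symm_apply_apply]
  refine ⟨s, ⟨fun x => ?_, fun i a k hk => ?_, fun v => ?_⟩, fun v => ?_⟩
  · rintro _ ⟨v, hv, rfl⟩
    rw [← hstalk] at hv
    obtain ⟨g, hg, rfl⟩ := hv
    rw [← G.stalk_eq] at hg
    change s (f g) ∈ _
    rw [hs]
    exact hg
  · rintro _ ⟨v, hv, rfl⟩
    have h1 := lt_of_weight_lt hw hk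
    rw [← (δ.compl d).count_orderEmbOfFin_succ, ← hflag] at hv
    obtain ⟨g, hg, rfl⟩ := hv
    change s (f g) ∈ _
    rw [hs]
    exact E.flag_mono i (Nat.succ_le_of_lt h1) hg
  · obtain ⟨g, rfl⟩ := f.surjective v
    rw [hs, hf, X.higgs_proj, hφ, lTensor_lTensor_apply, lTensor_lTensor_apply]
    congr 2
    exact LinearMap.ext fun g => (hs g).symm
  · obtain ⟨g, rfl⟩ := f.surjective v
    rw [hs, hf]

/-- A splitting embeds `E⁻` into `E` as a sub-PHB with the complementary discrete data. -/
theorem exists_sub_of_isSplit (X : Extension d δ E Ep Em) {w : Weights n r}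
    (hw : w ∈ weightSpace n r) (h : X.IsSplit w) :
    ∃ G : E.Sub, G.rank = (δ.compl d).rk ∧ G.degree = Em.degree ∧
      G.jumps = (δ.compl d).N := by
  obtain ⟨s, hs, hps⟩ := h
  have hinj : Function.Injective s := Function.LeftInverse.injective hps
  let G : E.Sub := E.subOf s hinj fun v => ⟨Em.higgs v, (hs.higgs v).symm⟩
  have hstalk : ∀ x, (E.stalk x).comap (atPt s x) = Em.stalk x := fun x => by
    refine le_antisymm (fun v hv => ?_) (Submodule.map_le_iff_le_comap.1 (hs.stalk x))
    rw [← X.stalk_proj]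
    exact ⟨s v, hv, hps v⟩
  refine ⟨G, ?_, ?_, ?_⟩
  · exact Em.finrank_eq.trans Em.rank_eq
  · rw [G.degree_eq Em.rationalFrame, Em.degree_eq Em.rationalFrame]
    exact finsum_congr fun x => congrArg (fun L => latDegAt L Em.rationalFrame) (hstalk x)
  · refine G.jumps_eq (fun i k => Em.flag i k) Em.flag_lt fun i j => ?_
    refine le_antisymm (fun v hv => ?_) fun v hv => ?_
    · change v ∈ Em.flag i _
      rw [← X.flag_proj]
      exact ⟨s v, hv, hps v⟩
    · change s v ∈ E.flag i j
      rcases le_or_gt r j with hj | hj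
      · rw [E.flag_top i j hj]
        rw [(δ.compl d).count_of_le i hj, Em.flag_top i _ le_rfl] at hv
        exact hs.stalk _ ⟨v, hv, rfl⟩
      rcases Nat.eq_zero_or_pos ((δ.compl d).count i j) with hc | hc
      · rw [hc, Em.flag_zero] at hv
        refine E.flag_mono i (Nat.zero_le j) ?_
        rw [E.flag_zero]
        have h1 : s v ∈ (C.m (p i) • Em.stalk (p i)).map (atPt s (p i)) := ⟨v, hv, rfl⟩
        rw [Submodule.map_smul''] at h1
        exact Submodule.smul_mono le_rfl (hs.stalk _) h1
      · obtain ⟨c, hc⟩ := Nat.exists_eq_succ_of_ne_zero hc.ne'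
        have hcr : c < (δ.compl d).rk := by
          rw [Nat.lt_iff_add_one_le, ← Nat.succ_eq_add_one, ← hc,
            ← (δ.compl d).count_of_le i le_rfl]
          exact (δ.compl d).count_mono i hj.le
        have h1 : (((δ.compl d).N i).orderEmbOfFin ((δ.compl d).card_N i) ⟨c, hcr⟩ : Fin r) <
            (⟨j, hj⟩ : Fin r) := by
          by_contra hlt
          have h2 := (δ.compl d).count_mono i (not_lt.1 hlt)
          rw [(δ.compl d).count_orderEmbOfFin] at h2
          change (δ.compl d).count i j ≤ c at h2
          omega
        rw [hc] at hv
        exact hs.parabolic i ⟨c, hcr⟩ ⟨j, hj⟩ ((hw i).2.1 _ _ h1) ⟨v, hv, rfl⟩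

variable {Ep' : QPHB C p δ.rk} {Em' : QPHB C p (δ.compl d).rk}

/-- An expression of `E` as an extension is determined by the subbundle `E⁺`. -/
theorem equivalent_of_range_eq (X : Extension d δ E Ep Em) (X' : Extension d δ E Ep' Em')
    (h : LinearMap.range X.inc = LinearMap.range X'.inc) : X.Equivalent X' := by
  let f : Ep.V ≃ₗ[C.K] Ep'.V := (LinearEquiv.ofInjective X.inc X.inc_injective).trans
    ((LinearEquiv.ofEq _ _ h).trans (LinearEquiv.ofInjective X'.inc X'.inc_injective).symm)
  have hf : ∀ v, X'.inc (f v) = X.inc v := fun v =>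
    congrArg Subtype.val
      ((LinearEquiv.ofInjective X'.inc X'.inc_injective).apply_symm_apply _)
  have hker : LinearMap.ker X.proj = LinearMap.ker X'.proj := by
    rw [LinearMap.exact_iff.1 X.exact, LinearMap.exact_iff.1 X'.exact, h]
  let g : Em.V ≃ₗ[C.K] Em'.V :=
    (X.proj.quotKerEquivOfSurjective X.proj_surjective).symm.trans
      ((Submodule.quotEquivOfEq _ _ hker).trans
        (X'.proj.quotKerEquivOfSurjective X'.proj_surjective))
  have hg : ∀ v, g (X.proj v) = X'.proj v := fun v => by
    have h1 : (X.proj.quotKerEquivOfSurjective X.proj_surjective).symm (X.proj v) =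
        Submodule.Quotient.mk v := by
      rw [LinearEquiv.symm_apply_eq]
      rfl
    change X'.proj.quotKerEquivOfSurjective X'.proj_surjective
      (Submodule.quotEquivOfEq _ _ hker
        ((X.proj.quotKerEquivOfSurjective X.proj_surjective).symm (X.proj v))) = _
    rw [h1]
    rfl
  have hcomap : ∀ (x : C.X) (L : Submodule (C.O x) E.V),
      (L.comap (atPt X.inc x)).map (atPt f.toLinearMap x) = L.comap (atPt X'.inc x) :=
    fun x L => by
      ext v
      obtain ⟨u, rfl⟩ := f.surjective v
      constructor
      · rintro ⟨u', hu', huu⟩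
        rw [← f.injective huu]
        change X'.inc (f u') ∈ L
        rw [hf]
        exact hu'
      · intro hv
        refine ⟨u, ?_, rfl⟩
        change X.inc u ∈ L
        rw [← hf]
        exact hv
  have hmap : ∀ (x : C.X) (L : Submodule (C.O x) E.V),
      (L.map (atPt X.proj x)).map (atPt g.toLinearMap x) = L.map (atPt X'.proj x) :=
    fun x L => by
      ext v
      constructor
      · rintro ⟨_, ⟨u, hu, rfl⟩, rfl⟩
        exact ⟨u, hu, (hg u).symm⟩
      · rintro ⟨u, hu, rfl⟩
        exact ⟨X.proj u, ⟨u, hu, rfl⟩, hg u⟩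
  refine ⟨f, g, ⟨fun x => ?_, fun i k => ?_, fun v => ?_⟩,
    ⟨fun x => ?_, fun i k => ?_, fun v => ?_⟩, hf, fun v => (hg v).symm⟩
  · rw [← X.stalk_inc, ← X'.stalk_inc, hcomap]
  · rcases le_total k δ.rk with hk | hk
    · rw [← δ.count_step i hk, ← X.flag_inc, ← X'.flag_inc, hcomap]
    · rw [Ep.flag_top i k hk, Ep'.flag_top i k hk, ← X.stalk_inc, ← X'.stalk_inc, hcomap]
  · apply Module.Flat.lTensor_preserves_injective_linearMap (M := C.Om) X'.inc X'.inc_injective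
    rw [← X'.higgs_inc, hf, X.higgs_inc, lTensor_lTensor_apply]
    congr 2
    exact LinearMap.ext fun u => (hf u).symm
  · rw [← X.stalk_proj, ← X'.stalk_proj, hmap]
  · rcases le_total k (δ.compl d).rk with hk | hk
    · rw [← (δ.compl d).count_step i hk, ← X.flag_proj, ← X'.flag_proj, hmap]
    · rw [Em.flag_top i k hk, Em'.flag_top i k hk, ← X.stalk_proj, ← X'.stalk_proj, hmap]
  · obtain ⟨u, rfl⟩ := X.proj_surjective v
    rw [hg, X'.higgs_proj, X.higgs_proj, lTensor_lTensor_apply]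
    congr 2
    exact LinearMap.ext fun u => (hg u).symm

end Extension

end ParHiggs

namespace ParHiggs

/-! ### Walls and chambers -/

variable {n r : ℕ} {d : ℤ}

lemma convex_weightSpace : Convex ℝ (weightSpace n r) := by
  intro v hv w hw a b ha hb hab i
  have key : ∀ x y c e : ℝ, x < c → y < e → a * x + b * y < a * c + b * e := by
    intro x y c e hx hy
    rcases ha.eq_or_lt with rfl | ha'
    · have : b = 1 := by linarith
      subst this
      linarith
    · nlinarith [mul_le_mul_of_nonneg_left hy.le hb, mul_lt_mul_of_pos_left hx ha']
  refine ⟨fun j => ?_, fun j k hjk => ?_, fun j => ?_⟩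
  · have := key _ _ _ _ ((hv i).1 j) ((hw i).1 j)
    rw [mul_one, mul_one, hab] at this
    exact this
  · exact key _ _ _ _ ((hv i).2.1 j k hjk) ((hw i).2.1 j k hjk)
  · exact add_nonneg (mul_nonneg ha ((hv i).2.2 j)) (mul_nonneg hb ((hw i).2.2 j))

namespace DiscreteData

lemma eq_of_fields {δ δ' : DiscreteData n r} (h1 : δ.rk = δ'.rk) (h2 : δ.deg = δ'.deg)
    (h3 : δ.N = δ'.N) : δ = δ' := by
  cases δ
  cases δ'
  congr

/-- The amount `r⁺ pdeg E - r pdeg E⁺` by which a sub-PHB `E⁺` with discrete data `δ` satisfies the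
stability condition; it vanishes on the wall of `δ`. -/
def gap (δ : DiscreteData n r) (d : ℤ) (w : Weights n r) : ℝ := δ.lhs d w - δ.rhs w

lemma mem_wall_iff (δ : DiscreteData n r) {w : Weights n r} :
    w ∈ δ.wall d ↔ w ∈ weightSpace n r ∧ δ.gap d w = 0 := by
  rw [gap, sub_eq_zero]
  rfl

lemma gap_compl (δ : DiscreteData n r) (w : Weights n r) :
    (δ.compl d).gap d w = - δ.gap d w := by
  have h : ∀ i, ∑ j ∈ (δ.N i)ᶜ, w i j = ∑ j, w i j - ∑ j ∈ δ.N i, w i j := fun i => by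
    rw [← Finset.sum_add_sum_compl (δ.N i)]
    ring
  simp only [gap, lhs, rhs, compl, h, Finset.sum_sub_distrib, Nat.cast_sub δ.rk_lt.le,
    Int.cast_sub]
  ring

lemma continuous_gap (δ : DiscreteData n r) : Continuous (δ.gap d) := by
  unfold gap lhs rhs
  fun_prop

lemma gap_add_smul (δ : DiscreteData n r) (w v : Weights n r) (t : ℝ) :
    δ.gap d (w + t • v) = δ.gap d w +
      t * (δ.rk * ∑ i, ∑ j, v i j - r * ∑ i, ∑ j ∈ δ.N i, v i j) := by
  simp only [gap, lhs, rhs, Pi.add_apply, Pi.smul_apply, smul_eq_mul, Finset.sum_add_distrib,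
    ← Finset.mul_sum]
  ring

lemma convex_gap_neg (δ : DiscreteData n r) : Convex ℝ {w | δ.gap d w < 0} := by
  intro v hv w hw a b ha hb hab
  have h1 : a • v + b • w = v + b • (w - v) := by
    obtain rfl : a = 1 - b := by linarith
    module
  have h2 := δ.gap_add_smul (d := d) v (w - v) 1
  rw [one_smul, add_sub_cancel, one_mul] at h2
  change δ.gap d _ < 0
  rw [h1, gap_add_smul, ← sub_eq_iff_eq_add'.2 h2]
  have hv' : δ.gap d v < 0 := hv
  have hw' : δ.gap d w < 0 := hw
  obtain rfl : a = 1 - b := by linarith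
  rcases hb.eq_or_lt with rfl | hb'
  · linarith
  · nlinarith

/-- Near a point `w₀` of the wall of `δ`, the gaps of all discrete data whose walls do not contain
`w₀` dominate that of `δ`, uniformly: although there are infinitely many possible discrete data,
there are finitely many ranks and jumps, and for given ranks and jumps the degree nearest to the
wall is the decisive one. -/
theorem exists_ball_lt_gap (δ : DiscreteData n r) {w₀ : Weights n r} (h₀ : δ.gap d w₀ = 0) :
    ∃ ε > 0, ∀ w ∈ Metric.ball w₀ ε, ∀ δ' : DiscreteData n r, 0 < δ'.gap d w₀ →
      r * |δ.gap d w| < δ'.gap d w := by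
  -- the gap of discrete data with ranks and jumps `k`, but degree zero
  let κ (k : Fin (r + 1) × (Fin n → Finset (Fin r))) (w : Weights n r) : ℝ :=
    (k.1 : ℕ) * (d + ∑ i, ∑ j, w i j) - r * ∑ i, ∑ j ∈ k.2 i, w i j
  have hκ : ∀ k, Continuous (κ k) := fun k => by fun_prop
  -- `⌈κ k w₀ / r⌉ - 1` is the largest degree for which the gap at `w₀` is positive
  have h1 : ∀ k, ∀ᶠ w in 𝓝 w₀, r * |δ.gap d w| < κ k w - r * (⌈κ k w₀ / r⌉ - 1) := by
    intro k
    refine ContinuousAt.eventually_lt ?_ ?_ ?_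
    · exact (continuous_const.mul δ.continuous_gap.abs).continuousAt
    · exact ((hκ k).sub continuous_const).continuousAt
    · rw [h₀, abs_zero, mul_zero, sub_pos]
      have hr : (0 : ℝ) < r := by exact_mod_cast δ.rk_pos.trans δ.rk_lt
      have := Int.ceil_lt_add_one (κ k w₀ / r)
      rw [mul_comm, ← lt_div_iff₀ hr]
      linarith
  obtain ⟨ε, hε, hU⟩ := Metric.eventually_nhds_iff_ball.1 (Filter.eventually_all.2 h1)
  refine ⟨ε, hε, fun w hw δ' hδ' => ?_⟩
  have hgap : ∀ w, δ'.gap d w = κ (⟨δ'.rk, by have := δ'.rk_lt; omega⟩, δ'.N) w - r * δ'.deg :=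
    fun w => by
      simp only [gap, lhs, rhs, κ]
      ring
  refine (hU w hw (⟨δ'.rk, by have := δ'.rk_lt; omega⟩, δ'.N)).trans_le ?_
  rw [hgap] at hδ' ⊢
  have hr : (0 : ℝ) < r := by exact_mod_cast δ.rk_pos.trans δ.rk_lt
  have h2 : (δ'.deg : ℝ) < κ (⟨δ'.rk, by have := δ'.rk_lt; omega⟩, δ'.N) w₀ / r := by
    rw [lt_div_iff₀ hr]
    linarith
  have h3 := Int.lt_ceil.2 h2
  have h4 : (δ'.deg : ℝ) ≤ ⌈κ (⟨δ'.rk, by have := δ'.rk_lt; omega⟩, δ'.N) w₀ / r⌉ - 1 := by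
    exact_mod_cast Int.le_sub_one_of_lt h3
  exact sub_le_sub_left (mul_le_mul_of_nonneg_left h4 hr.le) _

end DiscreteData

lemma IsChamber.gap_ne_zero {Δ : Set (Weights n r)} (h : IsChamber d Δ) (δ : DiscreteData n r)
    {w : Weights n r} (hw : w ∈ Δ) : δ.gap d w ≠ 0 := fun h0 => by
  obtain ⟨v, -, rfl⟩ := h
  have h1 := connectedComponentIn_subset _ _ hw
  exact h1.2 (Set.mem_iUnion.2 ⟨δ, δ.mem_wall_iff.2 ⟨h1.1, h0⟩⟩)

lemma IsChamber.subset {Δ : Set (Weights n r)} (h : IsChamber d Δ) : Δ ⊆ weightSpace n r := by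
  obtain ⟨v, -, rfl⟩ := h
  exact fun w hw => (connectedComponentIn_subset _ _ hw).1

lemma IsChamber.gap_pos {Δ : Set (Weights n r)} (h : IsChamber d Δ) (δ : DiscreteData n r)
    {v : Weights n r} (hv : v ∈ Δ) (h0 : 0 < δ.gap d v) {w : Weights n r} (hw : w ∈ Δ) :
    0 < δ.gap d w := by
  by_contra hlt
  have hΔ : _root_.IsPreconnected Δ := by
    obtain ⟨v, -, rfl⟩ := h
    exact isPreconnected_connectedComponentIn
  obtain ⟨u, hu, hu0⟩ := hΔ.intermediate_value hw hv δ.continuous_gap.continuousOn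
    ⟨not_lt.1 hlt, h0.le⟩
  exact h.gap_ne_zero δ hu hu0

lemma IsChamber.gap_pos_of_mem_closure {Δ : Set (Weights n r)} (h : IsChamber d Δ)
    (δ : DiscreteData n r) {w₀ : Weights n r} (h₀ : w₀ ∈ closure Δ) (hpos : 0 < δ.gap d w₀)
    {w : Weights n r} (hw : w ∈ Δ) : 0 < δ.gap d w := by
  obtain ⟨v, hv, hvΔ⟩ := mem_closure_iff.1 h₀ _
    (isOpen_lt continuous_const (δ.continuous_gap (d := d))) hpos
  exact h.gap_pos δ hvΔ hv hw

lemma IsChamber.gap_neg_of_mem_closure {Δ : Set (Weights n r)} (h : IsChamber d Δ)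
    (δ : DiscreteData n r) {w₀ : Weights n r} (h₀ : w₀ ∈ closure Δ) (hneg : δ.gap d w₀ < 0)
    {w : Weights n r} (hw : w ∈ Δ) : δ.gap d w < 0 := by
  have h1 := h.gap_pos_of_mem_closure (δ.compl d) h₀ (by rw [δ.gap_compl]; linarith) hw
  rw [δ.gap_compl] at h1
  linarith

lemma IsChamber.eq_of_isPreconnected {Δ Δ' T : Set (Weights n r)} (h : IsChamber d Δ)
    (h' : IsChamber d Δ') (hT : _root_.IsPreconnected T)
    (hTs : T ⊆ weightSpace n r \ ⋃ δ : DiscreteData n r, δ.wall d) {v w : Weights n r}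
    (hv : v ∈ Δ) (hvT : v ∈ T) (hw : w ∈ Δ') (hwT : w ∈ T) : Δ = Δ' := by
  obtain ⟨a, -, rfl⟩ := h
  obtain ⟨b, -, rfl⟩ := h'
  rw [connectedComponentIn_eq hv, connectedComponentIn_eq hw]
  exact connectedComponentIn_eq (hT.subset_connectedComponentIn hvT hTs hwT)

namespace IsWallCrossing

variable {δ : DiscreteData n r} {w₀ : Weights n r} {Δp Δm : Set (Weights n r)}

lemma gap_eq_zero (hW : IsWallCrossing d δ w₀ Δp Δm) : δ.gap d w₀ = 0 :=
  (δ.mem_wall_iff.1 hW.mem).2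

lemma gap_neg (hW : IsWallCrossing d δ w₀ Δp Δm) {w : Weights n r} (hw : w ∈ Δp) :
    δ.gap d w < 0 :=
  lt_of_le_of_ne (sub_nonpos.2 (hW.sign w hw)) (hW.chamber_p.gap_ne_zero δ hw)

/-- The two chambers lie on different sides of the wall: near `w₀`, the part of the weight space on
either side of the wall is convex and meets no other wall, so it lies in one chamber. -/
theorem gap_pos (hW : IsWallCrossing d δ w₀ Δp Δm) {w : Weights n r} (hw : w ∈ Δm) :
    0 < δ.gap d w := by
  by_contra hlt
  have hneg : ∀ v ∈ Δm, δ.gap d v < 0 := fun v hv => by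
    by_contra hv'
    exact hlt (hW.chamber_m.gap_pos δ hv
      (lt_of_le_of_ne (not_lt.1 hv') (hW.chamber_m.gap_ne_zero δ hv).symm) hw)
  obtain ⟨ε, hε, hU⟩ := δ.exists_ball_lt_gap hW.gap_eq_zero
  obtain ⟨a, haU, ha⟩ := mem_closure_iff.1 hW.adj_p _ Metric.isOpen_ball (Metric.mem_ball_self hε)
  obtain ⟨b, hbU, hb⟩ := mem_closure_iff.1 hW.adj_m _ Metric.isOpen_ball (Metric.mem_ball_self hε)
  let T := (Metric.ball w₀ ε ∩ weightSpace n r) ∩ {w | δ.gap d w < 0}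
  have hT : Convex ℝ T := ((convex_ball w₀ ε).inter convex_weightSpace).inter δ.convex_gap_neg
  refine hW.ne (hW.chamber_p.eq_of_isPreconnected hW.chamber_m hT.isPreconnected ?_ ha
    ⟨⟨haU, hW.chamber_p.subset ha⟩, hW.gap_neg ha⟩ hb ⟨⟨hbU, hW.chamber_m.subset hb⟩, hneg b hb⟩)
  rintro v ⟨⟨hvU, hvS⟩, hv⟩
  refine ⟨hvS, fun hmem => ?_⟩
  obtain ⟨δ', hδ'⟩ := Set.mem_iUnion.1 hmem
  have h0 := (δ'.mem_wall_iff.1 hδ').2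
  have hr : (0 : ℝ) ≤ r * |δ.gap d v| := by positivity
  rcases lt_trichotomy (δ'.gap d w₀) 0 with h1 | h1 | h1
  · have h2 := hU v hvU (δ'.compl d) (by rw [δ'.gap_compl]; linarith)
    rw [δ'.gap_compl, h0] at h2
    linarith
  · rw [hW.only δ' (δ'.mem_wall_iff.2 ⟨(δ.mem_wall_iff.1 hW.mem).1, h1⟩), δ.mem_wall_iff] at hδ'
    exact (ne_of_lt hv) hδ'.2
  · have h2 := hU v hvU δ' h1
    rw [h0] at h2
    linarith

lemma pos (hW : IsWallCrossing d δ w₀ Δp Δm) : 0 < n := by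
  rcases Nat.eq_zero_or_pos n with rfl | h
  · obtain ⟨a, -, ha⟩ := mem_closure_iff.1 hW.adj_p _ isOpen_univ trivial
    obtain ⟨b, -, hb⟩ := mem_closure_iff.1 hW.adj_m _ isOpen_univ trivial
    have := hW.gap_pos hb
    rw [Subsingleton.elim b a] at this
    exact absurd this (hW.gap_neg ha).not_gt
  · exact h

end IsWallCrossing

/-- A point of the weight space can be moved a little in any nonnegative direction. -/
lemma exists_add_smul_mem_weightSpace {w v : Weights n r} (hw : w ∈ weightSpace n r)
    (hv : ∀ i j, 0 ≤ v i j) : ∃ t : ℝ, 0 < t ∧ w + t • v ∈ weightSpace n r := by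
  have hc : ∀ i j, Continuous fun t : ℝ => (w + t • v) i j := fun i j => by
    change Continuous fun t : ℝ => w i j + t * v i j
    fun_prop
  have h0 : ∀ i j, (w + (0 : ℝ) • v) i j = w i j := fun i j => by
    rw [zero_smul, add_zero]
  have h1 : ∀ᶠ t : ℝ in 𝓝 0, ∀ i j, (w + t • v) i j < 1 :=
    Filter.eventually_all.2 fun i => Filter.eventually_all.2 fun j =>
      (hc i j).continuousAt.eventually_lt continuousAt_const (by rw [h0]; exact (hw i).1 j)
  have h2 : ∀ᶠ t : ℝ in 𝓝 0, ∀ i j k, j < k → (w + t • v) i k < (w + t • v) i j :=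
    Filter.eventually_all.2 fun i => Filter.eventually_all.2 fun j =>
      Filter.eventually_all.2 fun k => by
        by_cases hjk : j < k
        · filter_upwards [(hc i k).continuousAt.eventually_lt (hc i j).continuousAt
            (by rw [h0, h0]; exact (hw i).2.1 j k hjk)] with t ht _ using ht
        · exact Filter.Eventually.of_forall fun t h => absurd h hjk
  obtain ⟨t, ⟨ht1, ht2⟩, ht⟩ :=
    ((((h1.and h2).filter_mono nhdsWithin_le_nhds).and self_mem_nhdsWithin :
      ∀ᶠ t : ℝ in 𝓝[>] 0, _)).exists
  refine ⟨t, ht, fun i => ⟨ht1 i, ht2 i, fun j => ?_⟩⟩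
  exact add_nonneg ((hw i).2.2 j) (mul_nonneg (le_of_lt ht) (hv i j))

namespace IsWallCrossing

variable {δ : DiscreteData n r} {w₀ : Weights n r} {Δp Δm : Set (Weights n r)}

/-- Moving `w₀` in the direction `r⁺ e_{i,j} + (r - r⁺) e_{k,l}`, where `n⁺_{i,j} = 1` and
`n⁺_{k,l} = 0`, one stays on the wall of `δ`, hence on that of any discrete data whose gap vanishes
at `w₀`. -/
lemma rk_eq (hW : IsWallCrossing d δ w₀ Δp Δm) {δ' : DiscreteData n r}
    (h : δ'.gap d w₀ = 0) {i k : Fin n} {j l : Fin r} (hj : j ∈ δ.N i) (hl : l ∉ δ.N k) :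
    (δ'.rk : ℤ) =
      δ.rk * (if j ∈ δ'.N i then 1 else 0) + (r - δ.rk) * if l ∈ δ'.N k then 1 else 0 := by
  let v : Weights n r := fun a b =>
    (δ.rk : ℝ) * (if a = i ∧ b = j then 1 else 0) +
      ((r : ℝ) - δ.rk) * if a = k ∧ b = l then 1 else 0
  have hrk : (0 : ℝ) ≤ (r : ℝ) - δ.rk := sub_nonneg.2 (by exact_mod_cast δ.rk_lt.le)
  have hv : ∀ a b, 0 ≤ v a b := fun a b => by positivity
  have hw₀ := (δ.mem_wall_iff.1 hW.mem).1
  obtain ⟨t, ht, hmem⟩ := exists_add_smul_mem_weightSpace hw₀ hv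
  have hind : ∀ (s : Fin n → Finset (Fin r)) (a₀ : Fin n) (b₀ : Fin r),
      ∑ a, ∑ b ∈ s a, (if a = a₀ ∧ b = b₀ then (1 : ℝ) else 0) =
        if b₀ ∈ s a₀ then 1 else 0 := fun s a₀ b₀ => by
    rw [Finset.sum_eq_single a₀]
    · simp
    · intro a _ ha
      simp [ha]
    · simp
  have hsum : ∀ s : Fin n → Finset (Fin r), ∑ a, ∑ b ∈ s a, v a b =
      δ.rk * (if j ∈ s i then 1 else 0) + (r - δ.rk) * if l ∈ s k then 1 else 0 := fun s => by
    simp only [v, Finset.sum_add_distrib, ← Finset.mul_sum, hind]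
  have hsum' : ∑ a, ∑ b, v a b = r := by
    rw [hsum fun _ => Finset.univ]
    simp
  have h1 : δ.gap d (w₀ + t • v) = 0 := by
    rw [δ.gap_add_smul, hW.gap_eq_zero, hsum', hsum, if_pos hj, if_neg hl]
    ring
  have h2 : w₀ + t • v ∈ δ'.wall d := by
    rw [hW.only δ' (δ'.mem_wall_iff.2 ⟨hw₀, h⟩)]
    exact δ.mem_wall_iff.2 ⟨hmem, h1⟩
  have h3 := (δ'.mem_wall_iff.1 h2).2
  have hr : (r : ℝ) ≠ 0 := by exact_mod_cast (δ.rk_pos.trans δ.rk_lt).ne'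
  rw [δ'.gap_add_smul, h, hsum', zero_add, hsum, mul_comm (δ'.rk : ℝ), ← mul_sub] at h3
  have h4 := (mul_eq_zero.1 ((mul_eq_zero.1 h3).resolve_left ht.ne')).resolve_left hr
  rw [sub_eq_zero] at h4
  exact_mod_cast h4

/-- The wall of `δ` determines `δ` up to passing to the complementary data. -/
theorem eq_or_eq_compl (hW : IsWallCrossing d δ w₀ Δp Δm) {δ' : DiscreteData n r}
    (h : δ'.gap d w₀ = 0) : δ' = δ ∨ δ' = δ.compl d := by
  have hdeg : ∀ {ε : DiscreteData n r}, ε.gap d w₀ = 0 → δ'.rk = ε.rk → δ'.N = ε.N →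
      δ' = ε := fun {ε} hε h1 h2 => by
    refine DiscreteData.eq_of_fields h1 ?_ h2
    have hr : (r : ℝ) ≠ 0 := by exact_mod_cast (δ.rk_pos.trans δ.rk_lt).ne'
    have h3 := h.trans hε.symm
    rw [DiscreteData.gap, DiscreteData.gap, DiscreteData.lhs, DiscreteData.lhs, DiscreteData.rhs,
      DiscreteData.rhs, h1, h2, sub_right_inj, mul_right_inj' hr, add_left_inj] at h3
    exact_mod_cast h3
  have hne : ∀ i, ∃ j, j ∈ δ.N i := fun i =>
    Finset.card_pos.1 (by rw [δ.card_N]; exact δ.rk_pos)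
  have hne' : ∀ i, ∃ l, l ∉ δ.N i := fun i => by
    obtain ⟨l, hl⟩ : ((δ.N i)ᶜ).Nonempty :=
      Finset.card_pos.1 (((δ.compl d).rk_pos).trans_eq ((δ.compl d).card_N i).symm)
    exact ⟨l, Finset.mem_compl.1 hl⟩
  have h1 := δ'.rk_pos
  have h2 := δ'.rk_lt
  have h3 := δ.rk_lt
  have h4 := δ.rk_pos
  have key : ∀ {i k j l}, j ∈ δ.N i → l ∉ δ.N k →
      (j ∈ δ'.N i ∧ l ∉ δ'.N k ∧ δ'.rk = δ.rk) ∨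
      (j ∉ δ'.N i ∧ l ∈ δ'.N k ∧ δ'.rk = r - δ.rk) := fun {i k j l} hj hl => by
    have h5 := hW.rk_eq h hj hl
    by_cases hj' : j ∈ δ'.N i <;> by_cases hl' : l ∈ δ'.N k <;> simp [hj', hl'] at h5 ⊢ <;> omega
  let i₀ : Fin n := ⟨0, hW.pos⟩
  obtain ⟨j₀, hj₀⟩ := hne i₀
  obtain ⟨l₀, hl₀⟩ := hne' i₀
  by_cases hc : j₀ ∈ δ'.N i₀
  · have hout : ∀ {k l}, l ∉ δ.N k → l ∉ δ'.N k := fun hl => by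
      rcases key hj₀ hl with h5 | h5
      · exact h5.2.1
      · exact absurd hc h5.1
    have hrk : δ'.rk = δ.rk := by
      rcases key hj₀ hl₀ with h5 | h5
      · exact h5.2.2
      · exact absurd hc h5.1
    refine Or.inl (hdeg hW.gap_eq_zero hrk (funext fun i => Finset.ext fun j => ?_))
    refine ⟨fun hj => by_contra fun hj' => hout hj' hj, fun hj => ?_⟩
    rcases key hj hl₀ with h5 | h5
    · exact h5.1
    · exact absurd h5.2.1 (hout hl₀)
  · have hin : ∀ {k l}, l ∉ δ.N k → l ∈ δ'.N k := fun hl => by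
      rcases key hj₀ hl with h5 | h5
      · exact absurd h5.1 hc
      · exact h5.2.1
    have hrk : δ'.rk = r - δ.rk := by
      rcases key hj₀ hl₀ with h5 | h5
      · exact absurd h5.1 hc
      · exact h5.2.2
    refine Or.inr (hdeg (by rw [δ.gap_compl, hW.gap_eq_zero, neg_zero]) hrk
      (funext fun i => Finset.ext fun j => ?_))
    change j ∈ δ'.N i ↔ j ∈ (δ.N i)ᶜ
    rw [Finset.mem_compl]
    refine ⟨fun hj hj' => ?_, hin⟩
    rcases key hj' hl₀ with h5 | h5
    · exact h5.2.1 (hin hl₀)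
    · exact h5.1 hj

end IsWallCrossing

end ParHiggs

namespace ParHiggs

/-! ### Stability in terms of gaps -/

variable {C : Curve} {n : ℕ} {p : Fin n → C.X} {r : ℕ} {d : ℤ}

lemma DiscreteData.cast_compl_rk (δ : DiscreteData n r) :
    ((δ.compl d).rk : ℝ) = r - δ.rk := Nat.cast_sub δ.rk_lt.le

namespace QPHB

variable {E : QPHB C p r}

/-- The amount `rk F · pdeg E - r · pdeg F` by which a sub-PHB `F` satisfies the stability
condition. -/
noncomputable def Sub.gap (F : E.Sub) (w : Weights n r) : ℝ := F.rank * E.pdeg w - r * F.pdeg w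

lemma isStable_iff {w : Weights n r} :
    E.IsStable w ↔ ∀ F : E.Sub, 0 < F.rank → F.rank < r → 0 < F.gap w := by
  refine forall_congr' fun F => forall_congr' fun h0 => forall_congr' fun hr => ?_
  have h2 : (0 : ℝ) < F.rank := by exact_mod_cast h0
  have h3 : (0 : ℝ) < r := by exact_mod_cast h0.trans hr
  rw [div_lt_div_iff₀ h2 h3, Sub.gap, sub_pos, mul_comm (F.pdeg w), mul_comm (E.pdeg w)]

lemma IsSemistable.gap_nonneg {w : Weights n r} (h : E.IsSemistable w) (F : E.Sub)
    (h0 : 0 < F.rank) (hr : F.rank < r) : 0 ≤ F.gap w := by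
  have h1 := h F h0 hr
  have h2 : (0 : ℝ) < F.rank := by exact_mod_cast h0
  have h3 : (0 : ℝ) < r := by exact_mod_cast h0.trans hr
  rw [div_le_div_iff₀ h2 h3] at h1
  rw [Sub.gap]
  linarith

lemma Sub.gap_eq (hE : E.degree = d) (F : E.Sub) {δ : DiscreteData n r} (hrk : F.rank = δ.rk)
    (hdeg : F.degree = δ.deg) (hN : F.jumps = δ.N) (w : Weights n r) : F.gap w = δ.gap d w := by
  rw [gap, F.pdeg_eq, hrk, hdeg, hN, QPHB.pdeg, hE]
  rfl

lemma Sub.gap_data (hp : ∀ i, IsClosed ({p i} : Set C.X)) (hE : E.degree = d) (F : E.Sub)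
    (h0 : 0 < F.rank) (hr : F.rank < r) (w : Weights n r) :
    (F.data hp h0 hr).gap d w = F.gap w :=
  (F.gap_eq hE (δ := F.data hp h0 hr) rfl rfl rfl w).symm

/-- A sub-PHB whose gap vanishes at a point lying on exactly one wall has the discrete data of that
wall, or the complementary ones. -/
lemma Sub.data_of_gap_eq_zero {δ : DiscreteData n r} {w₀ : Weights n r}
    {Δp Δm : Set (Weights n r)} (hW : IsWallCrossing d δ w₀ Δp Δm)
    (hp : ∀ i, IsClosed ({p i} : Set C.X)) (hE : E.degree = d) (F : E.Sub)
    (h0 : 0 < F.rank) (hr : F.rank < r) (h : F.gap w₀ = 0) :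
    (F.rank = δ.rk ∧ F.degree = δ.deg ∧ F.jumps = δ.N) ∨
      (F.rank = (δ.compl d).rk ∧ F.degree = (δ.compl d).deg ∧ F.jumps = (δ.compl d).N) := by
  rw [← F.gap_data hp hE h0 hr] at h
  have h1 : (F.data hp h0 hr).rk = F.rank := rfl
  have h2 : (F.data hp h0 hr).deg = F.degree := rfl
  have h3 : (F.data hp h0 hr).N = F.jumps := rfl
  rw [← h1, ← h2, ← h3]
  rcases hW.eq_or_eq_compl h with h4 | h4
  · exact Or.inl (by rw [h4]; exact ⟨rfl, rfl, rfl⟩)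
  · exact Or.inr (by rw [h4]; exact ⟨rfl, rfl, rfl⟩)

lemma Sub.gap_pos_of_mem_closure (hp : ∀ i, IsClosed ({p i} : Set C.X)) (hE : E.degree = d)
    (F : E.Sub) (h0 : 0 < F.rank) (hr : F.rank < r) {Δ : Set (Weights n r)} (h : IsChamber d Δ)
    {w₀ : Weights n r} (h₀ : w₀ ∈ closure Δ) (hpos : 0 < F.gap w₀) {w : Weights n r}
    (hw : w ∈ Δ) : 0 < F.gap w := by
  rw [← F.gap_data hp hE h0 hr] at hpos ⊢
  exact h.gap_pos_of_mem_closure _ h₀ hpos hw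

lemma Sub.gap_neg_of_mem_closure (hp : ∀ i, IsClosed ({p i} : Set C.X)) (hE : E.degree = d)
    (F : E.Sub) (h0 : 0 < F.rank) (hr : F.rank < r) {Δ : Set (Weights n r)} (h : IsChamber d Δ)
    {w₀ : Weights n r} (h₀ : w₀ ∈ closure Δ) (hneg : F.gap w₀ < 0) {w : Weights n r}
    (hw : w ∈ Δ) : F.gap w < 0 := by
  rw [← F.gap_data hp hE h0 hr] at hneg ⊢
  exact h.gap_neg_of_mem_closure _ h₀ hneg hw

end QPHB

namespace Extension

variable {δ : DiscreteData n r} {E : QPHB C p r}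
  {Ep : QPHB C p δ.rk} {Em : QPHB C p (δ.compl d).rk}

lemma degree_eq (X : Extension d δ E Ep Em) (hd : Ep.degree = δ.deg)
    (hd' : Em.degree = (δ.compl d).deg) : E.degree = d := by
  have h1 : E.degree = Ep.degree + Em.degree := X.isExact.degree_add
  have h2 : (δ.compl d).deg = d - δ.deg := rfl
  omega

lemma gap_eq (_X : Extension d δ E Ep Em) (hd : Ep.degree = δ.deg) (hE : E.degree = d)
    (w : Weights n r) :
    δ.gap d w = δ.rk * E.pdeg w - r * Ep.pdeg (δ.restrict w) := by
  have h : ∀ i, ∑ j ∈ δ.N i, w i j = ∑ k, δ.restrict w i k := fun i => by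
    have h1 := Finset.sum_map Finset.univ ((δ.N i).orderEmbOfFin (δ.card_N i)).toEmbedding (w i)
    rw [Finset.map_orderEmbOfFin_univ] at h1
    exact h1
  simp only [DiscreteData.gap, DiscreteData.lhs, DiscreteData.rhs, QPHB.pdeg, h, hd, hE]

lemma subInc_gap (X : Extension d δ E Ep Em) (hd : Ep.degree = δ.deg) (hE : E.degree = d)
    (w : Weights n r) : X.subInc.gap w = δ.gap d w :=
  X.subInc.gap_eq hE Ep.rank_eq hd X.subInc_jumps w

/-- Stability of the terms of an extension, expressed by gaps of sub-PHBs of `E`. -/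
lemma termsStable_iff (X : Extension d δ E Ep Em) (hp : ∀ i, IsClosed ({p i} : Set C.X))
    (hd : Ep.degree = δ.deg) (hE : E.degree = d) {w : Weights n r} :
    X.TermsStable w ↔
      (∀ A : Ep.Sub, 0 < A.rank → A.rank < δ.rk →
        A.rank * δ.gap d w < δ.rk * (X.incSub A).gap w) ∧
      ∀ B : Em.Sub, 0 < B.rank → B.rank < (δ.compl d).rk →
        ((δ.compl d).rk - B.rank) * δ.gap d w < (δ.compl d).rk * (X.projSub B).gap w := by
  have hr : (0 : ℝ) < r := by exact_mod_cast δ.rk_pos.trans δ.rk_lt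
  have h1 := X.gap_eq hd hE w
  have h2 := X.pdeg_add hp w
  refine and_congr ?_ ?_
  · rw [QPHB.isStable_iff]
    refine forall_congr' fun A => forall_congr' fun _ => forall_congr' fun _ => ?_
    have h3 : ((X.incSub A).rank : ℝ) = A.rank := rfl
    have h4 : δ.rk * (X.incSub A).gap w - A.rank * δ.gap d w =
        r * A.gap (δ.restrict w) := by
      rw [QPHB.Sub.gap, QPHB.Sub.gap, X.incSub_pdeg, h1, h3]
      ring
    rw [← sub_pos (b := (A.rank : ℝ) * _), h4, mul_pos_iff_of_pos_left hr]
  · rw [QPHB.isStable_iff]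
    refine forall_congr' fun B => forall_congr' fun _ => forall_congr' fun _ => ?_
    have h4 : (δ.compl d).rk * (X.projSub B).gap w -
        ((δ.compl d).rk - B.rank) * δ.gap d w = r * B.gap ((δ.compl d).restrict w) := by
      rw [QPHB.Sub.gap, QPHB.Sub.gap, X.projSub_pdeg hp, X.projSub_rank hp, h1, h2,
        δ.cast_compl_rk, Nat.cast_add]
      ring
    rw [← sub_pos (b := ((δ.compl d).rk - B.rank : ℝ) * _), h4, mul_pos_iff_of_pos_left hr]

lemma incSub_rank_lt (X : Extension d δ E Ep Em) (A : Ep.Sub) (h : A.rank < δ.rk) :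
    (X.incSub A).rank < r := lt_trans h δ.rk_lt

lemma projSub_rank_lt (X : Extension d δ E Ep Em) (hp : ∀ i, IsClosed ({p i} : Set C.X))
    (B : Em.Sub) (h : B.rank < (δ.compl d).rk) : (X.projSub B).rank < r := by
  have h1 : (δ.compl d).rk = r - δ.rk := rfl
  rw [X.projSub_rank hp]
  omega

lemma projSub_rank_pos (X : Extension d δ E Ep Em) (hp : ∀ i, IsClosed ({p i} : Set C.X))
    (B : Em.Sub) : 0 < (X.projSub B).rank := by
  have := δ.rk_pos
  rw [X.projSub_rank hp]
  omega

variable {w₀ : Weights n r} {Δp Δm : Set (Weights n r)}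

/-- The jumps of a sub-PHB of `E⁺` are among those of `E⁺`, so its discrete data are neither those
of `E⁺` nor the complementary ones. -/
lemma incSub_gap_ne_zero (X : Extension d δ E Ep Em) (hW : IsWallCrossing d δ w₀ Δp Δm)
    (hp : ∀ i, IsClosed ({p i} : Set C.X)) (hE : E.degree = d) (A : Ep.Sub) (h0 : 0 < A.rank)
    (hr : A.rank < δ.rk) : (X.incSub A).gap w₀ ≠ 0 := fun h => by
  have h1 : (X.incSub A).rank = A.rank := rfl
  rcases (X.incSub A).data_of_gap_eq_zero hW hp hE h0 (X.incSub_rank_lt A hr) h with h2 | h2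
  · omega
  · obtain ⟨j, hj⟩ : ((δ.compl d).N ⟨0, hW.pos⟩).Nonempty :=
      Finset.card_pos.1 (((δ.compl d).rk_pos).trans_eq ((δ.compl d).card_N _).symm)
    have h3 := X.incSub_jumps_subset A ⟨0, hW.pos⟩ (by rw [h2.2.2]; exact hj)
    exact Finset.mem_compl.1 hj h3

/-- The jumps of the preimage of a sub-PHB of `E⁻` contain those of `E⁺`, so its discrete data are
neither those of `E⁺` nor the complementary ones. -/
lemma projSub_gap_ne_zero (X : Extension d δ E Ep Em) (hW : IsWallCrossing d δ w₀ Δp Δm)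
    (hp : ∀ i, IsClosed ({p i} : Set C.X)) (hE : E.degree = d) (B : Em.Sub) (h0 : 0 < B.rank)
    (hr : B.rank < (δ.compl d).rk) : (X.projSub B).gap w₀ ≠ 0 := fun h => by
  have h1 := X.projSub_rank hp B
  rcases (X.projSub B).data_of_gap_eq_zero hW hp hE (X.projSub_rank_pos hp B)
    (X.projSub_rank_lt hp B hr) h with h2 | h2
  · omega
  · obtain ⟨j, hj⟩ : (δ.N ⟨0, hW.pos⟩).Nonempty :=
      Finset.card_pos.1 (δ.rk_pos.trans_eq (δ.card_N _).symm)
    have h3 := X.subset_projSub_jumps hp B ⟨0, hW.pos⟩ hj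
    rw [h2.2.2] at h3
    exact Finset.mem_compl.1 h3 hj

/-- The condition that the gaps at `w₀` of the sub-PHBs of `E` coming from the terms are positive;
it governs the stability of the terms near `w₀`. -/
def GapsPos (X : Extension d δ E Ep Em) (w₀ : Weights n r) : Prop :=
  (∀ A : Ep.Sub, 0 < A.rank → A.rank < δ.rk → 0 < (X.incSub A).gap w₀) ∧
    ∀ B : Em.Sub, 0 < B.rank → B.rank < (δ.compl d).rk → 0 < (X.projSub B).gap w₀

lemma GapsPos.termsStable_of_mem {X : Extension d δ E Ep Em} (h : X.GapsPos w₀)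
    (hp : ∀ i, IsClosed ({p i} : Set C.X)) (hd : Ep.degree = δ.deg) (hE : E.degree = d)
    {w : Weights n r}
    (hw : ∀ δ' : DiscreteData n r, 0 < δ'.gap d w₀ → r * |δ.gap d w| < δ'.gap d w) :
    X.TermsStable w := by
  have key : ∀ (G : E.Sub) (h0 : 0 < G.rank) (hr : G.rank < r), 0 < G.gap w₀ →
      ∀ s t : ℝ, 0 ≤ s → s ≤ r → 1 ≤ t → s * δ.gap d w < t * G.gap w := by
    intro G h0 hr hG s t hs hsr ht
    have h1 := hw (G.data hp h0 hr) (by rwa [G.gap_data hp hE])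
    rw [G.gap_data hp hE] at h1
    have h2 : s * δ.gap d w ≤ r * |δ.gap d w| :=
      (mul_le_mul_of_nonneg_left (le_abs_self _) hs).trans
        (mul_le_mul_of_nonneg_right hsr (abs_nonneg _))
    have h3 : 0 ≤ r * |δ.gap d w| := by positivity
    nlinarith
  rw [X.termsStable_iff hp hd hE]
  have h1 : (1 : ℝ) ≤ δ.rk := by exact_mod_cast δ.rk_pos
  have h2 : (1 : ℝ) ≤ (δ.compl d).rk := by exact_mod_cast (δ.compl d).rk_pos
  have h3 := δ.cast_compl_rk (d := d)
  refine ⟨fun A h0 hr => key _ h0 (X.incSub_rank_lt A hr) (h.1 A h0 hr) _ _ ?_ ?_ h1,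
    fun B h0 hr => key _ (X.projSub_rank_pos hp B) (X.projSub_rank_lt hp B hr) (h.2 B h0 hr) _ _
      ?_ ?_ h2⟩
  · positivity
  · exact_mod_cast (hr.trans δ.rk_lt).le
  · rw [sub_nonneg]
    exact_mod_cast hr.le
  · have h4 : (0 : ℝ) ≤ B.rank := by positivity
    linarith

lemma TermsStable.gapsPos {X : Extension d δ E Ep Em} {w : Weights n r} (h : X.TermsStable w)
    (hW : IsWallCrossing d δ w₀ Δp Δm)
    (hp : ∀ i, IsClosed ({p i} : Set C.X)) (hd : Ep.degree = δ.deg) (hE : E.degree = d)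
    (hw : ∀ δ' : DiscreteData n r, 0 < δ'.gap d w₀ → r * |δ.gap d w| < δ'.gap d w) :
    X.GapsPos w₀ := by
  have key : ∀ (G : E.Sub) (h0 : 0 < G.rank) (hr : G.rank < r), G.gap w₀ ≠ 0 →
      ∀ s t : ℝ, 0 ≤ s → s ≤ r → 1 ≤ t → s * δ.gap d w < t * G.gap w → 0 < G.gap w₀ := by
    intro G h0 hr hG s t hs hsr ht hst
    by_contra hneg
    have h1 := hw ((G.data hp h0 hr).compl d) (by
      rw [DiscreteData.gap_compl, G.gap_data hp hE, neg_pos]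
      exact lt_of_le_of_ne (not_lt.1 hneg) hG)
    rw [DiscreteData.gap_compl, G.gap_data hp hE] at h1
    have h2 : s * -δ.gap d w ≤ r * |δ.gap d w| :=
      (mul_le_mul_of_nonneg_left (neg_le_abs _) hs).trans
        (mul_le_mul_of_nonneg_right hsr (abs_nonneg _))
    have h3 : 0 ≤ r * |δ.gap d w| := by positivity
    nlinarith
  rw [X.termsStable_iff hp hd hE] at h
  have h1 : (1 : ℝ) ≤ δ.rk := by exact_mod_cast δ.rk_pos
  have h2 : (1 : ℝ) ≤ (δ.compl d).rk := by exact_mod_cast (δ.compl d).rk_pos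
  have h3 := δ.cast_compl_rk (d := d)
  refine ⟨fun A h0 hr => key _ h0 (X.incSub_rank_lt A hr)
      (X.incSub_gap_ne_zero hW hp hE A h0 hr) _ _ ?_ ?_ h1 (h.1 A h0 hr),
    fun B h0 hr => key _ (X.projSub_rank_pos hp B) (X.projSub_rank_lt hp B hr)
      (X.projSub_gap_ne_zero hW hp hE B h0 hr) _ _ ?_ ?_ h2 (h.2 B h0 hr)⟩
  · positivity
  · exact_mod_cast (hr.trans δ.rk_lt).le
  · rw [sub_nonneg]
    exact_mod_cast hr.le
  · have h4 : (0 : ℝ) ≤ B.rank := by positivity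
    linarith

lemma GapsPos.termsStable_of_gap_neg {X : Extension d δ E Ep Em} (h : X.GapsPos w₀)
    (hW : IsWallCrossing d δ w₀ Δp Δm) (hp : ∀ i, IsClosed ({p i} : Set C.X))
    (hd : Ep.degree = δ.deg) (hE : E.degree = d) {w : Weights n r} (hw : w ∈ Δp) :
    X.TermsStable w := by
  have hg := hW.gap_neg hw
  rw [X.termsStable_iff hp hd hE]
  refine ⟨fun A h0 hr => ?_, fun B h0 hr => ?_⟩
  · have h1 : 0 < (X.incSub A).gap w := (X.incSub A).gap_pos_of_mem_closure hp hE h0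
      (X.incSub_rank_lt A hr) hW.chamber_p hW.adj_p (h.1 A h0 hr) hw
    have h2 : (0 : ℝ) < A.rank := by exact_mod_cast h0
    have h3 : (0 : ℝ) < δ.rk := by exact_mod_cast δ.rk_pos
    exact (mul_neg_of_pos_of_neg h2 hg).trans (mul_pos h3 h1)
  · have h1 : 0 < (X.projSub B).gap w := (X.projSub B).gap_pos_of_mem_closure hp hE
      (X.projSub_rank_pos hp B) (X.projSub_rank_lt hp B hr) hW.chamber_p hW.adj_p (h.2 B h0 hr) hw
    have h2 : (0 : ℝ) < (δ.compl d).rk - B.rank := by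
      rw [sub_pos]
      exact_mod_cast hr
    have h3 : (0 : ℝ) < (δ.compl d).rk := by exact_mod_cast (δ.compl d).rk_pos
    exact (mul_neg_of_pos_of_neg h2 hg).trans (mul_pos h3 h1)

/-- If the terms of an extension are stable with respect to weights on its wall, then `E` is
semistable, and a sub-PHB of the same slope meets `E⁺`, and maps to `E⁻`, either trivially or
fully. -/
theorem exists_sub_sub_of_gap_eq_zero (X : Extension d δ E Ep Em)
    (hp : ∀ i, IsClosed ({p i} : Set C.X)) (hpi : Function.Injective p)
    (hd : Ep.degree = δ.deg) (hE : E.degree = d) (hw₀ : w₀ ∈ weightSpace n r)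
    (h : X.TermsStable w₀) (hg : δ.gap d w₀ = 0) (G : E.Sub) :
    0 ≤ G.gap w₀ ∧ (G.gap w₀ = 0 → ∃ (A : Ep.Sub) (B : Em.Sub), G.rank = A.rank + B.rank ∧
      (A.rank = 0 ∨ A.rank = δ.rk) ∧ (B.rank = 0 ∨ B.rank = (δ.compl d).rk) ∧
      (∀ v, v ∈ LinearMap.range A.incl ↔ X.inc v ∈ LinearMap.range G.incl) ∧
      ∀ w ∈ weightSpace n r,
        G.pdeg w ≤ A.pdeg (δ.restrict w) + B.pdeg ((δ.compl d).restrict w)) := by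
  obtain ⟨A, B, hrk, hmem, hpdeg⟩ := X.exists_sub_sub hp hpi G
  have hr : (0 : ℝ) < r := by exact_mod_cast δ.rk_pos.trans δ.rk_lt
  have h1 : (0 : ℝ) < δ.rk := by exact_mod_cast δ.rk_pos
  have h2 : (0 : ℝ) < (δ.compl d).rk := by exact_mod_cast (δ.compl d).rk_pos
  have h3 := X.gap_eq hd hE w₀
  have h4 := X.pdeg_add hp w₀
  have h5 := hpdeg w₀ hw₀
  have h6 := δ.cast_compl_rk (d := d)
  rw [hg] at h3
  have hA : δ.rk * (A.rank * E.pdeg w₀ - r * A.pdeg (δ.restrict w₀)) =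
      r * (A.rank * Ep.pdeg (δ.restrict w₀) - δ.rk * A.pdeg (δ.restrict w₀)) := by
    linear_combination (-(A.rank : ℝ)) * h3
  have hB : (δ.compl d).rk * (B.rank * E.pdeg w₀ - r * B.pdeg ((δ.compl d).restrict w₀)) =
      r * (B.rank * Em.pdeg ((δ.compl d).restrict w₀) -
        (δ.compl d).rk * B.pdeg ((δ.compl d).restrict w₀)) := by
    linear_combination (B.rank : ℝ) * h3 + (B.rank : ℝ) * E.pdeg w₀ * h6 + (B.rank : ℝ) * r * h4
  have hA0 : 0 ≤ A.rank * E.pdeg w₀ - r * A.pdeg (δ.restrict w₀) := by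
    refine nonneg_of_mul_nonneg_right ?_ h1
    rw [hA]
    exact mul_nonneg hr.le (sub_nonneg.2 (h.1.mul_pdeg_le hp A))
  have hB0 : 0 ≤ B.rank * E.pdeg w₀ - r * B.pdeg ((δ.compl d).restrict w₀) := by
    refine nonneg_of_mul_nonneg_right ?_ h2
    rw [hB]
    exact mul_nonneg hr.le (sub_nonneg.2 (h.2.mul_pdeg_le hp B))
  have hG : A.rank * E.pdeg w₀ - r * A.pdeg (δ.restrict w₀) +
      (B.rank * E.pdeg w₀ - r * B.pdeg ((δ.compl d).restrict w₀)) ≤ G.gap w₀ := by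
    rw [QPHB.Sub.gap, hrk, Nat.cast_add]
    nlinarith
  refine ⟨by linarith, fun hG0 => ⟨A, B, hrk, ?_, ?_, hmem, hpdeg⟩⟩
  · rcases Nat.eq_zero_or_pos A.rank with h0 | h0
    · exact Or.inl h0
    refine Or.inr (A.rank_le.antisymm (not_lt.1 fun hlt => ?_))
    have h7 := mul_pos hr (sub_pos.2 (h.1.mul_pdeg_lt A h0 hlt))
    rw [← hA] at h7
    have h8 := pos_of_mul_pos_right h7 h1.le
    linarith
  · rcases Nat.eq_zero_or_pos B.rank with h0 | h0
    · exact Or.inl h0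
    refine Or.inr (B.rank_le.antisymm (not_lt.1 fun hlt => ?_))
    have h7 := mul_pos hr (sub_pos.2 (h.2.mul_pdeg_lt B h0 hlt))
    rw [← hB] at h7
    have h8 := pos_of_mul_pos_right h7 h2.le
    linarith

end Extension

end ParHiggs

namespace ParHiggs

/-! ### Crossing a wall -/

variable {C : Curve} {n : ℕ} {p : Fin n → C.X} {r : ℕ} {d : ℤ}

namespace Extension

variable {δ : DiscreteData n r} {E : QPHB C p r}
  {Ep : QPHB C p δ.rk} {Em : QPHB C p (δ.compl d).rk}
  {w₀ : Weights n r} {Δp Δm : Set (Weights n r)}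

/-- If `E` is stable on the side of the wall where `E⁻` would destabilize it, then `E⁻` is not a
direct summand. -/
lemma not_isSplit_of_isStable (X : Extension d δ E Ep Em) (hE : E.degree = d)
    (hd' : Em.degree = (δ.compl d).deg) {w : Weights n r} (hs : E.IsStable w)
    (hw : 0 < δ.gap d w) (hw₀ : w₀ ∈ weightSpace n r) : ¬ X.IsSplit w₀ := fun h => by
  obtain ⟨G, h1, h2, h3⟩ := X.exists_sub_of_isSplit hw₀ h
  have h4 := QPHB.isStable_iff.1 hs G (h1 ▸ (δ.compl d).rk_pos) (h1 ▸ (δ.compl d).rk_lt)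
  rw [G.gap_eq hE h1 (h2.trans hd') h3, δ.gap_compl] at h4
  linarith

/-- A semistable bundle whose Jordan–Hölder factors are the terms of an extension has only one
subbundle with the discrete data of `E⁺`: another one would project isomorphically to the generic
stalk of `E⁻`, so `E⁺` and `E⁻` would have the same rank, and `pdeg E⁺ ≤ pdeg E⁻` for all weights;
but `E⁺` destabilizes `E` for weights in `Δ⁺`. -/
theorem range_inc_eq (X : Extension d δ E Ep Em) (hW : IsWallCrossing d δ w₀ Δp Δm)
    (hp : ∀ i, IsClosed ({p i} : Set C.X)) (hpi : Function.Injective p)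
    (hd : Ep.degree = δ.deg) (hE : E.degree = d) (h : X.TermsStable w₀)
    {wp : Weights n r} (hwp : wp ∈ Δp) {Ep' : QPHB C p δ.rk} {Em' : QPHB C p (δ.compl d).rk}
    (X' : Extension d δ E Ep' Em') (hd' : Ep'.degree = δ.deg) :
    LinearMap.range X.inc = LinearMap.range X'.inc := by
  have hw₀ := (δ.mem_wall_iff.1 hW.mem).1
  have hG : ∀ w, X'.subInc.gap w = δ.gap d w := X'.subInc_gap hd' hE
  obtain ⟨A, B, hrk, hA, hB, hmem, hpdeg⟩ := (X.exists_sub_sub_of_gap_eq_zero hp hpi hd hE hw₀ h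
    hW.gap_eq_zero X'.subInc).2 ((hG w₀).trans hW.gap_eq_zero)
  have hGrk : X'.subInc.rank = δ.rk := Ep'.rank_eq
  rcases hA with hA | hA
  · exfalso
    have h1 := hpdeg wp (hW.chamber_p.subset hwp)
    have h2 : B.rank = (δ.compl d).rk := hB.resolve_left fun hB => by
      have := δ.rk_pos
      omega
    have h3 : ((δ.compl d).rk : ℝ) = δ.rk := by
      exact_mod_cast (by omega : (δ.compl d).rk = δ.rk)
    rw [A.pdeg_eq_zero hp hA, B.pdeg_eq_of_rank_eq hp h2, zero_add] at h1
    have h4 := hG wp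
    have h5 := hW.gap_neg hwp
    have h6 := X.gap_eq hd hE wp
    have h7 := X.pdeg_add hp wp
    rw [δ.cast_compl_rk] at h3
    rw [QPHB.Sub.gap, hGrk] at h4
    have hr : (0 : ℝ) < δ.rk := by exact_mod_cast δ.rk_pos
    have h8 : (r : ℝ) = 2 * δ.rk := by linarith
    rw [h8] at h4 h6
    nlinarith
  · have hsurj : LinearMap.range A.incl = ⊤ := by
      refine Submodule.eq_top_of_finrank_eq ?_
      rw [LinearMap.finrank_range_of_inj A.incl_injective, A.finrank_eq, Ep.finrank_eq, hA,
        Ep.rank_eq]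
    refine Submodule.eq_of_le_of_finrank_eq ?_ ?_
    · rintro _ ⟨v, rfl⟩
      exact (hmem v).1 (hsurj ▸ Submodule.mem_top)
    · rw [LinearMap.finrank_range_of_inj X.inc_injective,
        LinearMap.finrank_range_of_inj X'.inc_injective, Ep.finrank_eq, Ep'.finrank_eq,
        Ep.rank_eq, Ep'.rank_eq]

/-- A nonsplit extension of PHBs which are stable on the wall is stable on the side where `E⁺`
does not destabilize it. -/
theorem isStable_of_not_isSplit (X : Extension d δ E Ep Em) (hW : IsWallCrossing d δ w₀ Δp Δm)
    (hp : ∀ i, IsClosed ({p i} : Set C.X)) (hpi : Function.Injective p)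
    (hd : Ep.degree = δ.deg) (hd' : Em.degree = (δ.compl d).deg) (hX : ¬ X.IsSplit w₀)
    (h : X.TermsStable w₀) {wm : Weights n r} (hwm : wm ∈ Δm) : E.IsStable wm := by
  have hE := X.degree_eq hd hd'
  have hw₀ := (δ.mem_wall_iff.1 hW.mem).1
  have hm := hW.gap_pos hwm
  rw [QPHB.isStable_iff]
  intro G h0 hr
  obtain ⟨h1, h2⟩ := X.exists_sub_sub_of_gap_eq_zero hp hpi hd hE hw₀ h hW.gap_eq_zero G
  rcases h1.lt_or_eq with h1 | h1
  · exact G.gap_pos_of_mem_closure hp hE h0 hr hW.chamber_m hW.adj_m h1 hwm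
  rcases G.data_of_gap_eq_zero hW hp hE h0 hr h1.symm with ⟨h3, h4, h5⟩ | ⟨h3, h4, h5⟩
  · rw [G.gap_eq hE h3 h4 h5]
    exact hm
  exfalso
  obtain ⟨A, B, hrk, hA, hB, hmem, hpdeg⟩ := h2 h1.symm
  rcases hA with hA | hA
  · refine hX (X.isSplit_of_sub hp G (fun v hv => ?_) h3 (by rw [hd', h4]) h5 hw₀)
    obtain ⟨a, rfl⟩ := (hmem v).2 hv
    have : Subsingleton A.V := by
      rw [← Module.finrank_eq_zero_iff_of_free (R := C.K), A.finrank_eq, hA]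
    rw [Subsingleton.elim a 0, map_zero]
  · -- `G` contains `E⁺` and has the same rank, so `pdeg G ≤ pdeg E⁺` for all weights; but for those
    -- in `Δ⁻` the gap of `E⁺` is positive, and that of `G` is its negative
    have h6 : B.rank = 0 := hB.resolve_right fun hB => by
      have := δ.rk_pos
      omega
    have h7 := hpdeg wm (hW.chamber_m.subset hwm)
    rw [A.pdeg_eq_of_rank_eq hp hA, B.pdeg_eq_zero hp h6, add_zero] at h7
    have h8 := G.gap_eq hE h3 h4 h5 wm
    have h9 := X.gap_eq hd hE wm
    have h10 : G.rank = δ.rk := by omega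
    have hr0 : (0 : ℝ) ≤ r := by positivity
    rw [δ.gap_compl, QPHB.Sub.gap, h10] at h8
    nlinarith

end Extension

/-- A PHB which is stable on one side of the wall only has a subbundle with the discrete data of the
wall, and the gaps of the sub-PHBs coming from the terms of the corresponding extension are
positive. -/
theorem QPHB.exists_extension_of_not_isStable {δ : DiscreteData n r} {E : QPHB C p r}
    {w₀ : Weights n r} {Δp Δm : Set (Weights n r)} (hW : IsWallCrossing d δ w₀ Δp Δm)
    (hp : ∀ i, IsClosed ({p i} : Set C.X)) (hE : E.degree = d) {wm wp : Weights n r}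
    (hwm : wm ∈ Δm) (hwp : wp ∈ Δp) (hm : E.IsStable wm) (hnp : ¬ E.IsStable wp) :
    ∃ (Ep : QPHB C p δ.rk) (Em : QPHB C p (δ.compl d).rk) (X : Extension d δ E Ep Em),
      Ep.degree = δ.deg ∧ Em.degree = (δ.compl d).deg ∧ X.GapsPos w₀ := by
  rw [isStable_iff] at hm hnp
  -- a gap which is positive on `Δ⁻` is not negative at the boundary point `w₀`
  have hnonneg : ∀ G : E.Sub, 0 < G.rank → G.rank < r → 0 ≤ G.gap w₀ := fun G h0 hr => by
    by_contra hneg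
    exact absurd (hm G h0 hr) (G.gap_neg_of_mem_closure hp hE h0 hr hW.chamber_m hW.adj_m
      (not_le.1 hneg) hwm).not_gt
  push Not at hnp
  obtain ⟨F, h0, hr, hF⟩ := hnp
  have hF0 : F.gap w₀ = 0 := ((hnonneg F h0 hr).eq_of_not_lt fun hpos =>
    absurd (F.gap_pos_of_mem_closure hp hE h0 hr hW.chamber_p hW.adj_p hpos hwp)
      (not_lt.2 hF)).symm
  obtain ⟨h1, h2, h3⟩ := (F.data_of_gap_eq_zero hW hp hE h0 hr hF0).resolve_right
    fun ⟨h1, h2, h3⟩ => by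
      rw [F.gap_eq hE h1 h2 h3, δ.gap_compl] at hF
      have := hW.gap_neg hwp
      linarith
  obtain ⟨Ep, Em, X, -, hd, hd'⟩ := exists_extension hp hE F h1 h2 h3
  refine ⟨Ep, Em, X, hd, hd', fun A h0 hr => ?_, fun B h0 hr => ?_⟩
  · exact lt_of_le_of_ne (hnonneg (X.incSub A) h0 (X.incSub_rank_lt A hr))
      (X.incSub_gap_ne_zero hW hp hE A h0 hr).symm
  · exact lt_of_le_of_ne
      (hnonneg (X.projSub B) (X.projSub_rank_pos hp B) (X.projSub_rank_lt hp B hr))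
      (X.projSub_gap_ne_zero hW hp hE B h0 hr).symm

end ParHiggs

theorem mainTheorem4 (C : Curve) {n : ℕ} (p : Fin n → C.X)
    (p_closed : ∀ i, IsClosed ({p i} : Set C.X)) (p_injective : Function.Injective p)
    {r : ℕ} (d : ℤ) (δ : DiscreteData n r) (w₀ : Weights n r) (Δp Δm : Set (Weights n r))
    (hW : IsWallCrossing d δ w₀ Δp Δm) :
    ∃ U ∈ 𝓝 w₀,
      (∀ E : QPHB C p r, E.degree = d →
        ∀ wm ∈ Δm, ∀ wp ∈ Δp, E.IsStable wm → ¬ E.IsStable wp →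
        ∃ (Ep : QPHB C p δ.rk) (Em : QPHB C p (δ.compl d).rk) (X : Extension d δ E Ep Em),
          X.IsNonsplitOfType w₀ ∧
          (∀ w ∈ Δp ∪ (U ∩ weightSpace n r), X.TermsStable w) ∧
          ∀ (Ep' : QPHB C p δ.rk) (Em' : QPHB C p (δ.compl d).rk)
            (X' : Extension d δ E Ep' Em'), X'.IsNonsplitOfType w₀ →
            (∃ w ∈ U ∩ weightSpace n r, X'.TermsStable w) → X.Equivalent X') ∧
      (∀ (E : QPHB C p r) (Ep : QPHB C p δ.rk) (Em : QPHB C p (δ.compl d).rk)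
        (X : Extension d δ E Ep Em), X.IsNonsplitOfType w₀ →
        (∃ w ∈ U ∩ weightSpace n r, X.TermsStable w) →
        (∀ w ∈ Δm, E.IsStable w) ∧ ∀ w ∈ Δp, ¬ E.IsSemistable w) := by
  obtain ⟨ε, hε, hU⟩ := δ.exists_ball_lt_gap hW.gap_eq_zero
  have hw₀ := (δ.mem_wall_iff.1 hW.mem).1
  refine ⟨Metric.ball w₀ ε, Metric.ball_mem_nhds w₀ hε, ?_, ?_⟩
  · intro E hE wm hwm wp hwp hm hnp
    obtain ⟨Ep, Em, X, hd, hd', hX⟩ :=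
      QPHB.exists_extension_of_not_isStable hW p_closed hE hwm hwp hm hnp
    refine ⟨Ep, Em, X,
      ⟨hd, hd', X.not_isSplit_of_isStable hE hd' hm (hW.gap_pos hwm) hw₀⟩, ?_, ?_⟩
    · rintro w (hw | hw)
      · exact hX.termsStable_of_gap_neg hW p_closed hd hE hw
      · exact hX.termsStable_of_mem p_closed hd hE (hU w hw.1)
    · intro Ep' Em' X' hX' _
      exact X.equivalent_of_range_eq X' (X.range_inc_eq hW p_closed p_injective hd hE
        (hX.termsStable_of_mem p_closed hd hE (hU w₀ (Metric.mem_ball_self hε))) hwp X' hX'.1)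
  · rintro E Ep Em X ⟨hd, hd', hX⟩ ⟨w, hw, hs⟩
    have hE := X.degree_eq hd hd'
    have hs₀ : X.TermsStable w₀ := (hs.gapsPos hW p_closed hd hE (hU w hw.1)).termsStable_of_mem
      p_closed hd hE (hU w₀ (Metric.mem_ball_self hε))
    refine ⟨fun wm hwm => X.isStable_of_not_isSplit hW p_closed p_injective hd hd' hX hs₀ hwm,
      fun wp hwp hss => ?_⟩
    have hrk : X.subInc.rank = δ.rk := Ep.rank_eq
    have h1 := hss.gap_nonneg X.subInc (by rw [hrk]; exact δ.rk_pos) (by rw [hrk]; exact δ.rk_lt)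
    rw [X.subInc_gap hd hE] at h1
    exact absurd (hW.gap_neg hwp) (not_lt.2 h1)
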